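/- **Definitions.** A *string* is an element of $2^{<\omega}$; $s\subseteq t$ means that $t$ extends $s$. A *perfect tree* is a non-empty set $T\subseteq 2^{<\omega}$, closed under initial segments, in which every string has an extension $t\in T$ with $t^\frown0,t^\frown1\in T$; $T{\restriction}s=\{t\in T: s\subseteq t\lor t\subseteq s\}$; $\operatorname{stem}(T)$ is the largest $s\in T$ with $T=T{\restriction}s$; $[T]\subseteq2^\omega$ is the set of paths through $T$. A *perfect-tree forcing* is a set $\mathbb P$ of perfect trees with $T{\restriction}s\in\mathbb P$ whenever $s\in T\in\mathbb P$. A *finite splitting system* over $\mathbb P$ of height $n<\omega$ is a family $\varphi=\langle T_s\rangle_{s\in2^{<n}}$ of trees of $\mathbb P$ such that $T_{s^\frown i}\subseteq T_s$ and $\operatorname{stem}(T_s)^\frown i\subseteq\operatorname{stem}(T_{s^\frown i})$ whenever $s^\frown i\in2^{<n}$, $i<2$; $\psi\preccurlyeq\varphi$ means that $\varphi$ extends $\psi$ as a function. Let $\theta$ be an ordinal and $\mathbb P=\langle\mathbb P_\xi\rangle_{\xi<\theta}$ a sequence of sets of trees. $\mathbf{MT}(\mathbb P)$ is the set of *multitrees*,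 the matrices $\mathbf T=\langle T_{\xi k}\rangle_{\xi<\theta,\,k<\omega}$ of trees whose *support* $|\mathbf T|=\{(\xi,k):T_{\xi k}\ne2^{<\omega}\}$ is finite and which satisfy $T_{\xi k}\in\mathbb P_\xi$ for all $(\xi,k)\in|\mathbf T|$; put $\mathbf S\le\mathbf T$ ($\mathbf S$ is stronger) iff $S_{\xi k}\subseteq T_{\xi k}$ for all $\xi,k$, and $[\mathbf T]=\{x\in(2^\omega)^{\theta\times\omega}:x(\xi,k)\in[T_{\xi k}]\text{ for }(\xi,k)\in|\mathbf T|\}$. If each $\mathbb P_\xi$ is a perfect-tree forcing, $\mathbf{MS}(\mathbb P)$ is the set of *multisystems*, the matrices $\Phi=\langle\varphi_{\xi m}\rangle_{\xi<\theta,\,m<\omega}$, where $\varphi_{\xi m}$ is a finite splitting system over $\mathbb P_\xi$, and all but finitely many $\varphi_{\xi m}$ are empty (of height $0$); $\Psi\preccurlyeq\Phi$ is componentwise extension. A set $D\subseteq\mathbf{MS}(\mathbb P)$ is dense if for every $\Psi\in\mathbf{MS}(\mathbb P)$ there is $\Phi\in D$ with $\Psi\preccurlyeq\Phi$. An *$\mathbf{MT}(\mathbb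 P)$-real name* is a system $\mathbf c=\langle C_n^i\rangle_{n<\omega,\,i<2}$ of sets $C_n^i\subseteq\mathbf{MT}(\mathbb P)$ such that each $C_n^0\cup C_n^1$ is pre-dense in $\mathbf{MT}(\mathbb P)$ and every element of $C_n^0$ is incompatible in $\mathbf{MT}(\mathbb P)$ with every element of $C_n^1$. The canonical name of the generic real $x_{\xi k}$ is $\boldsymbol\pi_{\xi k}=\langle\{\mathbf R_n^i\}\rangle_{n<\omega,\,i<2}$, where $\mathbf R_n^i$ has the tree $\{s:\operatorname{lh}s>n\Rightarrow s(n)=i\}$ at $(\xi,k)$ and $2^{<\omega}$ elsewhere. For such systems, a multitree $\mathbf T$ *directly forces* $\mathbf c(n)=i$ if $[\mathbf T]\subseteq\bigcup_{\mathbf S\in\Sigma}[\mathbf S]$ for some finite $\Sigma\subseteq C_n^i$; it directly forces $s\subset\mathbf c$ if it directly forces $\mathbf c(n)=s(n)$ for all $n<\operatorname{lh}s$; it directly forces $\mathbf c\ne\mathbf d$ if there are incomparable strings $s,t$ such that it directly forces $s\subset\mathbf c$ and $t\subset\mathbf d$; it directly forces $\mathbf c\notin[S]$ if it directly forces $s\subset\mathbf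 c$ for some string $s\notin S$. $\mathrm{ZFC}'$ is $\mathrm{ZFC}$ without the power set axiom, plus the axiom that $\mathcal P(\omega)$ exists. **Theorem K.** Let $M$ be a countable transitive model of $\mathrm{ZFC}'$, and let $\mathbb P=\langle\mathbb P_\xi\rangle_{\xi<\theta}\in M$ be a sequence of non-empty perfect-tree forcings. Let $\langle\Phi^j\rangle_{j<\omega}$, $\Phi^j=\langle\varphi^j_{\xi m}\rangle_{\xi<\theta,\,m<\omega}$, be a $\preccurlyeq$-increasing sequence of elements of $\mathbf{MS}(\mathbb P)$, generic over $M$: it meets every $D\in M$, $D\subseteq\mathbf{MS}(\mathbb P)$, that is dense in $\mathbf{MS}(\mathbb P)$. For $\xi<\theta$, $m<\omega$ let $\langle T^\infty_{\xi m}(s)\rangle_{s\in2^{<\omega}}=\bigcup_j\varphi^j_{\xi m}$, and let $$U_{\xi m}(s)=\bigcap_{n\ge\operatorname{lh}s}\ \bigcup_{t\in2^n,\ s\subseteq t}T^\infty_{\xi m}(t),\qquad \mathbb U_\xi=\{U_{\xi m}(s):m<\omega,\ s\in2^{<\omega}\},$$ $\mathbb U=\langle\mathbb U_\xi\rangle_{\xi<\theta}$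 and $\mathbb P\lor\mathbb U=\langle\mathbb P_\xi\cup\mathbb U_\xi\rangle_{\xi<\theta}$. Suppose that $\eta<\theta$, that $\mathbf c=\langle C_n^i\rangle_{n<\omega,\,i<2}\in M$ is an $\mathbf{MT}(\mathbb P)$-real name, and that for every $k<\omega$ the set $$D(k)=\{\mathbf T\in\mathbf{MT}(\mathbb P):\mathbf T\text{ directly forces }\mathbf c\ne\boldsymbol\pi_{\eta k}\}$$ is dense in $\mathbf{MT}(\mathbb P)$. Let $\mathbf u\in\mathbf{MT}(\mathbb P\lor\mathbb U)$ and $U\in\mathbb U_\eta$. Then there is a stronger multitree $\mathbf v\in\mathbf{MT}(\mathbb U)$, $\mathbf v\le\mathbf u$, which directly forces $\mathbf c\notin[U]$. -/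

import Mathlib

open Set FirstOrder

noncomputable section

namespace Jensen

/-! ## Countable transitive models -/

/-- The only symbol of the language of set theory: a binary relation symbol. -/
inductive MemRel : ℕ → Type
  | mem : MemRel 2

/-- The first-order language of set theory. -/
def setLang : Language := ⟨fun _ => Empty, MemRel⟩

/-- A set (or class) `M` of sets as a structure with the true membership relation. -/
instance memStructure (M : Set ZFSet.{0}) : setLang.Structure M where
  funMap := fun f _ => f.elim
  RelMap := fun r => match r with
    | MemRel.mem => fun v => (v 0 : ZFSet.{0}) ∈ (v 1 : ZFSet.{0})

/-- `x` is an inductive set in the sense of `M`. -/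
def IsInductiveIn (M : Set ZFSet.{0}) (x : M) : Prop :=
  (∃ e : M, (∀ z : M, z.1 ∉ e.1) ∧ e.1 ∈ x.1) ∧
    ∀ y : M, y.1 ∈ x.1 →
      ∃ s : M, (∀ z : M, z.1 ∈ s.1 ↔ z.1 ∈ y.1 ∨ z = y) ∧ s.1 ∈ x.1

/-- `x` is the set of natural numbers in the sense of `M`. -/
def IsOmegaIn (M : Set ZFSet.{0}) (x : M) : Prop :=
  IsInductiveIn M x ∧ ∀ y : M, IsInductiveIn M y → ∀ z : M, z.1 ∈ x.1 → z.1 ∈ y.1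

/-- `M`, with the true membership relation, satisfies `ZFC'`: all axioms of `ZFC` other than the
power set axiom, together with the existence of the power set of `ω`. All quantifiers range
over `M`; the two schemes range over all classes that are first-order definable over `M` from
parameters in `M`. -/
structure ModelsZFC' (M : Set ZFSet.{0}) : Prop where
  extensionality : ∀ x y : M, (∀ z : M, z.1 ∈ x.1 ↔ z.1 ∈ y.1) → x = y
  foundation : ∀ x : M, (∃ y : M, y.1 ∈ x.1) →
    ∃ y : M, y.1 ∈ x.1 ∧ ∀ z : M, z.1 ∈ x.1 → z.1 ∉ y.1
  pairing : ∀ x y : M, ∃ p : M, ∀ z : M, z.1 ∈ p.1 ↔ z = x ∨ z = y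
  union : ∀ x : M, ∃ v : M, ∀ z : M, z.1 ∈ v.1 ↔ ∃ y : M, y.1 ∈ x.1 ∧ z.1 ∈ y.1
  infinity : ∃ x : M, IsInductiveIn M x
  separation : ∀ C : Set M, (univ : Set M).Definable₁ setLang C →
    ∀ x : M, ∃ y : M, ∀ z : M, z.1 ∈ y.1 ↔ z.1 ∈ x.1 ∧ z ∈ C
  replacement : ∀ R : Set (M × M), (univ : Set M).Definable₂ setLang R →
    ∀ x : M, (∀ y : M, y.1 ∈ x.1 → ∃! z : M, (y, z) ∈ R) →
      ∃ v : M, ∀ z : M, z.1 ∈ v.1 ↔ ∃ y : M, y.1 ∈ x.1 ∧ (y, z) ∈ R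
  choice : ∀ x : M, (∀ y : M, y.1 ∈ x.1 → ∃ z : M, z.1 ∈ y.1) →
    (∀ y y' : M, y.1 ∈ x.1 → y'.1 ∈ x.1 → (∃ z : M, z.1 ∈ y.1 ∧ z.1 ∈ y'.1) → y = y') →
      ∃ c : M, ∀ y : M, y.1 ∈ x.1 → ∃! z : M, z.1 ∈ y.1 ∧ z.1 ∈ c.1
  power_omega : ∃ w p : M, IsOmegaIn M w ∧
    ∀ x : M, x.1 ∈ p.1 ↔ ∀ z : M, z.1 ∈ x.1 → z.1 ∈ w.1

/-- `M` is a countable transitive model of `ZFC'`. -/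
structure IsCTM (M : Set ZFSet.{0}) : Prop where
  countable : M.Countable
  transitive : ∀ x ∈ M, ∀ y ∈ x, y ∈ M
  models : ModelsZFC' M

/-! ## Trees -/

/-- Finite strings of zeros (`false`) and ones (`true`). -/
abbrev Str := List Bool

/-- `T` is a tree: a set of strings closed under initial segments. -/
def IsTree (T : Set Str) : Prop :=
  ∀ s t : Str, s <+: t → t ∈ T → s ∈ T

/-- `T↾s`: the part of `T` that consists of the strings comparable with `s`. -/
def restr (T : Set Str) (s : Str) : Set Str :=
  {t ∈ T | s <+: t ∨ t <+: s}

/-- `T` is a perfect tree: a non-empty tree in which every string has a splitting extension. -/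
def IsPerfectTree (T : Set Str) : Prop :=
  T.Nonempty ∧ IsTree T ∧ ∀ s ∈ T, ∃ t ∈ T, s <+: t ∧ ∀ i : Bool, t ++ [i] ∈ T

/-- `r` is the stem of `T`: the largest string `s ∈ T` with `T = T↾s`. -/
def IsStem (T : Set Str) (r : Str) : Prop :=
  r ∈ T ∧ T = restr T r ∧ ∀ s ∈ T, T = restr T s → s <+: r

/-- `[T]`: the set of all paths through `T`. -/
def paths (T : Set Str) : Set (ℕ → Bool) :=
  {a | ∀ n : ℕ, (List.range n).map a ∈ T}

/-- `P` is a perfect-tree forcing notion. -/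
def IsPTF (P : Set (Set Str)) : Prop :=
  (∀ T ∈ P, IsPerfectTree T) ∧ ∀ T ∈ P, ∀ s ∈ T, restr T s ∈ P

/-! ## Splitting systems -/

/-- A family of sets of strings indexed by the strings of length `< height`. The value of `tree`
at the other strings is irrelevant and is required to be empty. -/
@[ext] structure Sys where
  height : ℕ
  tree : Str → Set Str
  tree_eq_empty : ∀ s : Str, height ≤ s.length → tree s = ∅

/-- `φ` is a finite splitting system over `P`. -/
def IsFSS (P : Set (Set Str)) (φ : Sys) : Prop :=
  (∀ s : Str, s.length < φ.height → φ.tree s ∈ P) ∧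
    ∀ (s : Str) (i : Bool), (s ++ [i]).length < φ.height →
      φ.tree (s ++ [i]) ⊆ φ.tree s ∧
        ∃ r r' : Str, IsStem (φ.tree s) r ∧ IsStem (φ.tree (s ++ [i])) r' ∧ r ++ [i] <+: r'

/-- `ψ ≼ φ`: the system `φ` extends `ψ`. -/
def Sys.ExtendedBy (ψ φ : Sys) : Prop :=
  ψ.height ≤ φ.height ∧ ∀ s : Str, s.length < ψ.height → ψ.tree s = φ.tree s

/-! ## Multitrees and multisystems -/

/-- Matrices `⟨a ξ k⟩` with `ξ < θ` and `k < ω`. -/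
abbrev Mat (θ : Ordinal.{0}) (α : Type) := Iio θ → ℕ → α

/-- The support of a matrix of trees: the places where the tree is not the full binary tree. -/
def treeSupp {θ : Ordinal.{0}} (T : Mat θ (Set Str)) : Set (Iio θ × ℕ) :=
  {p | T p.1 p.2 ≠ univ}

/-- `MT(P)`, the finite support product of `ω` copies of each `P ξ`: the support is finite,
the trees in the support belong to `P ξ`, and the other ones are the full binary tree. -/
def MT {θ : Ordinal.{0}} (P : Iio θ → Set (Set Str)) : Set (Mat θ (Set Str)) :=
  {T | (treeSupp T).Finite ∧ ∀ p ∈ treeSupp T, T p.1 p.2 ∈ P p.1}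

/-- The order of multitrees: `S` is stronger than `T`. -/
def Stronger {θ : Ordinal.{0}} (S T : Mat θ (Set Str)) : Prop :=
  ∀ ξ k, S ξ k ⊆ T ξ k

/-- The cube `[T]` of all matrices of reals with `x ξ k ∈ [T ξ k]` on the support of `T`. -/
def cube {θ : Ordinal.{0}} (T : Mat θ (Set Str)) : Set (Mat θ (ℕ → Bool)) :=
  {x | ∀ p ∈ treeSupp T, x p.1 p.2 ∈ paths (T p.1 p.2)}

/-- `MS(P)`, the set of all `P`-multisystems: finitely many systems are non-empty. -/
def MS {θ : Ordinal.{0}} (P : Iio θ → Set (Set Str)) : Set (Mat θ Sys) :=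
  {Φ | {p : Iio θ × ℕ | (Φ p.1 p.2).height ≠ 0}.Finite ∧ ∀ ξ m, IsFSS (P ξ) (Φ ξ m)}

/-- `Ψ ≼ Φ`: the multisystem `Φ` extends `Ψ`, componentwise. -/
def MSExtendedBy {θ : Ordinal.{0}} (Ψ Φ : Mat θ Sys) : Prop :=
  ∀ ξ m, (Ψ ξ m).ExtendedBy (Φ ξ m)

/-! ## The objects above as sets of the universe of sets

Finite ordinals code numbers and truth values, functions are sets of Kuratowski pairs. -/

/-- The set of the codes of the elements of `S`. -/
def setCode {α : Type*} [Small.{0} α] (c : α → ZFSet.{0}) (S : Set α) : ZFSet.{0} :=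
  ZFSet.range fun x : S => c x

/-- The function `f` with domain `D` as a set of ordered pairs of codes. -/
def funCode {α : Type*} {β : Type*} [Small.{0} α] (c : α → ZFSet.{0}) (d : β → ZFSet.{0})
    (D : Set α) (f : α → β) : ZFSet.{0} :=
  ZFSet.range fun x : D => ZFSet.pair (c x) (d (f x))

/-- A natural number as a von Neumann ordinal. -/
def natCode (n : ℕ) : ZFSet.{0} := (n : Ordinal.{0}).toZFSet

/-- The code of `false` is `0` and the code of `true` is `1`. -/
def boolCode (b : Bool) : ZFSet.{0} := natCode b.toNat

/-- A string of length `n` as a function from `n` to `2`. -/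
def strCode (s : Str) : ZFSet.{0} :=
  ZFSet.range fun i : Fin s.length => ZFSet.pair (natCode i) (boolCode (s.get i))

/-- A tree as a set of strings. -/
def treeCode (T : Set Str) : ZFSet.{0} := setCode strCode T

/-- A system as a function that is defined on the strings of length `< height`. -/
def sysCode (φ : Sys) : ZFSet.{0} :=
  funCode strCode treeCode {s | s.length < φ.height} φ.tree

/-- A matrix as a function that is defined on `θ × ω`. -/
def matCode {θ : Ordinal.{0}} {α : Type} (c : α → ZFSet.{0}) (A : Mat θ α) : ZFSet.{0} :=
  funCode (fun p : Iio θ × ℕ => ZFSet.pair p.1.1.toZFSet (natCode p.2)) c univ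
    fun p => A p.1 p.2

instance small_sys : Small.{0} Sys := small_of_injective (β := ℕ × (Str → Set Str))
  (f := fun φ => (φ.height, φ.tree))
  fun _ _ h => Sys.ext (congrArg Prod.fst h) (congrArg Prod.snd h)

/-- A sequence `⟨P ξ⟩` of sets of trees as a function that is defined on `θ`. -/
def seqCode {θ : Ordinal.{0}} (P : Iio θ → Set (Set Str)) : ZFSet.{0} :=
  funCode (fun ξ : Iio θ => ξ.1.toZFSet) (setCode treeCode) univ P

/-- A set of multisystems. -/
def msSetCode {θ : Ordinal.{0}} (D : Set (Mat θ Sys)) : ZFSet.{0} :=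
  setCode (matCode sysCode) D

/-- A system `⟨c n i⟩`, with `n < ω` and `i < 2`, of sets of multitrees as a function that is
defined on `ω × 2`. -/
def nameCode {θ : Ordinal.{0}} (c : ℕ → Bool → Set (Mat θ (Set Str))) : ZFSet.{0} :=
  funCode (fun p : ℕ × Bool => ZFSet.pair (natCode p.1) (boolCode p.2))
    (setCode (matCode treeCode)) univ fun p => c p.1 p.2

/-! ## Generic sequences of multisystems, and the extension that they define -/

/-- `D` is dense in `MS(P)`. -/
def MSDense {θ : Ordinal.{0}} (P : Iio θ → Set (Set Str)) (D : Set (Mat θ Sys)) : Prop :=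
  ∀ Ψ ∈ MS P, ∃ Φ ∈ D, MSExtendedBy Ψ Φ

/-- `Φ` is an increasing sequence of `P`-multisystems which is generic over `M`: it intersects
every set `D ∈ M`, `D ⊆ MS(P)`, that is dense in `MS(P)`. -/
structure IsGenericSeq {θ : Ordinal.{0}} (M : Set ZFSet.{0}) (P : Iio θ → Set (Set Str))
    (Φ : ℕ → Mat θ Sys) : Prop where
  mem : ∀ j, Φ j ∈ MS P
  increasing : ∀ j, MSExtendedBy (Φ j) (Φ (j + 1))
  generic : ∀ D : Set (Mat θ Sys), D ⊆ MS P → msSetCode D ∈ M → MSDense P D → ∃ j, Φ j ∈ D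

/-- The value at `s` of the limit system `⋃ j, Φ j ξ m`. -/
def limTree {θ : Ordinal.{0}} (Φ : ℕ → Mat θ Sys) (ξ : Iio θ) (m : ℕ) (s : Str) : Set Str :=
  ⋃ (j : ℕ) (_ : s.length < (Φ j ξ m).height), (Φ j ξ m).tree s

/-- The intersection over `n ≥ lh s` of the unions of the limit trees at the strings of length
`n` that extend `s`. -/
def genTree {θ : Ordinal.{0}} (Φ : ℕ → Mat θ Sys) (ξ : Iio θ) (m : ℕ) (s : Str) : Set Str :=
  ⋂ (n : ℕ) (_ : s.length ≤ n), ⋃ (t : Str) (_ : t.length = n ∧ s <+: t), limTree Φ ξ m t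

/-- The sequence `U` of sets of trees that is defined by the sequence `Φ` of multisystems. -/
def genExt {θ : Ordinal.{0}} (Φ : ℕ → Mat θ Sys) : Iio θ → Set (Set Str) :=
  fun ξ => {T | ∃ (m : ℕ) (s : Str), T = genTree Φ ξ m s}

/-- `P ∨ U`, the componentwise union. -/
def join {θ : Ordinal.{0}} (P U : Iio θ → Set (Set Str)) : Iio θ → Set (Set Str) :=
  fun ξ => P ξ ∪ U ξ

/-! ## Real names and direct forcing -/

/-- `S` and `T` are compatible in `MT(P)`. -/
def MTCompatible {θ : Ordinal.{0}} (P : Iio θ → Set (Set Str)) (S T : Mat θ (Set Str)) : Prop :=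
  ∃ R ∈ MT P, Stronger R S ∧ Stronger R T

/-- `C` is pre-dense in `MT(P)`. -/
def MTPredense {θ : Ordinal.{0}} (P : Iio θ → Set (Set Str)) (C : Set (Mat θ (Set Str))) :
    Prop :=
  ∀ T ∈ MT P, ∃ S ∈ C, MTCompatible P S T

/-- `D` is dense in `MT(P)`. -/
def MTDense {θ : Ordinal.{0}} (P : Iio θ → Set (Set Str)) (D : Set (Mat θ (Set Str))) : Prop :=
  ∀ T ∈ MT P, ∃ S ∈ D, Stronger S T

/-- `c` is an `MT(P)`-real name. -/
structure IsRealName {θ : Ordinal.{0}} (P : Iio θ → Set (Set Str))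
    (c : ℕ → Bool → Set (Mat θ (Set Str))) : Prop where
  subset : ∀ n i, c n i ⊆ MT P
  predense : ∀ n, MTPredense P (c n false ∪ c n true)
  incompatible : ∀ n, ∀ S ∈ c n false, ∀ T ∈ c n true, ¬ MTCompatible P S T

/-- The tree of all strings `s` with `s(n) = i` if `lh s > n`. -/
def digitTree (n : ℕ) (i : Bool) : Set Str :=
  {s | ∀ h : n < s.length, s[n] = i}

open Classical in
/-- The canonical name of the generic real `x ξ k`: for each `n` and `i` a single matrix,
with the support `{(ξ, k)}`. -/
def genName {θ : Ordinal.{0}} (ξ : Iio θ) (k : ℕ) : ℕ → Bool → Set (Mat θ (Set Str)) :=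
  fun n i => {fun ζ l => if ζ = ξ ∧ l = k then digitTree n i else univ}

/-- `T` directly forces `c(n) = i`. -/
def ForcesValue {θ : Ordinal.{0}} (T : Mat θ (Set Str))
    (c : ℕ → Bool → Set (Mat θ (Set Str))) (n : ℕ) (i : Bool) : Prop :=
  ∃ F : Set (Mat θ (Set Str)), F.Finite ∧ F ⊆ c n i ∧ cube T ⊆ ⋃ S ∈ F, cube S

/-- `T` directly forces `s ⊂ c`. -/
def ForcesPrefix {θ : Ordinal.{0}} (T : Mat θ (Set Str)) (s : Str)
    (c : ℕ → Bool → Set (Mat θ (Set Str))) : Prop :=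
  ∀ (n : ℕ) (h : n < s.length), ForcesValue T c n s[n]

/-- `T` directly forces `d ≠ c`. -/
def ForcesNe {θ : Ordinal.{0}} (T : Mat θ (Set Str))
    (d c : ℕ → Bool → Set (Mat θ (Set Str))) : Prop :=
  ∃ s t : Str, ¬ s <+: t ∧ ¬ t <+: s ∧ ForcesPrefix T s c ∧ ForcesPrefix T t d

/-- `T` directly forces `c ∉ [S]`. -/
def ForcesNotMem {θ : Ordinal.{0}} (T : Mat θ (Set Str))
    (c : ℕ → Bool → Set (Mat θ (Set Str))) (S : Set Str) : Prop :=
  ∃ s : Str, s ∉ S ∧ ForcesPrefix T s c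

end Jensen

end

open Jensen

/-!
The multitree `v` is read off from one multisystem `Φ j` of the generic sequence, which is found by
genericity in a dense set `D ∈ M`. Let `U` be part of the generic tree of the system `(η, m)`. Every
place `(ξ, k)` of a multitree is assigned to a branch of a system `(ξ, m')` in such a way that the
places in the support of `u` follow branches through the nodes that define `u`, and that different
places follow different branches (`Assignment`, `exists_assignment`). A multisystem `A` then defines
a multitree `a.tree A`. It belongs to `D` (`Decides`) if this multitree forces an initial segment `s`
of the real named by `c`, and `s` is outside of all trees at some level of the system `(η, m)` of
`A`. If `Φ j ∈ D`, then the generic trees at the nodes that are used by `Φ j` form the multitree `v`.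

The set `D` is dense (`msDense_decides`). Given a multisystem, all its systems are extended to a
common height for which the nodes at the top level on different branches are different. The top
trees on the branches form a multitree; it is strengthened until it forces a string `s` outside of
the trees at its finitely many places over `η` that are concerned, which is possible because
`D(k)` is dense, and the other top trees of the system `(η, m)`, which are not part of the
multitree, are shrunk so that they avoid `s` as well (`MT.exists_avoid`). Direct forcing by a finite
cover is reduced to the existence of a single weaker multitree by `MT.exists_of_cover`. Finally the
top trees are replaced by the smaller ones (`IsFSS.exists_replace`). A second dense set, of the
multisystems in which a given tree of `P ξ` is at the root of some system, shows that every tree of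
`P ξ` includes a generic tree.

The other half of the proof is that these dense sets belong to `M`. Relations and functions that are
definable over `M` are closed under the logical operations, bounded quantification, pairs and the
like (`Dfn`, `DfnT`), which makes separation and replacement applicable. The power set of a set
need not exist in `M`, but the set of its finite subsets does (`IsCTM.finSubsets_mem`). A splitting
system over `P ξ` is a finite set of pairs, and a multisystem differs from the empty one by
finitely many pairs, so that the set of all multisystems is in `M` (`IsCTM.msSetCode_mem`), and the
dense sets are obtained from it by separation (`IsCTM.rootSet_mem`, `IsCTM.decides_mem`).
-/

noncomputable section

namespace Jensen

/-! ### Relations and functions definable over a transitive model -/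

/-- The relation `R` between sets is first-order definable over `M`, with parameters in `M`. Only
the values of `R` at the elements of `M` matter. Relations are functions of a tuple `v`, so that a
proof of definability can follow the syntax of the relation. -/
def Dfn (M : Set ZFSet.{0}) {n : ℕ} (R : (Fin n → ZFSet.{0}) → Prop) : Prop :=
  (univ : Set M).Definable setLang {v : Fin n → M | R fun i => v i}

/-- `M` is closed under the function `f`, whose restriction to `M` is first-order definable over
`M`, with parameters in `M`. -/
structure DfnT (M : Set ZFSet.{0}) {n : ℕ} (f : (Fin n → ZFSet.{0}) → ZFSet.{0}) : Prop where
  closed : ∀ v : Fin n → ZFSet.{0}, (∀ i, v i ∈ M) → f v ∈ M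
  graph : Dfn M fun w : Fin (n + 1) → ZFSet.{0} => w 0 = f fun i => w i.succ

namespace Dfn

variable {M : Set ZFSet.{0}} {n k : ℕ} {R S : (Fin n → ZFSet.{0}) → Prop}

theorem congr (h : Dfn M R) (hRS : ∀ v, (∀ i, v i ∈ M) → (R v ↔ S v)) : Dfn M S := by
  have : {v : Fin n → M | S fun i => v i} = {v : Fin n → M | R fun i => v i} := by
    ext v
    exact (hRS _ fun i => (v i).2).symm
  rw [Dfn, this]
  exact h

theorem not (h : Dfn M R) : Dfn M fun v => ¬ R v := h.compl

theorem and (h : Dfn M R) (h' : Dfn M S) : Dfn M fun v => R v ∧ S v := h.inter h'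

theorem or (h : Dfn M R) (h' : Dfn M S) : Dfn M fun v => R v ∨ S v := h.union h'

theorem imp (h : Dfn M R) (h' : Dfn M S) : Dfn M fun v => R v → S v :=
  (h.not.or h').congr fun _ _ => imp_iff_not_or.symm

theorem iff (h : Dfn M R) (h' : Dfn M S) : Dfn M fun v => (R v ↔ S v) :=
  ((h.imp h').and (h'.imp h)).congr fun _ _ => iff_iff_implies_and_implies.symm

theorem rename (h : Dfn M R) (σ : Fin n → Fin k) : Dfn M fun w => R fun i => w (σ i) :=
  Definable.preimage_comp σ h

/-- Variables are de Bruijn indices: under a quantifier, the bound variable is `w 0`, and the other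
variables are shifted by one. -/
theorem ex {Q : (Fin n → ZFSet.{0}) → ZFSet.{0} → Prop}
    (h : Dfn M fun w : Fin (n + 1) → ZFSet.{0} => Q (fun i => w i.succ) (w 0)) :
    Dfn M fun v => ∃ x ∈ M, Q v x := by
  rw [Dfn]
  convert Definable.image_comp h Fin.succ
  ext v
  constructor
  · rintro ⟨x, hx, hQ⟩
    exact ⟨Fin.cons ⟨x, hx⟩ v, by simpa using hQ, by ext; simp⟩
  · rintro ⟨w, hw, rfl⟩
    exact ⟨w 0, (w 0).2, hw⟩

theorem all {Q : (Fin n → ZFSet.{0}) → ZFSet.{0} → Prop}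
    (h : Dfn M fun w : Fin (n + 1) → ZFSet.{0} => Q (fun i => w i.succ) (w 0)) :
    Dfn M fun v => ∀ x ∈ M, Q v x :=
  (ex (Q := fun v x => ¬ Q v x) h.not).not.congr fun _ _ => by push Not; rfl

theorem mem_var (i j : Fin n) : Dfn M fun v => v i ∈ v j := by
  refine ⟨Language.Relations.formula₂ (L := setLang[[(univ : Set M)]])
    (Sum.inl MemRel.mem) (Language.Term.var i) (Language.Term.var j), ?_⟩
  ext v
  simp only [mem_ofPred_eq]
  rfl

theorem eq_var (i j : Fin n) : Dfn M fun v => v i = v j := by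
  refine ⟨Language.Term.equal (Language.Term.var i) (Language.Term.var j), ?_⟩
  ext v
  simp only [mem_ofPred_eq, Language.Formula.realize_equal, Language.Term.realize_var]
  exact Subtype.coe_inj

theorem eq_var_const {a : ZFSet.{0}} (ha : a ∈ M) (i : Fin n) : Dfn M fun v => v i = a := by
  have h := (Definable.singleton (L := setLang) (⟨a, ha⟩ : M)).mono (subset_univ _)
  rw [Dfn]
  convert h.preimage_comp fun _ : Fin 1 => i
  ext v
  exact (Subtype.ext_iff (a1 := v i) (a2 := ⟨a, ha⟩)).symm

theorem subst {Q : (Fin n → ZFSet.{0}) → ZFSet.{0} → Prop} {f : (Fin n → ZFSet.{0}) → ZFSet.{0}}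
    (hf : DfnT M f)
    (h : Dfn M fun w : Fin (n + 1) → ZFSet.{0} => Q (fun i => w i.succ) (w 0)) :
    Dfn M fun v => Q v (f v) :=
  (ex (Q := fun v x => x = f v ∧ Q v x) (hf.graph.and h)).congr fun v hv =>
    ⟨fun ⟨_, _, hx, hQ⟩ => hx ▸ hQ, fun hQ => ⟨_, hf.closed v hv, rfl, hQ⟩⟩

end Dfn

namespace DfnT

variable {M : Set ZFSet.{0}} {n k : ℕ} {f g : (Fin n → ZFSet.{0}) → ZFSet.{0}}

theorem var (i : Fin n) : DfnT M fun v => v i := ⟨fun _ h => h i, Dfn.eq_var 0 i.succ⟩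

theorem const {a : ZFSet.{0}} (ha : a ∈ M) : DfnT M fun _ : Fin n → ZFSet.{0} => a :=
  ⟨fun _ _ => ha, Dfn.eq_var_const ha 0⟩

theorem weaken (hf : DfnT M f) : DfnT M fun w : Fin (n + 1) → ZFSet.{0} => f fun i => w i.succ :=
  ⟨fun _ hv => hf.closed _ fun i => hv i.succ,
    hf.graph.rename (Fin.cons 0 fun i => i.succ.succ)⟩

theorem mem (hf : DfnT M f) (hg : DfnT M g) : Dfn M fun v => f v ∈ g v :=
  Dfn.subst (Q := fun v x => x ∈ g v) hf
    (Dfn.subst (Q := fun v x => v 0 ∈ x) hg.weaken (Dfn.mem_var 1 0))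

theorem eq (hf : DfnT M f) (hg : DfnT M g) : Dfn M fun v => f v = g v :=
  Dfn.subst (Q := fun v x => f v = x) hg (Dfn.subst (Q := fun v x => x = v 0) hf.weaken
    (Dfn.eq_var 0 1))

theorem congr (hf : DfnT M f) (h : ∀ v, (∀ i, v i ∈ M) → f v = g v) : DfnT M g :=
  ⟨fun _ hv => h _ hv ▸ hf.closed _ hv, hf.graph.congr fun w hw => by
    rw [h _ fun i => hw i.succ]⟩

end DfnT

section Transitive

variable {M : Set ZFSet.{0}} {n : ℕ} {f g : (Fin n → ZFSet.{0}) → ZFSet.{0}}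

theorem IsCTM.mem_of_mem (hM : IsCTM M) {x y : ZFSet.{0}} (hx : x ∈ M) (hy : y ∈ x) : y ∈ M :=
  hM.transitive x hx y hy

theorem Dfn.bex (hM : IsCTM M) {Q : (Fin n → ZFSet.{0}) → ZFSet.{0} → Prop} (hf : DfnT M f)
    (h : Dfn M fun w : Fin (n + 1) → ZFSet.{0} => Q (fun i => w i.succ) (w 0)) :
    Dfn M fun v => ∃ x ∈ f v, Q v x :=
  (Dfn.ex (Q := fun v x => x ∈ f v ∧ Q v x) (((DfnT.var 0).mem hf.weaken).and h)).congr
    fun v hv => ⟨fun ⟨x, _, hx⟩ => ⟨x, hx⟩, fun ⟨x, hx, hQ⟩ =>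
      ⟨x, hM.mem_of_mem (hf.closed v hv) hx, hx, hQ⟩⟩

theorem Dfn.ball (hM : IsCTM M) {Q : (Fin n → ZFSet.{0}) → ZFSet.{0} → Prop} (hf : DfnT M f)
    (h : Dfn M fun w : Fin (n + 1) → ZFSet.{0} => Q (fun i => w i.succ) (w 0)) :
    Dfn M fun v => ∀ x ∈ f v, Q v x :=
  (Dfn.bex hM (Q := fun v x => ¬ Q v x) hf h.not).not.congr fun _ _ => by push Not; rfl

theorem DfnT.subset (hM : IsCTM M) (hf : DfnT M f) (hg : DfnT M g) : Dfn M fun v => f v ⊆ g v :=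
  Dfn.ball hM (Q := fun v x => x ∈ g v) hf ((DfnT.var 0).mem hg.weaken)

/-- A function is definable if its values are in `M` and membership in its values is definable. -/
theorem DfnT.of_mem (hM : IsCTM M) (hc : ∀ v : Fin n → ZFSet.{0}, (∀ i, v i ∈ M) → f v ∈ M)
    (h : Dfn M fun w : Fin (n + 1) → ZFSet.{0} => w 0 ∈ f fun i => w i.succ) : DfnT M f := by
  refine ⟨hc, (Dfn.all (Q := fun w x => x ∈ w 0 ↔ x ∈ f fun i => w i.succ)
    (((DfnT.var 0).mem (DfnT.var 1)).iff (h.rename (Fin.cons 0 fun i => i.succ.succ)))).congr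
      fun w hw => ⟨fun hx => ?_, fun hx _ _ => by rw [hx]⟩⟩
  ext z
  constructor
  · exact fun hz => (hx z (hM.mem_of_mem (hw 0) hz)).1 hz
  · exact fun hz => (hx z (hM.mem_of_mem (hc _ fun i => hw i.succ) hz)).2 hz

/-- A set of elements of `M` is in `M` if some element of `M` has the same elements in `M`. -/
theorem IsCTM.mem_of_forall (hM : IsCTM M) {x y : ZFSet.{0}} (hy : y ∈ M) (hx : ∀ z ∈ x, z ∈ M)
    (h : ∀ z ∈ M, z ∈ y ↔ z ∈ x) : x ∈ M := by
  have : x = y := by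
    ext z
    exact ⟨fun hz => (h z (hx z hz)).2 hz, fun hz => (h z (hM.mem_of_mem hy hz)).1 hz⟩
  exact this ▸ hy

theorem IsCTM.pair_mem (hM : IsCTM M) {x y : ZFSet.{0}} (hx : x ∈ M) (hy : y ∈ M) :
    ({x, y} : ZFSet.{0}) ∈ M := by
  obtain ⟨p, hp⟩ := hM.models.pairing ⟨x, hx⟩ ⟨y, hy⟩
  refine hM.mem_of_forall p.2 (fun z hz => ?_) fun z hz => ?_
  · rcases ZFSet.mem_pair.1 hz with rfl | rfl <;> assumption
  · simpa using hp ⟨z, hz⟩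

theorem IsCTM.sUnion_mem (hM : IsCTM M) {x : ZFSet.{0}} (hx : x ∈ M) : ZFSet.sUnion x ∈ M := by
  obtain ⟨p, hp⟩ := hM.models.union ⟨x, hx⟩
  refine hM.mem_of_forall p.2 (fun z hz => ?_) fun z hz => ?_
  · obtain ⟨y, hy, hz⟩ := ZFSet.mem_sUnion.1 hz
    exact hM.mem_of_mem (hM.mem_of_mem hx hy) hz
  · rw [hp ⟨z, hz⟩, ZFSet.mem_sUnion]
    exact ⟨fun ⟨y, hy⟩ => ⟨y, hy⟩, fun ⟨y, hy, h⟩ => ⟨⟨y, hM.mem_of_mem hx hy⟩, hy, h⟩⟩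

theorem IsCTM.sep_mem (hM : IsCTM M) {x : ZFSet.{0}} (hx : x ∈ M) {Q : ZFSet.{0} → Prop}
    (hQ : Dfn M fun v : Fin 1 → ZFSet.{0} => Q (v 0)) : ZFSet.sep Q x ∈ M := by
  obtain ⟨p, hp⟩ := hM.models.separation {z : M | Q z} hQ ⟨x, hx⟩
  refine hM.mem_of_forall p.2 (fun z hz => ?_) fun z hz => ?_
  · exact hM.mem_of_mem hx (ZFSet.mem_sep.1 hz).1
  · rw [hp ⟨z, hz⟩, ZFSet.mem_sep]
    rfl

/-- Replacement for a definable function. -/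
theorem IsCTM.image_mem (hM : IsCTM M) {x : ZFSet.{0}} (hx : x ∈ M) {F : ZFSet.{0} → ZFSet.{0}}
    (hF : ∀ y ∈ x, F y ∈ M)
    (hQ : Dfn M fun v : Fin 2 → ZFSet.{0} => v 1 = F (v 0)) :
    ZFSet.range (fun y : x => F y) ∈ M := by
  obtain ⟨p, hp⟩ := hM.models.replacement {z : M × M | (z.2 : ZFSet.{0}) = F z.1} hQ ⟨x, hx⟩
    fun y hy => ⟨⟨F y, hF _ hy⟩, rfl, fun z hz => Subtype.ext hz⟩
  refine hM.mem_of_forall p.2 (fun z hz => ?_) fun z hz => ?_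
  · obtain ⟨y, rfl⟩ := ZFSet.mem_range.1 hz
    exact hF y y.2
  · rw [hp ⟨z, hz⟩, ZFSet.mem_range]
    constructor
    · rintro ⟨y, hy, h⟩
      exact ⟨⟨y, hy⟩, h.symm⟩
    · rintro ⟨y, hy⟩
      exact ⟨⟨y, hM.mem_of_mem hx y.2⟩, y.2, hy.symm⟩

theorem IsCTM.singleton_mem (hM : IsCTM M) {x : ZFSet.{0}} (hx : x ∈ M) :
    ({x} : ZFSet.{0}) ∈ M := by
  rw [← ZFSet.pair_eq_singleton]
  exact hM.pair_mem hx hx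

theorem IsCTM.opair_mem (hM : IsCTM M) {x y : ZFSet.{0}} (hx : x ∈ M) (hy : y ∈ M) :
    ZFSet.pair x y ∈ M :=
  hM.pair_mem (hM.singleton_mem hx) (hM.pair_mem hx hy)

theorem IsCTM.of_opair_mem (hM : IsCTM M) {x y : ZFSet.{0}} (h : ZFSet.pair x y ∈ M) :
    x ∈ M ∧ y ∈ M := by
  have h2 : ({x, y} : ZFSet.{0}) ∈ M := hM.mem_of_mem h (by simp [ZFSet.pair])
  exact ⟨hM.mem_of_mem h2 (by simp), hM.mem_of_mem h2 (by simp)⟩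

theorem IsCTM.union_mem (hM : IsCTM M) {x y : ZFSet.{0}} (hx : x ∈ M) (hy : y ∈ M) :
    x ∪ y ∈ M := by
  rw [← ZFSet.sUnion_pair]
  exact hM.sUnion_mem (hM.pair_mem hx hy)

theorem IsCTM.insert_mem (hM : IsCTM M) {x y : ZFSet.{0}} (hx : x ∈ M) (hy : y ∈ M) :
    insert x y ∈ M := by
  rw [ZFSet.insert_eq]
  exact hM.union_mem (hM.singleton_mem hx) hy

theorem IsCTM.sdiff_mem (hM : IsCTM M) {x y : ZFSet.{0}} (hx : x ∈ M) (hy : y ∈ M) :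
    x \ y ∈ M := by
  rw [← ZFSet.sep_notMem]
  exact hM.sep_mem hx ((DfnT.var 0).mem (DfnT.const hy)).not

theorem DfnT.unordered_pair (hM : IsCTM M) (hf : DfnT M f) (hg : DfnT M g) :
    DfnT M fun v => ({f v, g v} : ZFSet.{0}) :=
  .of_mem hM (fun v hv => hM.pair_mem (hf.closed v hv) (hg.closed v hv))
    ((((DfnT.var 0).eq hf.weaken).or ((DfnT.var 0).eq hg.weaken)).congr fun _ _ =>
      ZFSet.mem_pair.symm)

theorem DfnT.opair (hM : IsCTM M) (hf : DfnT M f) (hg : DfnT M g) :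
    DfnT M fun v => ZFSet.pair (f v) (g v) :=
  ((hf.unordered_pair hM hf).unordered_pair hM (hf.unordered_pair hM hg)).congr fun _ _ => by
    rw [ZFSet.pair_eq_singleton, ZFSet.pair]

theorem DfnT.union (hM : IsCTM M) (hf : DfnT M f) (hg : DfnT M g) : DfnT M fun v => f v ∪ g v :=
  .of_mem hM (fun v hv => hM.union_mem (hf.closed v hv) (hg.closed v hv))
    ((((DfnT.var 0).mem hf.weaken).or ((DfnT.var 0).mem hg.weaken)).congr fun _ _ =>
      ZFSet.mem_union.symm)

theorem DfnT.sdiff (hM : IsCTM M) (hf : DfnT M f) (hg : DfnT M g) : DfnT M fun v => f v \ g v :=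
  .of_mem hM (fun v hv => hM.sdiff_mem (hf.closed v hv) (hg.closed v hv))
    ((((DfnT.var 0).mem hf.weaken).and ((DfnT.var 0).mem hg.weaken).not).congr fun _ _ =>
      ZFSet.mem_sdiff.symm)

theorem DfnT.insert (hM : IsCTM M) (hf : DfnT M f) (hg : DfnT M g) :
    DfnT M fun v => insert (f v) (g v) :=
  ((hf.unordered_pair hM hf).union hM hg).congr fun _ _ => by
    rw [ZFSet.pair_eq_singleton, ZFSet.insert_eq]

/-- Replacement for a definable function of two variables. -/
theorem IsCTM.exists_image₂ (hM : IsCTM M) {x y : ZFSet.{0}} (hx : x ∈ M) (hy : y ∈ M)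
    {F : ZFSet.{0} → ZFSet.{0} → ZFSet.{0}}
    (hF : DfnT M fun v : Fin 2 → ZFSet.{0} => F (v 0) (v 1)) :
    ∃ p ∈ M, ∀ z, z ∈ p ↔ ∃ a ∈ x, ∃ b ∈ y, z = F a b := by
  have h0 : ∀ a ∈ M, ∀ b ∈ M, F a b ∈ M := fun a ha b hb =>
    hF.closed ![a, b] (Fin.forall_fin_two.2 ⟨ha, hb⟩)
  have h1 : ∀ a ∈ M, ZFSet.range (fun b : y => F a b) ∈ M := fun a ha =>
    hM.image_mem hy (F := fun b => F a b) (fun b hb => h0 a ha b (hM.mem_of_mem hy hb))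
      (Dfn.subst (Q := fun v c => v 1 = F c (v 0)) (DfnT.const ha)
        (hF.graph.rename ![2, 0, 1]))
  have h2 : DfnT M fun v : Fin 1 → ZFSet.{0} => ZFSet.range fun b : y => F (v 0) b :=
    .of_mem hM (fun v hv => h1 _ (hv 0))
      ((Dfn.bex hM (Q := fun w b => w 0 = F (w 1) b) (DfnT.const hy)
        (hF.graph.rename ![1, 2, 0])).congr fun w _ => by
          simp [eq_comm])
  refine ⟨_, hM.sUnion_mem (hM.image_mem hx (F := fun a => ZFSet.range fun b : y => F a b)
    (fun a ha => h1 a (hM.mem_of_mem hx ha)) (h2.graph.rename ![1, 0])), fun z => ?_⟩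
  simp [eq_comm]

theorem IsCTM.prod_mem (hM : IsCTM M) {x y : ZFSet.{0}} (hx : x ∈ M) (hy : y ∈ M) :
    ZFSet.prod x y ∈ M := by
  obtain ⟨p, hp, h⟩ := hM.exists_image₂ hx hy (F := ZFSet.pair)
    ((DfnT.var 0).opair hM (DfnT.var 1))
  convert hp
  ext z
  simp [h]

end Transitive

/-! ### Natural numbers, finite sets and strings in the model -/

section

variable {M : Set ZFSet.{0}}

theorem natCode_zero : natCode 0 = ∅ := by simp [natCode]

theorem natCode_succ (n : ℕ) : natCode (n + 1) = insert (natCode n) (natCode n) := by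
  simp [natCode, Ordinal.toZFSet_add_one]

@[simp] theorem natCode_inj {m n : ℕ} : natCode m = natCode n ↔ m = n := by
  simp [natCode, Ordinal.toZFSet_injective.eq_iff]

@[simp] theorem natCode_mem_natCode {m n : ℕ} : natCode m ∈ natCode n ↔ m < n := by
  simp [natCode]

theorem mem_natCode {n : ℕ} {z : ZFSet.{0}} : z ∈ natCode n ↔ ∃ i < n, natCode i = z := by
  induction n with
  | zero => simp [natCode_zero]
  | succ n ih =>
    rw [natCode_succ, ZFSet.mem_insert_iff, ih]
    constructor
    · rintro (rfl | ⟨i, hi, rfl⟩)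
      exacts [⟨n, by omega, rfl⟩, ⟨i, by omega, rfl⟩]
    · rintro ⟨i, hi, rfl⟩
      rcases Nat.lt_succ_iff_lt_or_eq.1 hi with h | rfl
      exacts [.inr ⟨i, h, rfl⟩, .inl rfl]

@[simp] theorem mem_setCode {α : Type*} [Small.{0} α] {c : α → ZFSet.{0}} {S : Set α}
    {z : ZFSet.{0}} : z ∈ setCode c S ↔ ∃ x ∈ S, c x = z := by
  simp [setCode]

/-- The set of all natural numbers. -/
def omegaSet : ZFSet.{0} := setCode natCode univ

@[simp] theorem mem_omegaSet {z : ZFSet.{0}} : z ∈ omegaSet ↔ ∃ n, natCode n = z := by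
  simp [omegaSet]

theorem IsCTM.empty_mem (hM : IsCTM M) : ∅ ∈ M := by
  obtain ⟨x, ⟨e, he, -⟩, -⟩ := hM.models.infinity
  convert e.2
  ext z
  simpa using fun hz => he ⟨z, hM.mem_of_mem e.2 hz⟩ hz

theorem IsCTM.natCode_mem (hM : IsCTM M) (n : ℕ) : natCode n ∈ M := by
  induction n with
  | zero => exact natCode_zero ▸ hM.empty_mem
  | succ n ih => exact natCode_succ n ▸ hM.insert_mem ih ih

theorem IsCTM.isInductiveIn_iff (hM : IsCTM M) (x : M) :
    IsInductiveIn M x ↔ ∅ ∈ x.1 ∧ ∀ y ∈ x.1, insert y y ∈ x.1 := by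
  have h0 : ∀ e : M, (∀ z : M, z.1 ∉ e.1) ↔ e.1 = ∅ := by
    refine fun e => ⟨fun h => ?_, fun h => by simp [h]⟩
    ext z
    simpa using fun hz => h ⟨z, hM.mem_of_mem e.2 hz⟩ hz
  have h1 : ∀ y s : M, (∀ z : M, z.1 ∈ s.1 ↔ z.1 ∈ y.1 ∨ z = y) ↔ s.1 = insert y.1 y.1 := by
    refine fun y s => ⟨fun h => ?_, fun h => by simp [h, Subtype.ext_iff, or_comm]⟩
    ext z
    have := hM.insert_mem y.2 y.2
    constructor
    · intro hz
      rw [ZFSet.mem_insert_iff, or_comm]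
      simpa [Subtype.ext_iff] using (h ⟨z, hM.mem_of_mem s.2 hz⟩).1 hz
    · intro hz
      refine (h ⟨z, hM.mem_of_mem this hz⟩).2 ?_
      rw [ZFSet.mem_insert_iff, or_comm] at hz
      simpa [Subtype.ext_iff] using hz
  simp only [IsInductiveIn, h0, h1]
  constructor
  · rintro ⟨⟨e, he, hx⟩, h⟩
    refine ⟨he ▸ hx, fun y hy => ?_⟩
    obtain ⟨s, hs, hsx⟩ := h ⟨y, hM.mem_of_mem x.2 hy⟩ hy
    exact hs ▸ hsx
  · rintro ⟨h, h'⟩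
    exact ⟨⟨⟨∅, hM.empty_mem⟩, rfl, h⟩, fun y hy => ⟨⟨_, hM.insert_mem y.2 y.2⟩, rfl, h' y hy⟩⟩

/-- An `∈`-minimal element of `ω` in the sense of `M` that is not a natural number could be removed
from it. -/
theorem IsCTM.omegaSet_mem (hM : IsCTM M) : omegaSet ∈ M := by
  obtain ⟨w, -, ⟨hw, hmin⟩, -⟩ := hM.models.power_omega
  have hw' := (hM.isInductiveIn_iff w).1 hw
  have hnat : ∀ n, natCode n ∈ w.1 := by
    intro n
    induction n with
    | zero => exact natCode_zero ▸ hw'.1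
    | succ n ih => exact natCode_succ n ▸ hw'.2 _ ih
  have hconv : ∀ z : ZFSet.{0}, z ∈ w.1 → ∃ n, natCode n = z := by
    intro z
    induction z using ZFSet.inductionOn with
    | _ z ih =>
    intro hz
    by_contra hn
    have hzM := hM.mem_of_mem w.2 hz
    have : IsInductiveIn M ⟨_, hM.sdiff_mem w.2 (hM.singleton_mem hzM)⟩ := by
      refine (hM.isInductiveIn_iff _).2 ⟨?_, fun y hy => ?_⟩
      · simp only [ZFSet.mem_sdiff, ZFSet.mem_singleton]
        exact ⟨hw'.1, fun h => hn ⟨0, natCode_zero.trans h⟩⟩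
      · simp only [ZFSet.mem_sdiff, ZFSet.mem_singleton] at hy ⊢
        refine ⟨hw'.2 _ hy.1, ?_⟩
        rintro rfl
        obtain ⟨n, rfl⟩ := ih y (by simp) hy.1
        exact hn ⟨n + 1, natCode_succ n⟩
    have := hmin _ this ⟨z, hzM⟩ hz
    simp at this
  convert w.2
  ext z
  rw [mem_omegaSet]
  exact ⟨fun ⟨n, hn⟩ => hn ▸ hnat n, hconv z⟩

theorem IsCTM.exists_of_finite (hM : IsCTM M) {s : Set ZFSet.{0}} (hs : s.Finite) (hsM : s ⊆ M) :
    ∃ y ∈ M, ∀ z, z ∈ y ↔ z ∈ s := by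
  induction s, hs using Set.Finite.induction_on with
  | empty => exact ⟨∅, hM.empty_mem, by simp⟩
  | @insert a s _ _ ih =>
    obtain ⟨y, hy, h⟩ := ih fun z hz => hsM (mem_insert_of_mem _ hz)
    exact ⟨insert a y, hM.insert_mem (hsM (mem_insert _ _)) hy, by simp [h]⟩

theorem IsCTM.mem_of_finite (hM : IsCTM M) {y : ZFSet.{0}} (hy : (y : Set ZFSet.{0}).Finite)
    (h : ∀ z ∈ y, z ∈ M) : y ∈ M := by
  obtain ⟨y', hy', h'⟩ := hM.exists_of_finite hy h
  exact hM.mem_of_forall hy' h fun z _ => by simp [h']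

/-- The set of all finite subsets of `x`. -/
def finSubsets (x : ZFSet.{0}) : ZFSet.{0} :=
  ZFSet.sep (fun y => (y : Set ZFSet.{0}).Finite) x.powerset

@[simp] theorem mem_finSubsets {x y : ZFSet.{0}} :
    y ∈ finSubsets x ↔ y ⊆ x ∧ (y : Set ZFSet.{0}).Finite := by
  simp [finSubsets]

/-- Some relation in `M` maps a part of `n` onto `z`. -/
def SurjIn (M : Set ZFSet.{0}) (n z : ZFSet.{0}) : Prop :=
  ∃ f ∈ M, (∀ x ∈ z, ∃ i ∈ n, ZFSet.pair i x ∈ f) ∧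
    ∀ i ∈ n, ∀ x ∈ z, ∀ y ∈ z, ZFSet.pair i x ∈ f → ZFSet.pair i y ∈ f → x = y

theorem IsCTM.dfn_surjIn (hM : IsCTM M) : Dfn M fun v : Fin 2 → ZFSet.{0} => SurjIn M (v 0) (v 1) :=
  Dfn.ex <| Dfn.and
    (Dfn.ball hM (DfnT.var 2) <| Dfn.bex hM (DfnT.var 2)
      (((DfnT.var 0).opair hM (DfnT.var 1)).mem (DfnT.var 2)))
    (Dfn.ball hM (DfnT.var 1) <| Dfn.ball hM (DfnT.var 3) <| Dfn.ball hM (DfnT.var 4) <|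
      .imp (((DfnT.var 2).opair hM (DfnT.var 1)).mem (DfnT.var 3)) <|
      .imp (((DfnT.var 2).opair hM (DfnT.var 0)).mem (DfnT.var 3)) ((DfnT.var 1).eq (DfnT.var 0)))

theorem IsCTM.surjIn_natCode (hM : IsCTM M) {n : ℕ} {z : ZFSet.{0}} (hz : z ∈ M) :
    SurjIn M (natCode n) z ↔ (z : Set ZFSet.{0}).Finite ∧ (z : Set ZFSet.{0}).ncard ≤ n := by
  constructor
  · rintro ⟨f, -, h1, h2⟩
    have h1' : ∀ x : (z : Set ZFSet.{0}), ∃ i : Fin n, ZFSet.pair (natCode i) x ∈ f := by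
      rintro ⟨x, hx⟩
      obtain ⟨i, hi, h⟩ := h1 x hx
      obtain ⟨j, hj, rfl⟩ := mem_natCode.1 hi
      exact ⟨⟨j, hj⟩, h⟩
    choose g hg using h1'
    have hinj : Function.Injective g := fun x y hxy =>
      Subtype.ext (h2 (natCode (g x)) (by simp) x x.2 y y.2 (hg x) (hxy ▸ hg y))
    have : Finite (z : Set ZFSet.{0}) := Finite.of_injective g hinj
    refine ⟨this, ?_⟩
    have := Nat.card_le_card_of_injective g hinj
    rwa [Nat.card_coe_set_eq, Nat.card_fin] at this
  · rintro ⟨hfin, hcard⟩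
    obtain ⟨g, hg⟩ : ∃ g : ↥(z : Set ZFSet.{0}) → Fin n, Function.Injective g := by
      have := hfin.fintype
      refine Function.Embedding.nonempty_of_card_le ?_ |>.elim fun e => ⟨e, e.injective⟩
      rw [Fintype.card_fin, ← Nat.card_eq_fintype_card, Nat.card_coe_set_eq]
      exact hcard
    have : Finite (z : Set ZFSet.{0}) := hfin
    obtain ⟨f, hf, h⟩ := hM.exists_of_finite
      (s := Set.range fun x : (z : Set ZFSet.{0}) => ZFSet.pair (natCode (g x)) x)
      (Set.finite_range _) (by
        rintro _ ⟨x, rfl⟩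
        exact hM.opair_mem (hM.natCode_mem _) (hM.mem_of_mem hz x.2))
    refine ⟨f, hf, fun x hx => ⟨natCode (g ⟨x, hx⟩), by simp, ?_⟩, ?_⟩
    · exact (h _).2 ⟨⟨x, hx⟩, rfl⟩
    · rintro i - x hx y hy hix hiy
      obtain ⟨x', hx'⟩ := (h _).1 hix
      obtain ⟨y', hy'⟩ := (h _).1 hiy
      rw [ZFSet.pair_inj] at hx' hy'
      have : g x' = g y' := Fin.ext (natCode_inj.1 (hx'.1.trans hy'.1.symm))
      rw [← hx'.2, ← hy'.2, hg this]

/-- The sets of the subsets of `x` with at most `n` elements are in `M`, by induction on `n`, and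
the function that maps `n` to such a set is definable. -/
theorem IsCTM.finSubsets_mem (hM : IsCTM M) {x : ZFSet.{0}} (hx : x ∈ M) : finSubsets x ∈ M := by
  let F : ZFSet.{0} → ZFSet.{0} := fun n =>
    ZFSet.sep (fun z => z ∈ M ∧ SurjIn M n z) x.powerset
  have hF : ∀ n z, z ∈ F (natCode n) ↔
      z ⊆ x ∧ (z : Set ZFSet.{0}).Finite ∧ (z : Set ZFSet.{0}).ncard ≤ n := by
    intro n z
    simp only [F, ZFSet.mem_sep, ZFSet.mem_powerset]
    constructor
    · rintro ⟨h1, h2, h3⟩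
      exact ⟨h1, (hM.surjIn_natCode h2).1 h3⟩
    · rintro ⟨h1, h2⟩
      have := hM.mem_of_finite h2.1 fun a ha => hM.mem_of_mem hx (h1 ha)
      exact ⟨h1, this, (hM.surjIn_natCode this).2 h2⟩
  have hFM : ∀ n, F (natCode n) ∈ M := by
    intro n
    induction n with
    | zero =>
      convert hM.singleton_mem hM.empty_mem
      ext z
      rw [hF, ZFSet.mem_singleton]
      constructor
      · rintro ⟨-, h, h'⟩
        have := (Set.ncard_eq_zero h).1 (Nat.le_zero.1 h')
        exact SetLike.coe_injective (by simpa using this)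
      · rintro rfl
        simp [ZFSet.empty_subset]
    | succ n ih =>
      obtain ⟨p, hp, h⟩ := hM.exists_image₂ hx ih (F := fun a b => insert a b)
        ((DfnT.var 0).insert hM (DfnT.var 1))
      convert hM.union_mem ih hp
      ext z
      rw [ZFSet.mem_union, h, hF, hF]
      constructor
      · rintro ⟨h1, h2, h3⟩
        by_cases hn : (z : Set ZFSet.{0}).ncard ≤ n
        · exact .inl ⟨h1, h2, hn⟩
        · right
          obtain ⟨a, ha⟩ := (Set.ncard_pos h2).1 (by omega)
          have hz : z = insert a (z \ {a}) := by
            ext b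
            by_cases hb : b = a <;> simp_all
          refine ⟨a, h1 ha, z \ {a}, (hF _ _).2 ⟨fun b hb => h1 (ZFSet.mem_sdiff.1 hb).1, ?_, ?_⟩,
            hz⟩
          · exact h2.subset fun b hb => (ZFSet.mem_sdiff.1 hb).1
          · rw [ZFSet.coe_sdiff, ZFSet.coe_singleton, Set.ncard_sdiff_singleton_of_mem ha]
            omega
      · rintro (h | ⟨a, ha, y, hy, rfl⟩)
        · exact ⟨h.1, h.2.1, by omega⟩
        · obtain ⟨h1, h2, h3⟩ := (hF _ _).1 hy
          refine ⟨fun b hb => ?_, ?_, ?_⟩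
          · rcases ZFSet.mem_insert_iff.1 hb with rfl | hb
            exacts [ha, h1 hb]
          · rw [ZFSet.coe_insert]
            exact h2.insert a
          · rw [ZFSet.coe_insert]
            exact (Set.ncard_insert_le _ _).trans (by omega)
  have := hM.sUnion_mem (hM.image_mem hM.omegaSet_mem (F := F)
    (fun y hy => by
      obtain ⟨n, rfl⟩ := mem_omegaSet.1 hy
      exact hFM n)
    ((Dfn.all (Q := fun v z => z ∈ v 1 ↔ z ⊆ x ∧ SurjIn M (v 0) z)
      (((DfnT.var 0).mem (DfnT.var 2)).iff
        (((DfnT.var 0).subset hM (DfnT.const hx)).and (hM.dfn_surjIn.rename ![1, 0])))).congr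
      fun v hv => ⟨fun h => by
        ext z
        simp only [F, ZFSet.mem_sep, ZFSet.mem_powerset]
        constructor
        · intro hz
          have hzM := hM.mem_of_mem (hv 1) hz
          have := (h z hzM).1 hz
          exact ⟨this.1, hzM, this.2⟩
        · rintro ⟨h1, h2, h3⟩
          exact (h z h2).2 ⟨h1, h3⟩, fun h z hz => by
        rw [h]
        simp [F, hz]⟩))
  convert this
  ext z
  rw [mem_finSubsets, ZFSet.mem_sUnion]
  constructor
  · rintro ⟨h1, h2⟩
    exact ⟨F (natCode (z : Set ZFSet.{0}).ncard), ZFSet.mem_range.2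
      ⟨⟨natCode _, mem_omegaSet.2 ⟨_, rfl⟩⟩, rfl⟩, (hF _ _).2 ⟨h1, h2, le_rfl⟩⟩
  · rintro ⟨y, hy, hz⟩
    obtain ⟨⟨i, hi⟩, rfl⟩ := ZFSet.mem_range.1 hy
    obtain ⟨n, rfl⟩ := mem_omegaSet.1 hi
    have := (hF _ _).1 hz
    exact ⟨this.1, this.2.1⟩

@[simp] theorem boolCode_inj {a b : Bool} : boolCode a = boolCode b ↔ a = b := by
  cases a <;> cases b <;> simp [boolCode]

/-- The set of the two truth values. -/
def boolSet : ZFSet.{0} := setCode boolCode univ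

@[simp] theorem mem_boolSet {z : ZFSet.{0}} : z ∈ boolSet ↔ ∃ b, boolCode b = z := by
  simp [boolSet]

theorem IsCTM.boolSet_mem (hM : IsCTM M) : boolSet ∈ M :=
  hM.mem_of_finite ((Set.finite_range boolCode).subset fun z hz => mem_boolSet.1 hz)
    fun z hz => by
      obtain ⟨b, rfl⟩ := mem_boolSet.1 hz
      exact hM.natCode_mem _

theorem mem_strCode {s : Str} {z : ZFSet.{0}} :
    z ∈ strCode s ↔ ∃ i b, s[i]? = some b ∧ ZFSet.pair (natCode i) (boolCode b) = z := by
  simp only [strCode, ZFSet.mem_range]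
  constructor
  · rintro ⟨i, rfl⟩
    exact ⟨i, s.get i, by simp, rfl⟩
  · rintro ⟨i, b, h, rfl⟩
    obtain ⟨hi, rfl⟩ := List.getElem?_eq_some_iff.1 h
    exact ⟨⟨i, hi⟩, rfl⟩

@[simp] theorem pair_mem_strCode {s : Str} {i : ℕ} {b : Bool} :
    ZFSet.pair (natCode i) (boolCode b) ∈ strCode s ↔ s[i]? = some b := by
  rw [mem_strCode]
  constructor
  · rintro ⟨j, c, h, h'⟩
    simp only [ZFSet.pair_inj, natCode_inj, boolCode_inj] at h'
    rwa [← h'.1, ← h'.2]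
  · exact fun h => ⟨i, b, h, rfl⟩

@[simp] theorem strCode_subset {s t : Str} : strCode s ⊆ strCode t ↔ s <+: t := by
  constructor
  · intro h
    rw [List.prefix_iff_getElem?]
    intro i hi
    exact pair_mem_strCode.1 (h (pair_mem_strCode.2 (List.getElem?_eq_getElem hi)))
  · rintro ⟨r, rfl⟩ z hz
    obtain ⟨i, b, h, rfl⟩ := mem_strCode.1 hz
    rw [pair_mem_strCode]
    obtain ⟨hi, rfl⟩ := List.getElem?_eq_some_iff.1 h
    rw [List.getElem?_append_left hi, h]

@[simp] theorem strCode_inj {s t : Str} : strCode s = strCode t ↔ s = t := by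
  refine ⟨fun h => ?_, fun h => h ▸ rfl⟩
  have h1 : s <+: t := strCode_subset.1 (h ▸ subset_rfl)
  have h2 : t <+: s := strCode_subset.1 (h ▸ subset_rfl)
  exact h1.eq_of_length (le_antisymm h1.length_le h2.length_le)

theorem strCode_append (s : Str) (b : Bool) :
    strCode (s ++ [b]) = insert (ZFSet.pair (natCode s.length) (boolCode b)) (strCode s) := by
  ext z
  rw [ZFSet.mem_insert_iff, mem_strCode, mem_strCode]
  constructor
  · rintro ⟨i, c, h, rfl⟩
    rcases lt_trichotomy i s.length with hi | rfl | hi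
    · exact .inr ⟨i, c, by rwa [List.getElem?_append_left hi] at h, rfl⟩
    · left
      simp at h
      simp [h]
    · have := (List.getElem?_eq_some_iff.1 h).1
      rw [List.length_append, List.length_singleton] at this
      omega
  · rintro (rfl | ⟨i, c, h, rfl⟩)
    · exact ⟨s.length, b, by simp, rfl⟩
    · obtain ⟨hi, -⟩ := List.getElem?_eq_some_iff.1 h
      exact ⟨i, c, by rw [List.getElem?_append_left hi, h], rfl⟩

/-- The set of all strings. -/
def strSet : ZFSet.{0} := setCode strCode univ

@[simp] theorem mem_strSet {z : ZFSet.{0}} : z ∈ strSet ↔ ∃ s, strCode s = z := by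
  simp [strSet]

theorem strCode_finite (s : Str) : (strCode s : Set ZFSet.{0}).Finite := by
  rw [strCode, ZFSet.coe_range]
  exact Set.finite_range _

theorem IsCTM.strSet_mem (hM : IsCTM M) : strSet ∈ M := by
  have h1 := hM.omegaSet_mem
  have h2 := hM.boolSet_mem
  have := hM.sep_mem (hM.finSubsets_mem (hM.prod_mem h1 h2))
    (Q := fun z => ∃ n ∈ omegaSet, ∀ i ∈ omegaSet,
      (i ∈ n → ∃ b ∈ boolSet, ∀ c ∈ boolSet, ZFSet.pair i c ∈ z ↔ c = b) ∧
      (i ∉ n → ∀ c ∈ boolSet, ZFSet.pair i c ∉ z))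
    (Dfn.bex hM (DfnT.const h1) <| Dfn.ball hM (DfnT.const h1) <| Dfn.and
      (.imp ((DfnT.var 0).mem (DfnT.var 1)) <| Dfn.bex hM (DfnT.const h2) <|
        Dfn.ball hM (DfnT.const h2) <| .iff
          (((DfnT.var 2).opair hM (DfnT.var 0)).mem (DfnT.var 4)) ((DfnT.var 0).eq (DfnT.var 1)))
      (.imp ((DfnT.var 0).mem (DfnT.var 1)).not <| Dfn.ball hM (DfnT.const h2)
          (((DfnT.var 1).opair hM (DfnT.var 0)).mem (DfnT.var 3)).not))
  convert this
  ext z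
  simp only [mem_strSet, ZFSet.mem_sep, mem_finSubsets, mem_omegaSet, mem_boolSet,
    exists_exists_eq_and, forall_exists_index, forall_apply_eq_imp_iff, natCode_mem_natCode,
    boolCode_inj]
  constructor
  · rintro ⟨s, rfl⟩
    refine ⟨⟨fun z hz => ?_, strCode_finite s⟩, s.length, fun i => ⟨fun hi => ⟨s[i], fun c => ?_⟩,
      fun hi c => ?_⟩⟩
    · obtain ⟨i, b, -, rfl⟩ := mem_strCode.1 hz
      exact ZFSet.pair_mem_prod.2 ⟨mem_omegaSet.2 ⟨i, rfl⟩, mem_boolSet.2 ⟨b, rfl⟩⟩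
    · simp [hi, eq_comm]
    · simp only [pair_mem_strCode]
      rw [List.getElem?_eq_none (by omega)]
      simp
  · rintro ⟨⟨hz, -⟩, n, h⟩
    choose f hf using fun i => (h i).1
    refine ⟨List.ofFn fun i : Fin n => f i i.2, ?_⟩
    have key : ∀ i c, ZFSet.pair (natCode i) (boolCode c) ∈
        strCode (List.ofFn fun i : Fin n => f i i.2) ↔
          ZFSet.pair (natCode i) (boolCode c) ∈ z := by
      intro i c
      rw [pair_mem_strCode]
      by_cases hi : i < n
      · rw [hf i hi]
        simp [hi, eq_comm]
      · simp [hi, (h i).2 hi c]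
    ext y
    constructor
    · intro hy
      obtain ⟨i, c, -, rfl⟩ := mem_strCode.1 hy
      exact (key i c).1 hy
    · intro hy
      obtain ⟨a, ha, b, hb, rfl⟩ := ZFSet.mem_prod.1 (hz hy)
      obtain ⟨i, rfl⟩ := mem_omegaSet.1 ha
      obtain ⟨c, rfl⟩ := mem_boolSet.1 hb
      exact (key i c).2 hy

theorem IsCTM.strCode_mem (hM : IsCTM M) (s : Str) : strCode s ∈ M :=
  hM.mem_of_mem hM.strSet_mem (mem_strSet.2 ⟨s, rfl⟩)

end

/-! ### Splitting systems over perfect-tree forcings -/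

theorem prefix_or_prefix {s t u : Str} (h : s <+: u) (h' : t <+: u) : s <+: t ∨ t <+: s :=
  List.prefix_or_prefix_of_prefix h h'

/-- The condition that relates neighbouring trees of a splitting system, stated by means of a
splitting node `r` of `T` which is comparable with all elements of `T`. -/
def IsStep (T T' : Set Str) (i : Bool) : Prop :=
  T' ⊆ T ∧ ∃ r : Str, (∀ j : Bool, r ++ [j] ∈ T) ∧ (∀ t ∈ T, r <+: t ∨ t <+: r) ∧
    ∀ t ∈ T', r ++ [i] <+: t ∨ t <+: r ++ [i]

theorem IsPerfectTree.nil_mem {T : Set Str} (hT : IsPerfectTree T) : [] ∈ T := by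
  obtain ⟨s, hs⟩ := hT.1
  exact hT.2.1 _ _ List.nil_prefix hs

theorem restr_eq_self {T : Set Str} {s : Str} : T = restr T s ↔ ∀ t ∈ T, s <+: t ∨ t <+: s := by
  constructor
  · intro h t ht
    rw [h] at ht
    exact ht.2
  · intro h
    ext t
    exact ⟨fun ht => ⟨ht, h t ht⟩, fun ht => ht.1⟩

theorem not_prefix_append {r : Str} {i j : Bool} (h : r ++ [i] <+: r ++ [j]) : i = j := by
  rw [List.prefix_append_right_inj] at h
  simpa using h

/-- The stem of a perfect tree is the shortest splitting node. -/
theorem isStem_iff {T : Set Str} (hT : IsPerfectTree T) {r : Str} :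
    IsStem T r ↔ (∀ j : Bool, r ++ [j] ∈ T) ∧ ∀ t ∈ T, r <+: t ∨ t <+: r := by
  constructor
  · rintro ⟨hr, hTr, hmax⟩
    have hcmp := restr_eq_self.1 hTr
    refine ⟨?_, hcmp⟩
    obtain ⟨t, ht, hrt, hsplit⟩ := hT.2.2 r hr
    -- If only `r ++ [i]` were in `T` above `r`, then `r ++ [i]` would contradict maximality.
    by_contra hcon
    have hne : t ≠ r := by
      rintro rfl
      exact hcon hsplit
    obtain ⟨q, rfl⟩ := hrt
    cases q with
    | nil => simp at hne
    | cons i q =>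
      have hi : r ++ [i] ∈ T := hT.2.1 _ _ ⟨q, by simp⟩ ht
      have hall : ∀ t ∈ T, r ++ [i] <+: t ∨ t <+: r ++ [i] := by
        intro t ht
        rcases hcmp t ht with h | h
        · obtain ⟨q', rfl⟩ := h
          cases q' with
          | nil => right; simp
          | cons j q' =>
            have hj : r ++ [j] ∈ T := hT.2.1 _ _ ⟨q', by simp⟩ ht
            have : i = j := by
              by_contra hij
              apply hcon
              intro k
              have : k = i ∨ k = j := by revert hij; cases i <;> cases j <;> cases k <;> simp
              rcases this with rfl | rfl <;> assumption
            subst this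
            left
            exact ⟨q', by simp⟩
        · exact .inr (h.trans (List.prefix_append _ _))
      have := (hmax _ hi (restr_eq_self.2 hall)).length_le
      simp at this
  · rintro ⟨hsplit, hcmp⟩
    refine ⟨hT.2.1 _ _ (List.prefix_append _ _) (hsplit false), restr_eq_self.2 hcmp, ?_⟩
    intro s hs hTs
    have h := restr_eq_self.1 hTs
    have h0 := h _ (hsplit false)
    have h1 := h _ (hsplit true)
    rcases hcmp s hs with hrs | hsr
    · -- `s` is comparable with both successors of `r`, so it does not extend `r` properly.
      obtain ⟨q, rfl⟩ := hrs
      cases q with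
      | nil => simp
      | cons i q =>
        exfalso
        have key : ∀ j, r ++ i :: q <+: r ++ [j] ∨ r ++ [j] <+: r ++ i :: q → j = i := by
          intro j h
          rcases h with h | h
          · rw [List.prefix_append_right_inj] at h
            obtain ⟨u, hu⟩ := h
            simp at hu
            exact hu.1.symm
          · rw [List.prefix_append_right_inj] at h
            obtain ⟨u, hu⟩ := h
            simp at hu
            exact hu.1
        have := (key _ h0).trans (key _ h1).symm
        simp at this
    · exact hsr

theorem exists_isStem {T : Set Str} (hT : IsPerfectTree T) : ∃ r, IsStem T r := by
  classical
  have hex : ∃ n, ∃ r : Str, r.length = n ∧ ∀ j : Bool, r ++ [j] ∈ T := by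
    obtain ⟨t, -, -, h⟩ := hT.2.2 _ hT.nil_mem
    exact ⟨_, t, rfl, h⟩
  obtain ⟨r, hlen, hr⟩ := Nat.find_spec hex
  refine ⟨r, (isStem_iff hT).2 ⟨hr, ?_⟩⟩
  -- Otherwise the longest common initial segment of `t` and `r` is a shorter splitting node.
  by_contra hcon
  push Not at hcon
  obtain ⟨t, ht, hrt, htr⟩ := hcon
  have hrT : r ∈ T := hT.2.1 _ _ (List.prefix_append _ _) (hr false)
  have hdiv : ∀ (r t : Str), ¬ r <+: t → ¬ t <+: r →
      ∃ u i j, i ≠ j ∧ u ++ [i] <+: r ∧ u ++ [j] <+: t := by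
    intro r
    induction r with
    | nil => intro t h; simp at h
    | cons a r ih =>
      intro t h h'
      cases t with
      | nil => simp at h'
      | cons b t =>
        by_cases hab : a = b
        · subst hab
          simp only [List.cons_prefix_cons, true_and] at h h'
          obtain ⟨u, i, j, hij, h1, h2⟩ := ih t h h'
          exact ⟨a :: u, i, j, hij, by simpa using h1, by simpa using h2⟩
        · exact ⟨[], a, b, hab, by simp, by simp⟩
  obtain ⟨u, i, j, hij, hu, hu'⟩ := hdiv r t hrt htr
  refine Nat.find_min hex (m := u.length) ?_ ⟨u, rfl, fun k => ?_⟩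
  · have := hu.length_le
    rw [← hlen]
    simp at this
    omega
  · have : k = i ∨ k = j := by cases i <;> cases j <;> cases k <;> simp_all
    rcases this with rfl | rfl
    exacts [hT.2.1 _ _ hu hrT, hT.2.1 _ _ hu' ht]

theorem isStep_iff {T T' : Set Str} (hT : IsPerfectTree T) (hT' : IsPerfectTree T') {i : Bool} :
    IsStep T T' i ↔ T' ⊆ T ∧ ∃ r r' : Str, IsStem T r ∧ IsStem T' r' ∧ r ++ [i] <+: r' := by
  refine and_congr_right fun hsub => ⟨?_, ?_⟩
  · rintro ⟨r, hr, hcmp, h⟩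
    obtain ⟨r', hr'⟩ := exists_isStem hT'
    refine ⟨r, r', (isStem_iff hT).2 ⟨hr, hcmp⟩, hr', ?_⟩
    obtain ⟨h1, h2⟩ := (isStem_iff hT').1 hr'
    have h0 := h _ (h1 false)
    have h0' := h _ (h1 true)
    rcases h r' hr'.1 with h3 | h3
    · exact h3
    · by_cases he : r' = r ++ [i]
      · rw [he]
      · -- Both successors of `r'` would be initial segments of `r ++ [i]`.
        have hlt : r'.length < (r ++ [i]).length :=
          lt_of_le_of_ne h3.length_le fun hl => he (h3.eq_of_length hl)
        have hpre : ∀ j, r ++ [i] <+: r' ++ [j] ∨ r' ++ [j] <+: r ++ [i] →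
            r' ++ [j] <+: r ++ [i] := by
          rintro j (h | h)
          · rw [h.eq_of_length (le_antisymm h.length_le (by simp at hlt ⊢; omega))]
          · exact h
        have := (List.prefix_of_prefix_length_le (hpre _ h0) (hpre _ h0') (by simp))
        exact absurd (not_prefix_append this) (by simp)
  · rintro ⟨r, r', hr, hr', h⟩
    obtain ⟨h1, h2⟩ := (isStem_iff hT).1 hr
    refine ⟨r, h1, h2, fun t ht => ?_⟩
    rcases ((isStem_iff hT').1 hr').2 t ht with h3 | h3
    · exact .inl (h.trans h3)
    · exact (prefix_or_prefix h h3)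

theorem isFSS_iff {P : Set (Set Str)} (hP : IsPTF P) {φ : Sys} :
    IsFSS P φ ↔ (∀ s : Str, s.length < φ.height → φ.tree s ∈ P) ∧
      ∀ (s : Str) (i : Bool), (s ++ [i]).length < φ.height →
        IsStep (φ.tree s) (φ.tree (s ++ [i])) i := by
  refine and_congr_right fun h => forall₃_congr fun s i hs => ?_
  have hs' : s.length < φ.height := by simp at hs; omega
  exact (isStep_iff (hP.1 _ (h s hs')) (hP.1 _ (h _ hs))).symm

/-! ### Codes of trees, systems and matrices in the model -/

section

variable {M : Set ZFSet.{0}} {θ : Ordinal.{0}} {P : Iio θ → Set (Set Str)}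

@[simp] theorem strCode_mem_treeCode {s : Str} {T : Set Str} :
    strCode s ∈ treeCode T ↔ s ∈ T := by
  simp [treeCode]

@[simp] theorem treeCode_subset {S T : Set Str} : treeCode S ⊆ treeCode T ↔ S ⊆ T := by
  constructor
  · intro h s hs
    exact strCode_mem_treeCode.1 (h (strCode_mem_treeCode.2 hs))
  · intro h z hz
    obtain ⟨s, hs, rfl⟩ := mem_setCode.1 hz
    exact strCode_mem_treeCode.2 (h hs)

@[simp] theorem treeCode_inj {S T : Set Str} : treeCode S = treeCode T ↔ S = T := by
  refine ⟨fun h => ?_, fun h => h ▸ rfl⟩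
  exact (treeCode_subset.1 (h ▸ subset_rfl)).antisymm (treeCode_subset.1 (h ▸ subset_rfl))

/-- The code of a place of a matrix. -/
def placeCode (p : Iio θ × ℕ) : ZFSet.{0} := ZFSet.pair p.1.1.toZFSet (natCode p.2)

@[simp] theorem toZFSet_inj {ξ ζ : Ordinal.{0}} : ξ.toZFSet = ζ.toZFSet ↔ ξ = ζ :=
  Ordinal.toZFSet_injective.eq_iff

@[simp] theorem placeCode_inj {p q : Iio θ × ℕ} : placeCode p = placeCode q ↔ p = q := by
  simp [placeCode, Prod.ext_iff, Subtype.ext_iff]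

/-- The set of all places of matrices. -/
def placeSet (θ : Ordinal.{0}) : ZFSet.{0} := setCode (placeCode (θ := θ)) univ

@[simp] theorem mem_placeSet {z : ZFSet.{0}} :
    z ∈ placeSet θ ↔ ∃ p : Iio θ × ℕ, placeCode p = z := by
  simp [placeSet]

theorem mem_matCode {α : Type} {c : α → ZFSet.{0}} {A : Mat θ α} {z : ZFSet.{0}} :
    z ∈ matCode c A ↔ ∃ p : Iio θ × ℕ, ZFSet.pair (placeCode p) (c (A p.1 p.2)) = z := by
  simp [matCode, funCode, placeCode]

@[simp] theorem pair_mem_matCode {α : Type} {c : α → ZFSet.{0}} {A : Mat θ α} {p : Iio θ × ℕ}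
    {y : ZFSet.{0}} : ZFSet.pair (placeCode p) y ∈ matCode c A ↔ y = c (A p.1 p.2) := by
  simp only [mem_matCode, ZFSet.pair_inj, placeCode_inj]
  exact ⟨fun ⟨q, hq, h⟩ => by rw [← h, hq], fun h => ⟨p, rfl, h.symm⟩⟩

theorem mem_sysCode {φ : Sys} {z : ZFSet.{0}} : z ∈ sysCode φ ↔
    ∃ s : Str, s.length < φ.height ∧ ZFSet.pair (strCode s) (treeCode (φ.tree s)) = z := by
  simp [sysCode, funCode]

@[simp] theorem pair_mem_sysCode {φ : Sys} {s : Str} {y : ZFSet.{0}} :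
    ZFSet.pair (strCode s) y ∈ sysCode φ ↔ s.length < φ.height ∧ y = treeCode (φ.tree s) := by
  simp only [mem_sysCode, ZFSet.pair_inj, strCode_inj]
  constructor
  · rintro ⟨t, ht, rfl, rfl⟩
    exact ⟨ht, rfl⟩
  · rintro ⟨hs, rfl⟩
    exact ⟨s, hs, rfl, rfl⟩

theorem mem_seqCode {z : ZFSet.{0}} : z ∈ seqCode P ↔
    ∃ ξ : Iio θ, ZFSet.pair ξ.1.toZFSet (setCode treeCode (P ξ)) = z := by
  simp [seqCode, funCode]

@[simp] theorem pair_mem_seqCode {ξ : Iio θ} {y : ZFSet.{0}} :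
    ZFSet.pair ξ.1.toZFSet y ∈ seqCode P ↔ y = setCode treeCode (P ξ) := by
  simp only [mem_seqCode, ZFSet.pair_inj, toZFSet_inj]
  constructor
  · rintro ⟨ζ, h, rfl⟩
    rw [Subtype.ext h]
  · rintro rfl
    exact ⟨ξ, rfl, rfl⟩

theorem IsCTM.seqCode_fst_mem (hM : IsCTM M) (hP : seqCode P ∈ M) (ξ : Iio θ) :
    ξ.1.toZFSet ∈ M :=
  (hM.of_opair_mem (hM.mem_of_mem hP (mem_seqCode.2 ⟨ξ, rfl⟩))).1

theorem IsCTM.seqCode_snd_mem (hM : IsCTM M) (hP : seqCode P ∈ M) (ξ : Iio θ) :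
    setCode treeCode (P ξ) ∈ M :=
  (hM.of_opair_mem (hM.mem_of_mem hP (mem_seqCode.2 ⟨ξ, rfl⟩))).2

theorem IsCTM.treeCode_mem (hM : IsCTM M) (hP : seqCode P ∈ M) {ξ : Iio θ} {T : Set Str}
    (hT : T ∈ P ξ) : treeCode T ∈ M :=
  hM.mem_of_mem (hM.seqCode_snd_mem hP ξ) (mem_setCode.2 ⟨T, hT, rfl⟩)

theorem IsCTM.placeCode_mem (hM : IsCTM M) (hP : seqCode P ∈ M) (p : Iio θ × ℕ) :
    placeCode p ∈ M :=
  hM.opair_mem (hM.seqCode_fst_mem hP p.1) (hM.natCode_mem p.2)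

/-- Both coordinates of the pairs in `z` are elements of `⋃₀ ⋃₀ z`. -/
theorem mem_sUnion_sUnion {x y z : ZFSet.{0}} (h : ZFSet.pair x y ∈ z) :
    x ∈ ZFSet.sUnion (ZFSet.sUnion z) ∧ y ∈ ZFSet.sUnion (ZFSet.sUnion z) := by
  have : ({x, y} : ZFSet.{0}) ∈ ZFSet.sUnion z :=
    ZFSet.mem_sUnion.2 ⟨_, h, by simp [ZFSet.pair]⟩
  exact ⟨ZFSet.mem_sUnion.2 ⟨_, this, by simp⟩, ZFSet.mem_sUnion.2 ⟨_, this, by simp⟩⟩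

theorem IsCTM.placeSet_mem (hM : IsCTM M) (hP : seqCode P ∈ M) : placeSet θ ∈ M := by
  have := hM.sep_mem (hM.sUnion_mem (hM.sUnion_mem hP))
    (Q := fun x => ∃ y ∈ M, ZFSet.pair x y ∈ seqCode P)
    (Dfn.ex <| ((DfnT.var 1).opair hM (DfnT.var 0)).mem (DfnT.const hP))
  convert hM.prod_mem this hM.omegaSet_mem
  ext z
  simp only [mem_placeSet, ZFSet.mem_prod, ZFSet.mem_sep, mem_omegaSet, exists_exists_eq_and]
  constructor
  · rintro ⟨p, rfl⟩
    have h : ZFSet.pair p.1.1.toZFSet (setCode treeCode (P p.1)) ∈ seqCode P := by simp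
    exact ⟨_, ⟨(mem_sUnion_sUnion h).1, _, hM.seqCode_snd_mem hP p.1, h⟩, p.2, rfl⟩
  · rintro ⟨x, ⟨-, y, -, hxy⟩, n, rfl⟩
    obtain ⟨ξ, h⟩ := mem_seqCode.1 hxy
    rw [ZFSet.pair_inj] at h
    exact ⟨(ξ, n), by rw [← h.1]; rfl⟩

/-- The set of all trees that occur in the sequence `P`. -/
def treeSet (P : Iio θ → Set (Set Str)) : ZFSet.{0} := setCode treeCode (⋃ ξ, P ξ)

@[simp] theorem mem_treeSet {z : ZFSet.{0}} :
    z ∈ treeSet P ↔ ∃ T, (∃ ξ, T ∈ P ξ) ∧ treeCode T = z := by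
  simp [treeSet]

theorem IsCTM.treeSet_mem (hM : IsCTM M) (hP : seqCode P ∈ M) : treeSet P ∈ M := by
  have := hM.sep_mem (hM.sUnion_mem (hM.sUnion_mem (hM.sUnion_mem hP)))
    (Q := fun z => ∃ x ∈ M, ∃ y ∈ M, ZFSet.pair x y ∈ seqCode P ∧ z ∈ y)
    (Dfn.ex <| Dfn.ex <| .and (((DfnT.var 1).opair hM (DfnT.var 0)).mem (DfnT.const hP))
      ((DfnT.var 2).mem (DfnT.var 0)))
  convert this
  ext z
  simp only [mem_treeSet, ZFSet.mem_sep]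
  constructor
  · rintro ⟨T, ⟨ξ, hT⟩, rfl⟩
    have h : ZFSet.pair ξ.1.toZFSet (setCode treeCode (P ξ)) ∈ seqCode P := by simp
    have h' : treeCode T ∈ setCode treeCode (P ξ) := mem_setCode.2 ⟨T, hT, rfl⟩
    exact ⟨ZFSet.mem_sUnion.2 ⟨_, (mem_sUnion_sUnion h).2, h'⟩, _, hM.seqCode_fst_mem hP ξ, _,
      hM.seqCode_snd_mem hP ξ, h, h'⟩
  · rintro ⟨-, x, -, y, -, hxy, hz⟩
    obtain ⟨ξ, h⟩ := mem_seqCode.1 hxy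
    rw [ZFSet.pair_inj] at h
    rw [← h.2, mem_setCode] at hz
    obtain ⟨T, hT, rfl⟩ := hz
    exact ⟨T, ⟨ξ, hT⟩, rfl⟩

/-- The relation that consists of the places `(ξ, k)` and the trees in `P ξ`. -/
def placedTreeSet (P : Iio θ → Set (Set Str)) : ZFSet.{0} :=
  setCode (fun q : (Iio θ × ℕ) × Set Str => ZFSet.pair (placeCode q.1) (treeCode q.2))
    {q | q.2 ∈ P q.1.1}

@[simp] theorem pair_mem_placedTreeSet {p : Iio θ × ℕ} {T : Set Str} :
    ZFSet.pair (placeCode p) (treeCode T) ∈ placedTreeSet P ↔ T ∈ P p.1 := by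
  simp only [placedTreeSet, mem_setCode, ZFSet.pair_inj, placeCode_inj, treeCode_inj]
  constructor
  · rintro ⟨q, hq, rfl, rfl⟩
    exact hq
  · exact fun h => ⟨(p, T), h, rfl, rfl⟩

theorem IsCTM.placedTreeSet_mem (hM : IsCTM M) (hP : seqCode P ∈ M) : placedTreeSet P ∈ M := by
  have := hM.sep_mem (hM.prod_mem (hM.placeSet_mem hP) (hM.treeSet_mem hP))
    (Q := fun z => ∃ x ∈ M, ∃ n ∈ M, ∃ y ∈ M, ∃ T ∈ M, z = ZFSet.pair (ZFSet.pair x n) T ∧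
      ZFSet.pair x y ∈ seqCode P ∧ T ∈ y)
    (Dfn.ex <| Dfn.ex <| Dfn.ex <| Dfn.ex <|
      .and ((DfnT.var 4).eq (((DfnT.var 3).opair hM (DfnT.var 2)).opair hM (DfnT.var 0))) <|
      .and (((DfnT.var 3).opair hM (DfnT.var 1)).mem (DfnT.const hP))
      ((DfnT.var 0).mem (DfnT.var 1)))
  convert this
  ext z
  rw [ZFSet.mem_sep, ZFSet.mem_prod]
  constructor
  · intro h
    obtain ⟨⟨p, T⟩, hT, rfl⟩ := mem_setCode.1 h
    exact ⟨⟨_, mem_placeSet.2 ⟨p, rfl⟩, _, mem_treeSet.2 ⟨T, ⟨_, hT⟩, rfl⟩, rfl⟩,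
      _, hM.seqCode_fst_mem hP p.1, _, hM.natCode_mem p.2, _, hM.seqCode_snd_mem hP p.1, _,
      hM.treeCode_mem hP hT, rfl, by simp, mem_setCode.2 ⟨T, hT, rfl⟩⟩
  · rintro ⟨⟨a, ha, b, hb, rfl⟩, x, -, n, -, y, -, T, -, h, hxy, hT⟩
    obtain ⟨p, rfl⟩ := mem_placeSet.1 ha
    obtain ⟨S, -, rfl⟩ := mem_treeSet.1 hb
    rw [ZFSet.pair_inj, placeCode, ZFSet.pair_inj] at h
    obtain ⟨⟨rfl, rfl⟩, rfl⟩ := h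
    rw [pair_mem_seqCode] at hxy
    subst hxy
    obtain ⟨T, hT, h⟩ := mem_setCode.1 hT
    rw [pair_mem_placedTreeSet]
    rwa [← treeCode_inj.1 h]

/-- The relation between strings and their lengths. -/
def lengthSet : ZFSet.{0} :=
  setCode (fun s : Str => ZFSet.pair (strCode s) (natCode s.length)) univ

@[simp] theorem pair_mem_lengthSet {s : Str} {n : ℕ} :
    ZFSet.pair (strCode s) (natCode n) ∈ lengthSet ↔ s.length = n := by
  simp [lengthSet]

theorem IsCTM.lengthSet_mem (hM : IsCTM M) : lengthSet ∈ M := by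
  have h1 := hM.omegaSet_mem
  have h2 := hM.boolSet_mem
  have := hM.sep_mem (hM.prod_mem hM.strSet_mem h1)
    (Q := fun z => ∃ s ∈ strSet, ∃ n ∈ omegaSet, z = ZFSet.pair s n ∧
      ∀ i ∈ omegaSet, i ∈ n ↔ ∃ b ∈ boolSet, ZFSet.pair i b ∈ s)
    (Dfn.bex hM (DfnT.const hM.strSet_mem) <| Dfn.bex hM (DfnT.const h1) <|
      .and ((DfnT.var 2).eq ((DfnT.var 1).opair hM (DfnT.var 0))) <|
      Dfn.ball hM (DfnT.const h1) <| .iff ((DfnT.var 0).mem (DfnT.var 1)) <|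
      Dfn.bex hM (DfnT.const h2) (((DfnT.var 1).opair hM (DfnT.var 0)).mem (DfnT.var 3)))
  convert this
  ext z
  rw [ZFSet.mem_sep, ZFSet.mem_prod]
  have key : ∀ (s : Str) (n : ℕ), (∀ i, i < n ↔ ∃ b, s[i]? = some b) ↔ s.length = n := by
    intro s n
    have : ∀ i, (∃ b, s[i]? = some b) ↔ i < s.length := by
      intro i
      rw [← Option.isSome_iff_exists]
      simp
    simp only [this]
    exact ⟨fun h => eq_of_forall_lt_iff fun i => (h i).symm, by rintro rfl; simp⟩
  simp only [mem_strSet, mem_omegaSet, mem_boolSet, exists_exists_eq_and, forall_exists_index,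
    forall_apply_eq_imp_iff, natCode_mem_natCode, pair_mem_strCode, key]
  constructor
  · intro h
    obtain ⟨s, -, rfl⟩ := mem_setCode.1 h
    exact ⟨⟨s, _, rfl⟩, s, _, rfl, rfl⟩
  · rintro ⟨-, s, n, rfl, h⟩
    simpa using h

/-- The relation between a string, a truth value, and the extension of the string by this
value. -/
def appendSet : ZFSet.{0} :=
  setCode (fun q : Str × Bool =>
    ZFSet.pair (ZFSet.pair (strCode q.1) (boolCode q.2)) (strCode (q.1 ++ [q.2]))) univ

@[simp] theorem pair_mem_appendSet {s t : Str} {b : Bool} :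
    ZFSet.pair (ZFSet.pair (strCode s) (boolCode b)) (strCode t) ∈ appendSet ↔ t = s ++ [b] := by
  simp only [appendSet, mem_setCode, ZFSet.pair_inj, strCode_inj, boolCode_inj, mem_univ, true_and,
    Prod.exists]
  constructor
  · rintro ⟨_, _, ⟨rfl, rfl⟩, rfl⟩
    rfl
  · rintro rfl
    exact ⟨_, _, ⟨rfl, rfl⟩, rfl⟩

theorem strCode_eq_insert_iff {s t : Str} {n : ℕ} {b : Bool} (hs : s[n]? ≠ some b) :
    strCode t = insert (ZFSet.pair (natCode n) (boolCode b)) (strCode s) ↔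
      n = s.length ∧ t = s ++ [b] := by
  constructor
  · intro h
    have hst : s <+: t := by
      rw [← strCode_subset, h]
      exact fun z hz => ZFSet.mem_insert_of_mem _ hz
    have hn : t[n]? = some b := by
      rw [← pair_mem_strCode, h]
      exact ZFSet.mem_insert _ _
    obtain ⟨r, rfl⟩ := hst
    cases r with
    | nil => exact absurd (by simpa using hn) hs
    | cons c r =>
      have hc : ZFSet.pair (natCode s.length) (boolCode c) ∈ strCode (s ++ c :: r) := by
        simp
      rw [h, ZFSet.mem_insert_iff, ZFSet.pair_inj, natCode_inj, boolCode_inj,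
        pair_mem_strCode] at hc
      rcases hc with ⟨rfl, rfl⟩ | hc
      · refine ⟨rfl, ?_⟩
        rw [← strCode_append, strCode_inj] at h
        exact h
      · simp at hc
  · rintro ⟨rfl, rfl⟩
    exact strCode_append s b

theorem IsCTM.appendSet_mem (hM : IsCTM M) : appendSet ∈ M := by
  have h1 := hM.omegaSet_mem
  have h2 := hM.boolSet_mem
  have h3 := hM.strSet_mem
  have := hM.sep_mem (hM.prod_mem (hM.prod_mem h3 h2) h3)
    (Q := fun z => ∃ s ∈ strSet, ∃ b ∈ boolSet, ∃ t ∈ strSet, ∃ n ∈ omegaSet,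
      ZFSet.pair n b ∉ s ∧ z = ZFSet.pair (ZFSet.pair s b) t ∧ t = insert (ZFSet.pair n b) s)
    (Dfn.bex hM (DfnT.const h3) <| Dfn.bex hM (DfnT.const h2) <| Dfn.bex hM (DfnT.const h3) <|
      Dfn.bex hM (DfnT.const h1) <|
      .and (((DfnT.var 0).opair hM (DfnT.var 2)).mem (DfnT.var 3)).not <|
      .and ((DfnT.var 4).eq (((DfnT.var 3).opair hM (DfnT.var 2)).opair hM (DfnT.var 1)))
      ((DfnT.var 1).eq (((DfnT.var 0).opair hM (DfnT.var 2)).insert hM (DfnT.var 3))))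
  convert this
  ext z
  rw [ZFSet.mem_sep]
  simp only [mem_strSet, mem_omegaSet, mem_boolSet, exists_exists_eq_and, pair_mem_strCode]
  constructor
  · intro h
    obtain ⟨⟨s, b⟩, -, rfl⟩ := mem_setCode.1 h
    refine ⟨ZFSet.pair_mem_prod.2 ⟨ZFSet.pair_mem_prod.2 ⟨mem_strSet.2 ⟨_, rfl⟩,
      mem_boolSet.2 ⟨_, rfl⟩⟩, mem_strSet.2 ⟨_, rfl⟩⟩, s, b, s ++ [b], s.length, by simp, rfl,
      strCode_append s b⟩
  · rintro ⟨-, s, b, t, n, hn, rfl, h⟩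
    rw [pair_mem_appendSet]
    exact ((strCode_eq_insert_iff hn).1 h).2

/-- The relation `IsStep` on the trees that occur in the sequence `P`. -/
def stepSet (P : Iio θ → Set (Set Str)) : ZFSet.{0} :=
  setCode (fun q : Set Str × Set Str × Bool =>
    ZFSet.pair (ZFSet.pair (treeCode q.1) (treeCode q.2.1)) (boolCode q.2.2))
    {q | (∃ ξ, q.1 ∈ P ξ) ∧ (∃ ξ, q.2.1 ∈ P ξ) ∧ IsStep q.1 q.2.1 q.2.2}

theorem pair_mem_stepSet {S T : Set Str} {b : Bool} (hS : ∃ ξ, S ∈ P ξ) (hT : ∃ ξ, T ∈ P ξ) :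
    ZFSet.pair (ZFSet.pair (treeCode S) (treeCode T)) (boolCode b) ∈ stepSet P ↔
      IsStep S T b := by
  simp only [stepSet, mem_setCode, ZFSet.pair_inj, treeCode_inj, boolCode_inj, Prod.exists]
  constructor
  · rintro ⟨_, _, _, h, ⟨rfl, rfl⟩, rfl⟩
    exact h.2.2
  · exact fun h => ⟨_, _, _, ⟨hS, hT, h⟩, ⟨rfl, rfl⟩, rfl⟩

theorem IsCTM.stepSet_mem (hM : IsCTM M) (hP : seqCode P ∈ M) : stepSet P ∈ M := by
  have h2 := hM.boolSet_mem
  have h3 := hM.strSet_mem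
  have h4 := hM.treeSet_mem hP
  have h5 := hM.appendSet_mem
  have := hM.sep_mem (hM.prod_mem (hM.prod_mem h4 h4) h2)
    (Q := fun z => ∃ S ∈ treeSet P, ∃ T ∈ treeSet P, ∃ b ∈ boolSet,
      z = ZFSet.pair (ZFSet.pair S T) b ∧ T ⊆ S ∧ ∃ r ∈ strSet,
        (∀ j ∈ boolSet, ∃ q ∈ strSet, ZFSet.pair (ZFSet.pair r j) q ∈ appendSet ∧ q ∈ S) ∧
        (∀ t ∈ strSet, t ∈ S → r ⊆ t ∨ t ⊆ r) ∧
        ∃ q ∈ strSet, ZFSet.pair (ZFSet.pair r b) q ∈ appendSet ∧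
          ∀ t ∈ strSet, t ∈ T → q ⊆ t ∨ t ⊆ q)
    (Dfn.bex hM (DfnT.const h4) <| Dfn.bex hM (DfnT.const h4) <| Dfn.bex hM (DfnT.const h2) <|
      .and ((DfnT.var 3).eq (((DfnT.var 2).opair hM (DfnT.var 1)).opair hM (DfnT.var 0))) <|
      .and ((DfnT.var 1).subset hM (DfnT.var 2)) <| Dfn.bex hM (DfnT.const h3) <|
      .and (Dfn.ball hM (DfnT.const h2) <| Dfn.bex hM (DfnT.const h3) <|
        .and ((((DfnT.var 2).opair hM (DfnT.var 1)).opair hM (DfnT.var 0)).mem (DfnT.const h5))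
          ((DfnT.var 0).mem (DfnT.var 5))) <|
      .and (Dfn.ball hM (DfnT.const h3) <| .imp ((DfnT.var 0).mem (DfnT.var 4)) <|
        .or ((DfnT.var 1).subset hM (DfnT.var 0)) ((DfnT.var 0).subset hM (DfnT.var 1))) <|
      Dfn.bex hM (DfnT.const h3) <|
      .and ((((DfnT.var 1).opair hM (DfnT.var 2)).opair hM (DfnT.var 0)).mem (DfnT.const h5)) <|
      Dfn.ball hM (DfnT.const h3) <| .imp ((DfnT.var 0).mem (DfnT.var 4)) <|
        .or ((DfnT.var 1).subset hM (DfnT.var 0)) ((DfnT.var 0).subset hM (DfnT.var 1)))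
  convert this
  ext z
  rw [ZFSet.mem_sep]
  simp only [mem_strSet, mem_boolSet, mem_treeSet, exists_exists_and_eq_and, exists_exists_eq_and,
    forall_exists_index, forall_apply_eq_imp_iff, pair_mem_appendSet, exists_eq_left]
  constructor
  · intro h
    obtain ⟨⟨S, T, b⟩, ⟨hS, hT, hTS, r, hr⟩, rfl⟩ := mem_setCode.1 h
    have hS' : treeCode S ∈ treeSet P := mem_treeSet.2 ⟨S, hS, rfl⟩
    have hT' : treeCode T ∈ treeSet P := mem_treeSet.2 ⟨T, hT, rfl⟩
    exact ⟨ZFSet.pair_mem_prod.2 ⟨ZFSet.pair_mem_prod.2 ⟨hS', hT'⟩, mem_boolSet.2 ⟨_, rfl⟩⟩,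
      S, hS, T, hT, b, rfl, treeCode_subset.2 hTS, r, by simpa using hr⟩
  · rintro ⟨-, S, hS, T, hT, b, rfl, hTS, r, h⟩
    rw [pair_mem_stepSet hS hT]
    exact ⟨treeCode_subset.1 hTS, r, by simpa using h⟩

end

/-! ### The set of all multisystems in the model -/

section

variable {M : Set ZFSet.{0}} {θ : Ordinal.{0}} {P : Iio θ → Set (Set Str)}

/-- The relation between the places `(ξ, k)` and the finite splitting systems over `P ξ`. -/
def fssSet (P : Iio θ → Set (Set Str)) : ZFSet.{0} :=
  setCode (fun q : (Iio θ × ℕ) × Sys => ZFSet.pair (placeCode q.1) (sysCode q.2))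
    {q | IsFSS (P q.1.1) q.2}

theorem sysCode_finite (φ : Sys) : (sysCode φ : Set ZFSet.{0}).Finite := by
  refine ((List.finite_length_lt Bool φ.height).image
    fun s => ZFSet.pair (strCode s) (treeCode (φ.tree s))).subset ?_
  intro z hz
  obtain ⟨s, hs, rfl⟩ := mem_sysCode.1 hz
  exact ⟨s, hs, rfl⟩

/-- The condition, in terms of codes, that `y` is a splitting system over the forcing notion that
belongs to the place `p`. -/
def FSSCond (P : Iio θ → Set (Set Str)) (p y : ZFSet.{0}) : Prop :=
  (∃ n ∈ omegaSet, ∀ s ∈ strSet, ∀ k ∈ omegaSet, ZFSet.pair s k ∈ lengthSet →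
    (k ∈ n → ∃ T ∈ treeSet P, ZFSet.pair p T ∈ placedTreeSet P ∧
      ∀ S ∈ treeSet P, ZFSet.pair s S ∈ y ↔ S = T) ∧
    (k ∉ n → ∀ S ∈ treeSet P, ZFSet.pair s S ∉ y)) ∧
  ∀ s ∈ strSet, ∀ b ∈ boolSet, ∀ t ∈ strSet, ZFSet.pair (ZFSet.pair s b) t ∈ appendSet →
    ∀ S ∈ treeSet P, ∀ T ∈ treeSet P, ZFSet.pair s S ∈ y → ZFSet.pair t T ∈ y →
      ZFSet.pair (ZFSet.pair S T) b ∈ stepSet P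

theorem IsCTM.dfn_fssCond (hM : IsCTM M) (hP : seqCode P ∈ M) :
    Dfn M fun v : Fin 2 → ZFSet.{0} => FSSCond P (v 0) (v 1) := by
  have h1 := hM.omegaSet_mem
  have h2 := hM.boolSet_mem
  have h3 := hM.strSet_mem
  have h4 := hM.treeSet_mem hP
  exact Dfn.and
    (Dfn.bex hM (DfnT.const h1) <| Dfn.ball hM (DfnT.const h3) <| Dfn.ball hM (DfnT.const h1) <|
      .imp (((DfnT.var 1).opair hM (DfnT.var 0)).mem (DfnT.const hM.lengthSet_mem)) <|
      .and (.imp ((DfnT.var 0).mem (DfnT.var 2)) <| Dfn.bex hM (DfnT.const h4) <|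
        .and (((DfnT.var 4).opair hM (DfnT.var 0)).mem (DfnT.const (hM.placedTreeSet_mem hP))) <|
        Dfn.ball hM (DfnT.const h4) <|
          .iff (((DfnT.var 3).opair hM (DfnT.var 0)).mem (DfnT.var 6))
            ((DfnT.var 0).eq (DfnT.var 1)))
        (.imp ((DfnT.var 0).mem (DfnT.var 2)).not <| Dfn.ball hM (DfnT.const h4) <|
          (((DfnT.var 2).opair hM (DfnT.var 0)).mem (DfnT.var 5)).not))
    (Dfn.ball hM (DfnT.const h3) <| Dfn.ball hM (DfnT.const h2) <| Dfn.ball hM (DfnT.const h3) <|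
      .imp ((((DfnT.var 2).opair hM (DfnT.var 1)).opair hM (DfnT.var 0)).mem
        (DfnT.const hM.appendSet_mem)) <|
      Dfn.ball hM (DfnT.const h4) <| Dfn.ball hM (DfnT.const h4) <|
      .imp (((DfnT.var 4).opair hM (DfnT.var 1)).mem (DfnT.var 6)) <|
      .imp (((DfnT.var 2).opair hM (DfnT.var 0)).mem (DfnT.var 6)) <|
      (((DfnT.var 1).opair hM (DfnT.var 0)).opair hM (DfnT.var 3)).mem
        (DfnT.const (hM.stepSet_mem hP)))

theorem forall_mem_treeSet {R : ZFSet.{0} → Prop} :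
    (∀ z ∈ treeSet P, R z) ↔ ∀ T ξ, T ∈ P ξ → R (treeCode T) := by
  simp only [mem_treeSet, forall_exists_index, and_imp]
  exact ⟨fun h T ξ hT => h _ T ξ hT rfl, fun h z T ξ hT hz => hz ▸ h T ξ hT⟩

theorem fssCond_iff (hP : ∀ ξ, IsPTF (P ξ)) {p : Iio θ × ℕ} {y : ZFSet.{0}}
    (hy : y ⊆ ZFSet.prod strSet (treeSet P)) :
    FSSCond P (placeCode p) y ↔ ∃ φ, IsFSS (P p.1) φ ∧ sysCode φ = y := by
  have htree : ∀ φ : Sys, IsFSS (P p.1) φ → ∀ s, s.length < φ.height → ∃ ξ, φ.tree s ∈ P ξ :=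
    fun φ hφ s hs => ⟨p.1, hφ.1 s hs⟩
  simp only [FSSCond, forall_mem_treeSet]
  simp only [mem_omegaSet, mem_strSet, mem_treeSet, mem_boolSet,
    exists_exists_eq_and, forall_exists_index, forall_apply_eq_imp_iff, pair_mem_lengthSet,
    natCode_mem_natCode, exists_exists_and_eq_and, pair_mem_appendSet, forall_eq',
    pair_mem_placedTreeSet, treeCode_inj]
  constructor
  · rintro ⟨⟨n, h1⟩, h2⟩
    have h1a : ∀ s : Str, s.length < n → ∃ T, (∃ ξ, T ∈ P ξ) ∧ T ∈ P p.1 ∧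
        ∀ S, ∀ ξ, S ∈ P ξ → (ZFSet.pair (strCode s) (treeCode S) ∈ y ↔ S = T) := by
      intro s hs
      exact (h1 s).1 hs
    choose! f hf hfp hfy using h1a
    have hfin : ∀ s, n ≤ s.length → (if s.length < n then f s else ∅) = ∅ := fun s hs =>
      if_neg (by omega)
    refine ⟨⟨n, fun s => if s.length < n then f s else ∅, hfin⟩,
      (isFSS_iff (hP p.1)).2 ⟨fun s hs => ?_, fun s i hs => ?_⟩, ?_⟩
    · simp only at hs ⊢
      rw [if_pos hs]
      exact hfp s hs
    · have hs' : s.length < n := by simp at hs; omega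
      simp only at hs ⊢
      rw [if_pos hs, if_pos hs']
      obtain ⟨ξ, hξ⟩ := hf s hs'
      obtain ⟨ζ, hζ⟩ := hf _ hs
      refine (pair_mem_stepSet ⟨ξ, hξ⟩ ⟨ζ, hζ⟩).1 ?_
      exact h2 s i _ rfl _ ξ hξ _ ζ hζ ((hfy s hs' _ ξ hξ).2 rfl)
        ((hfy _ hs _ ζ hζ).2 rfl)
    · ext z
      rw [mem_sysCode]
      constructor
      · rintro ⟨s, hs, rfl⟩
        simp only at hs ⊢
        rw [if_pos hs]
        exact (hfy s hs _ _ (hfp s hs)).2 rfl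
      · intro hz
        obtain ⟨a, ha, b, hb, rfl⟩ := ZFSet.mem_prod.1 (hy hz)
        obtain ⟨s, rfl⟩ := mem_strSet.1 ha
        obtain ⟨T, ⟨ξ, hT⟩, rfl⟩ := mem_treeSet.1 hb
        by_cases hs : s.length < n
        · refine ⟨s, hs, ?_⟩
          simp only
          rw [if_pos hs, (hfy s hs _ _ hT).1 hz]
        · exact absurd hz ((h1 s).2 hs T ξ hT)
  · rintro ⟨φ, hφ, rfl⟩
    have hφ' := (isFSS_iff (hP p.1)).1 hφ
    refine ⟨⟨φ.height, ?_⟩, ?_⟩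
    · refine fun s => ⟨fun hs => ⟨φ.tree s, htree φ hφ s hs, hφ.1 s hs, ?_⟩, ?_⟩
      · intro S ξ hS
        simp [hs]
      · intro hs S ξ hS
        simp [hs]
    · rintro s b _ rfl S ξ hS T ζ hT h1 h2
      rw [pair_mem_sysCode, treeCode_inj] at h1 h2
      rw [pair_mem_stepSet ⟨ξ, hS⟩ ⟨ζ, hT⟩, h1.2, h2.2]
      exact hφ'.2 s b h2.1

theorem sysCode_subset {p : Iio θ × ℕ} {φ : Sys} (hφ : IsFSS (P p.1) φ) :
    sysCode φ ⊆ ZFSet.prod strSet (treeSet P) := by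
  intro z hz
  obtain ⟨s, hs, rfl⟩ := mem_sysCode.1 hz
  exact ZFSet.pair_mem_prod.2 ⟨mem_strSet.2 ⟨s, rfl⟩, mem_treeSet.2 ⟨_, ⟨_, hφ.1 s hs⟩, rfl⟩⟩

theorem IsCTM.fssSet_mem (hM : IsCTM M) (hP : seqCode P ∈ M) (hPP : ∀ ξ, IsPTF (P ξ)) :
    fssSet P ∈ M := by
  have h4 := hM.placeSet_mem hP
  have h5 := hM.finSubsets_mem (hM.prod_mem hM.strSet_mem (hM.treeSet_mem hP))
  have := hM.sep_mem (hM.prod_mem h4 h5)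
    (Q := fun z => ∃ p ∈ placeSet θ, ∃ y ∈ finSubsets (ZFSet.prod strSet (treeSet P)),
      z = ZFSet.pair p y ∧ FSSCond P p y)
    (Dfn.bex hM (DfnT.const h4) <| Dfn.bex hM (DfnT.const h5) <|
      .and ((DfnT.var 2).eq ((DfnT.var 1).opair hM (DfnT.var 0)))
        ((hM.dfn_fssCond hP).rename ![1, 0]))
  convert this
  ext z
  rw [ZFSet.mem_sep]
  constructor
  · intro h
    obtain ⟨⟨p, φ⟩, hφ, rfl⟩ := mem_setCode.1 h
    have h1 : placeCode p ∈ placeSet θ := mem_placeSet.2 ⟨p, rfl⟩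
    have h2 : sysCode φ ∈ finSubsets (ZFSet.prod strSet (treeSet P)) :=
      mem_finSubsets.2 ⟨sysCode_subset hφ, sysCode_finite φ⟩
    exact ⟨ZFSet.pair_mem_prod.2 ⟨h1, h2⟩, _, h1, _, h2, rfl,
      (fssCond_iff hPP (sysCode_subset hφ)).2 ⟨φ, hφ, rfl⟩⟩
  · rintro ⟨-, p, hp, y, hy, rfl, h⟩
    obtain ⟨p, rfl⟩ := mem_placeSet.1 hp
    obtain ⟨φ, hφ, rfl⟩ := (fssCond_iff hPP (mem_finSubsets.1 hy).1).1 h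
    exact mem_setCode.2 ⟨(p, φ), hφ, rfl⟩

/-- The empty system. -/
def emptySys : Sys := ⟨0, fun _ => ∅, fun _ _ => rfl⟩

theorem isFSS_emptySys (Q : Set (Set Str)) : IsFSS Q emptySys :=
  ⟨fun s hs => by simp [emptySys] at hs, fun s i hs => by simp [emptySys] at hs⟩

theorem sysCode_of_height_eq_zero {φ : Sys} (h : φ.height = 0) : sysCode φ = ∅ := by
  rw [ZFSet.eq_empty]
  intro z hz
  obtain ⟨s, hs, -⟩ := mem_sysCode.1 hz
  omega

theorem pair_mem_fssSet {p : Iio θ × ℕ} {y : ZFSet.{0}} :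
    ZFSet.pair (placeCode p) y ∈ fssSet P ↔ ∃ φ, IsFSS (P p.1) φ ∧ sysCode φ = y := by
  simp only [fssSet, mem_setCode, ZFSet.pair_inj, placeCode_inj, Prod.exists]
  constructor
  · rintro ⟨_, _, φ, h, rfl, rfl⟩
    exact ⟨φ, h, rfl⟩
  · rintro ⟨φ, h, rfl⟩
    exact ⟨_, _, φ, h, rfl, rfl⟩

/-- Every multisystem is obtained from the empty one by the removal of a finite set of pairs and
the addition of another one. -/
theorem IsCTM.msSetCode_mem (hM : IsCTM M) (hP : seqCode P ∈ M) (hPP : ∀ ξ, IsPTF (P ξ)) :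
    msSetCode (MS P) ∈ M := by
  have hplace := hM.placeSet_mem hP
  have hbase := hM.prod_mem hplace (hM.singleton_mem hM.empty_mem)
  have hfin := hM.finSubsets_mem (hM.fssSet_mem hP hPP)
  obtain ⟨Z, hZ, hZ'⟩ := hM.exists_image₂ hfin hfin
    (F := fun E S => (ZFSet.prod (placeSet θ) {∅} \ E) ∪ S)
    (((DfnT.const hbase).sdiff hM (DfnT.var 0)).union hM (DfnT.var 1))
  have := hM.sep_mem hZ
    (Q := fun z => ∀ p ∈ placeSet θ, ∃ y ∈ M, ∀ y' ∈ M, ZFSet.pair p y' ∈ z ↔ y' = y)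
    (Dfn.ball hM (DfnT.const hplace) <| Dfn.ex <| Dfn.all <|
      .iff (((DfnT.var 2).opair hM (DfnT.var 0)).mem (DfnT.var 3)) ((DfnT.var 0).eq (DfnT.var 1)))
  convert this
  ext z
  rw [ZFSet.mem_sep, hZ', msSetCode, mem_setCode]
  constructor
  · rintro ⟨A, hA, rfl⟩
    have hsub : ∀ (f : Iio θ × ℕ → Sys), (∀ p, IsFSS (P p.1) (f p)) →
        ∃ E ∈ finSubsets (fssSet P), ∀ z, z ∈ E ↔ ∃ p : Iio θ × ℕ,
          (A p.1 p.2).height ≠ 0 ∧ ZFSet.pair (placeCode p) (sysCode (f p)) = z := by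
      intro f hf
      have hmem : ∀ p, ZFSet.pair (placeCode p) (sysCode (f p)) ∈ fssSet P := fun p =>
        pair_mem_fssSet.2 ⟨_, hf p, rfl⟩
      have hEfin := hA.1.image fun p => ZFSet.pair (placeCode p) (sysCode (f p))
      obtain ⟨E, hE, h⟩ := hM.exists_of_finite hEfin (by
        rintro _ ⟨p, -, rfl⟩
        exact hM.mem_of_mem (hM.fssSet_mem hP hPP) (hmem p))
      refine ⟨E, mem_finSubsets.2 ⟨fun z hz => ?_, hEfin.subset fun z hz => (h z).1 hz⟩, h⟩
      obtain ⟨p, -, rfl⟩ := (h z).1 hz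
      exact hmem p
    obtain ⟨E, hE, hE'⟩ := hsub (fun _ => emptySys) fun _ => isFSS_emptySys _
    obtain ⟨S, hS, hS'⟩ := hsub (fun p => A p.1 p.2) fun p => hA.2 p.1 p.2
    refine ⟨⟨E, hE, S, hS, ?_⟩, fun p hp => ?_⟩
    · ext z
      rw [mem_matCode, ZFSet.mem_union, ZFSet.mem_sdiff, hE', hS', ZFSet.mem_prod]
      constructor
      · rintro ⟨p, rfl⟩
        by_cases hp : (A p.1 p.2).height = 0
        · left
          refine ⟨⟨_, mem_placeSet.2 ⟨p, rfl⟩, ∅, by simp, by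
            rw [sysCode_of_height_eq_zero hp]⟩, ?_⟩
          rintro ⟨q, hq, h⟩
          rw [ZFSet.pair_inj, placeCode_inj] at h
          exact hq (h.1 ▸ hp)
        · exact .inr ⟨p, hp, rfl⟩
      · rintro (⟨⟨a, ha, b, hb, rfl⟩, h⟩ | ⟨p, -, rfl⟩)
        · obtain ⟨p, rfl⟩ := mem_placeSet.1 ha
          obtain rfl := ZFSet.mem_singleton.1 hb
          refine ⟨p, ?_⟩
          rw [sysCode_of_height_eq_zero]
          by_contra hp
          exact h ⟨p, hp, by rw [sysCode_of_height_eq_zero (φ := emptySys) rfl]⟩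
        · exact ⟨p, rfl⟩
    · obtain ⟨p, rfl⟩ := mem_placeSet.1 hp
      refine ⟨sysCode (A p.1 p.2), ?_, fun y' _ => by simp⟩
      have : ZFSet.pair (placeCode p) (sysCode (A p.1 p.2)) ∈ fssSet P :=
        pair_mem_fssSet.2 ⟨_, hA.2 p.1 p.2, rfl⟩
      exact (hM.of_opair_mem (hM.mem_of_mem (hM.fssSet_mem hP hPP) this)).2
  · rintro ⟨⟨E, -, S, hS, rfl⟩, h⟩
    obtain ⟨hS, hSfin⟩ := mem_finSubsets.1 hS
    have hz : ∀ x ∈ (ZFSet.prod (placeSet θ) {∅} \ E) ∪ S, ∃ p : Iio θ × ℕ, ∃ φ,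
        IsFSS (P p.1) φ ∧ x = ZFSet.pair (placeCode p) (sysCode φ) ∧ (φ.height ≠ 0 → x ∈ S) := by
      intro x hx
      rcases ZFSet.mem_union.1 hx with hx | hx
      · obtain ⟨a, ha, b, hb, rfl⟩ := ZFSet.mem_prod.1 (ZFSet.mem_sdiff.1 hx).1
        obtain ⟨p, rfl⟩ := mem_placeSet.1 ha
        obtain rfl := ZFSet.mem_singleton.1 hb
        exact ⟨p, emptySys, isFSS_emptySys _, by
          rw [sysCode_of_height_eq_zero (φ := emptySys) rfl], fun h => absurd rfl h⟩
      · obtain ⟨⟨p, φ⟩, hφ, rfl⟩ := mem_setCode.1 (hS hx)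
        exact ⟨p, φ, hφ, rfl, fun _ => hx⟩
    have hex : ∀ p : Iio θ × ℕ, ∃ φ, IsFSS (P p.1) φ ∧
        (∀ y' ∈ M, ZFSet.pair (placeCode p) y' ∈ (ZFSet.prod (placeSet θ) {∅} \ E) ∪ S ↔
          y' = sysCode φ) ∧
        (φ.height ≠ 0 → ZFSet.pair (placeCode p) (sysCode φ) ∈ S) := by
      intro p
      obtain ⟨y, hy, hy'⟩ := h (placeCode p) (mem_placeSet.2 ⟨p, rfl⟩)
      obtain ⟨q, φ, hφ, heq, hh⟩ := hz _ ((hy' y hy).2 rfl)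
      rw [ZFSet.pair_inj, placeCode_inj] at heq
      obtain ⟨rfl, rfl⟩ := heq
      exact ⟨φ, hφ, hy', hh⟩
    choose A hA hA' hAS using hex
    refine ⟨fun ξ m => A (ξ, m), ⟨?_, fun ξ m => hA (ξ, m)⟩, ?_⟩
    · refine Set.Finite.of_finite_image (f := fun p => ZFSet.pair (placeCode p) (sysCode (A p)))
        (hSfin.subset ?_) ?_
      · rintro _ ⟨p, hp, rfl⟩
        exact hAS p hp
      · intro p _ q _ hpq
        simp only [ZFSet.pair_inj, placeCode_inj] at hpq
        exact hpq.1
    · have hAM : ∀ p, sysCode (A p) ∈ M := fun p =>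
        (hM.of_opair_mem (hM.mem_of_mem (hM.fssSet_mem hP hPP)
          (pair_mem_fssSet.2 ⟨_, hA p, rfl⟩))).2
      ext x
      rw [mem_matCode]
      constructor
      · rintro ⟨p, rfl⟩
        exact (hA' p _ (hAM p)).2 rfl
      · intro hx
        obtain ⟨p, φ, hφ, rfl, -⟩ := hz x hx
        refine ⟨p, ?_⟩
        have hφM : sysCode φ ∈ M := (hM.of_opair_mem (hM.mem_of_mem (hM.fssSet_mem hP hPP)
          (pair_mem_fssSet.2 ⟨_, hφ, rfl⟩))).2
        rw [(hA' p _ hφM).1 hx]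

/-- Separation for sets of multisystems. -/
theorem IsCTM.msSetCode_sep_mem (hM : IsCTM M) (hP : seqCode P ∈ M) (hPP : ∀ ξ, IsPTF (P ξ))
    {D : Mat θ Sys → Prop} {Q : ZFSet.{0} → Prop}
    (hQ : Dfn M fun v : Fin 1 → ZFSet.{0} => Q (v 0))
    (hDQ : ∀ A ∈ MS P, Q (matCode sysCode A) ↔ D A) :
    msSetCode {A | A ∈ MS P ∧ D A} ∈ M := by
  convert hM.sep_mem (hM.msSetCode_mem hP hPP) hQ
  ext z
  simp only [msSetCode, mem_setCode, ZFSet.mem_sep]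
  constructor
  · rintro ⟨A, ⟨hA, hD⟩, rfl⟩
    exact ⟨⟨A, hA, rfl⟩, (hDQ A hA).2 hD⟩
  · rintro ⟨⟨A, hA, rfl⟩, h⟩
    exact ⟨A, ⟨hA, (hDQ A hA).1 h⟩, rfl⟩

/-! ### Two dense sets in the model -/

theorem IsCTM.sysCode_mem (hM : IsCTM M) (hP : seqCode P ∈ M) (hPP : ∀ ξ, IsPTF (P ξ))
    {p : Iio θ × ℕ} {φ : Sys} (hφ : IsFSS (P p.1) φ) : sysCode φ ∈ M :=
  (hM.of_opair_mem (hM.mem_of_mem (hM.fssSet_mem hP hPP) (pair_mem_fssSet.2 ⟨_, hφ, rfl⟩))).2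

theorem IsCTM.rootSet_mem (hM : IsCTM M) (hP : seqCode P ∈ M) (hPP : ∀ ξ, IsPTF (P ξ))
    {ξ : Iio θ} {T : Set Str} (hT : T ∈ P ξ) :
    msSetCode {A | A ∈ MS P ∧ ∃ m, 0 < (A ξ m).height ∧ (A ξ m).tree [] = T} ∈ M := by
  refine hM.msSetCode_sep_mem hP hPP (Q := fun z => ∃ m ∈ omegaSet, ∃ y ∈ M,
    ZFSet.pair (ZFSet.pair ξ.1.toZFSet m) y ∈ z ∧ ZFSet.pair (strCode []) (treeCode T) ∈ y)
    (Dfn.bex hM (DfnT.const hM.omegaSet_mem) <| Dfn.ex <|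
      .and ((((DfnT.const (hM.seqCode_fst_mem hP ξ)).opair hM (DfnT.var 1)).opair hM
        (DfnT.var 0)).mem (DfnT.var 2))
      ((DfnT.const (hM.opair_mem (hM.strCode_mem _) (hM.treeCode_mem hP hT))).mem (DfnT.var 0)))
    fun A hA => ?_
  have hpl : ∀ m, ZFSet.pair ξ.1.toZFSet (natCode m) = placeCode (ξ, m) := fun _ => rfl
  simp only [mem_omegaSet, exists_exists_eq_and, hpl, pair_mem_matCode]
  refine exists_congr fun m => ⟨?_, fun h => ⟨_, hM.sysCode_mem hP hPP (p := (ξ, m)) (hA.2 ξ m),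
    rfl, ?_⟩⟩
  · rintro ⟨_, -, rfl, h⟩
    rw [pair_mem_sysCode, treeCode_inj] at h
    exact ⟨h.1, h.2.symm⟩
  · rw [pair_mem_sysCode, treeCode_inj]
    exact ⟨h.1, h.2.symm⟩

/-- The initial segment of length `n` of `β`. -/
def branch (β : ℕ → Bool) (n : ℕ) : Str := (List.range n).map β

@[simp] theorem length_branch (β : ℕ → Bool) (n : ℕ) : (branch β n).length = n := by
  simp [branch]

theorem getElem?_branch {β : ℕ → Bool} {n i : ℕ} (h : i < n) : (branch β n)[i]? = some (β i) := by
  simp [branch, h]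

theorem branch_prefix (β : ℕ → Bool) {m n : ℕ} (h : m ≤ n) : branch β m <+: branch β n := by
  rw [List.prefix_iff_getElem?]
  intro i hi
  rw [length_branch] at hi
  simp [branch, hi.trans_le h]

/-- An assignment of the places of multitrees to nodes of multisystems: the place `(ξ, k)` follows
the branch `br ξ k` of the system with the index `(ξ, idx ξ k)`. Two places never follow the same
branch of the same system. Outside of a finite set of exceptional places, the assignment is the
canonical one: `(ξ, k)` follows the branch of ones of the system with the index `(ξ, k)`. This, and
the requirement that all branches are eventually constant, puts the code of the assignment into the
models under consideration. -/
structure Assignment (θ : Ordinal.{0}) where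
  idx : Iio θ → ℕ → ℕ
  br : Iio θ → ℕ → ℕ → Bool
  inj : ∀ ξ k l, idx ξ k = idx ξ l → br ξ k = br ξ l → k = l
  exceptional : Set (Iio θ × ℕ)
  finite : exceptional.Finite
  idx_eq : ∀ ξ k, (ξ, k) ∉ exceptional → idx ξ k = k
  br_eq : ∀ ξ k, (ξ, k) ∉ exceptional → br ξ k = fun _ => true
  eventually_true : ∀ ξ k, ∃ n, ∀ i, n ≤ i → br ξ k i = true

/-- The code of an assignment: the relation between a place `p` and the pairs `(q, t)` for which
`t` is a string on the branch of the system with the index `q` which the place `p` follows. -/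
def Assignment.code (a : Assignment θ) : ZFSet.{0} :=
  setCode (fun z : (Iio θ × ℕ) × ℕ => ZFSet.pair (placeCode z.1)
    (ZFSet.pair (placeCode (z.1.1, a.idx z.1.1 z.1.2)) (strCode (branch (a.br z.1.1 z.1.2) z.2))))
    univ

theorem Assignment.pair_mem_code {a : Assignment θ} {p q : Iio θ × ℕ} {t : Str} :
    ZFSet.pair (placeCode p) (ZFSet.pair (placeCode q) (strCode t)) ∈ a.code ↔
      q = (p.1, a.idx p.1 p.2) ∧ t = branch (a.br p.1 p.2) t.length := by
  simp only [code, mem_setCode, mem_univ, true_and, ZFSet.pair_inj, placeCode_inj, strCode_inj,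
    Prod.exists]
  constructor
  · rintro ⟨_, _, n, rfl, rfl, rfl⟩
    simp
  · rintro ⟨rfl, h⟩
    exact ⟨_, _, t.length, rfl, rfl, h.symm⟩

/-- The set of the initial segments of `β`. -/
def branchSet (β : ℕ → Bool) : ZFSet.{0} := ZFSet.range fun n => strCode (branch β n)

theorem IsCTM.branchSet_mem (hM : IsCTM M) {β : ℕ → Bool} {n : ℕ} (hβ : ∀ i, n ≤ i → β i = true) :
    branchSet β ∈ M := by
  have hb : ∃ b ∈ M, ∀ i c, ZFSet.pair (natCode i) (boolCode c) ∈ b ↔ β i = c := by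
    refine ⟨strCode (branch β n) ∪ ZFSet.prod (omegaSet \ natCode n) {boolCode true},
      hM.union_mem (hM.strCode_mem _) (hM.prod_mem
        (hM.sdiff_mem hM.omegaSet_mem (hM.natCode_mem _)) (hM.singleton_mem (hM.natCode_mem _))),
      fun i c => ?_⟩
    rw [ZFSet.mem_union, pair_mem_strCode, ZFSet.pair_mem_prod, ZFSet.mem_sdiff,
      natCode_mem_natCode, ZFSet.mem_singleton, boolCode_inj]
    by_cases hi : i < n
    · rw [getElem?_branch hi]
      simp [hi]
    · simp [hβ i (not_lt.1 hi), hi, branch, eq_comm]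
  obtain ⟨b, hb, h⟩ := hb
  convert hM.sep_mem hM.strSet_mem (Q := fun s => s ⊆ b)
    ((DfnT.var 0).subset hM (DfnT.const hb))
  ext z
  rw [ZFSet.mem_sep, mem_strSet, branchSet, ZFSet.mem_range]
  constructor
  · rintro ⟨k, rfl⟩
    refine ⟨⟨_, rfl⟩, fun z hz => ?_⟩
    obtain ⟨i, c, hi, rfl⟩ := mem_strCode.1 hz
    rw [h]
    have := (List.getElem?_eq_some_iff.1 hi).1
    rw [length_branch] at this
    rw [getElem?_branch this] at hi
    simpa using hi
  · rintro ⟨⟨s, rfl⟩, hs⟩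
    refine ⟨s.length, congrArg _ (List.ext_getElem (by simp) fun i h1 h2 => ?_)⟩
    have := (h i s[i]).1 (hs (pair_mem_strCode.2 (List.getElem?_eq_getElem h2)))
    simp [branch, this]

/-- The code of an assignment is in the model: it differs from a definable set by finitely many
sets of branches. -/
theorem IsCTM.assignment_mem (hM : IsCTM M) (hP : seqCode P ∈ M) (a : Assignment θ) :
    a.code ∈ M := by
  have hplace := hM.placeSet_mem hP
  have htrue := hM.branchSet_mem (β := fun _ => true) (n := 0) fun _ _ => rfl
  obtain ⟨B, hB, hB'⟩ := hM.exists_image₂ hplace htrue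
    (F := fun p t => ZFSet.pair p (ZFSet.pair p t))
    ((DfnT.var 0).opair hM ((DfnT.var 0).opair hM (DfnT.var 1)))
  have hEfin := a.finite.image (placeCode (θ := θ))
  obtain ⟨E, hE, hE'⟩ := hM.exists_of_finite hEfin (by
    rintro _ ⟨p, -, rfl⟩
    exact hM.placeCode_mem hP p)
  let f : Iio θ × ℕ → ZFSet.{0} := fun p =>
    ZFSet.prod {placeCode p} (ZFSet.prod {placeCode (p.1, a.idx p.1 p.2)} (branchSet (a.br p.1 p.2)))
  obtain ⟨C, hC, hC'⟩ := hM.exists_of_finite (a.finite.image f) (by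
    rintro _ ⟨p, -, rfl⟩
    obtain ⟨n, hn⟩ := a.eventually_true p.1 p.2
    exact hM.prod_mem (hM.singleton_mem (hM.placeCode_mem hP _))
      (hM.prod_mem (hM.singleton_mem (hM.placeCode_mem hP _)) (hM.branchSet_mem hn)))
  have hset := hM.strSet_mem
  convert hM.union_mem (hM.sdiff_mem hB (hM.prod_mem hE (hM.prod_mem hplace hset)))
    (hM.sUnion_mem hC)
  ext z
  rw [ZFSet.mem_union, ZFSet.mem_sdiff, hB', ZFSet.mem_sUnion]
  constructor
  · intro hz
    obtain ⟨⟨p, n⟩, -, rfl⟩ := mem_setCode.1 hz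
    by_cases hp : p ∈ a.exceptional
    · right
      exact ⟨f p, (hC' _).2 ⟨p, hp, rfl⟩, ZFSet.pair_mem_prod.2 ⟨by simp, ZFSet.pair_mem_prod.2
        ⟨by simp, ZFSet.mem_range.2 ⟨n, rfl⟩⟩⟩⟩
    · left
      have h1 := a.idx_eq _ _ hp
      have h2 := a.br_eq _ _ hp
      simp only [h1, h2]
      refine ⟨⟨_, mem_placeSet.2 ⟨p, rfl⟩, _, ZFSet.mem_range.2 ⟨n, rfl⟩, rfl⟩, fun h => ?_⟩
      obtain ⟨q, hq, hq'⟩ := (hE' _).1 (ZFSet.pair_mem_prod.1 h).1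
      exact hp (placeCode_inj.1 hq' ▸ hq)
  · rintro (⟨⟨x, hx, y, hy, rfl⟩, h⟩ | ⟨y, hy, hz⟩)
    · obtain ⟨p, rfl⟩ := mem_placeSet.1 hx
      obtain ⟨n, rfl⟩ := ZFSet.mem_range.1 hy
      have hp : p ∉ a.exceptional := fun hp => h <| ZFSet.pair_mem_prod.2
        ⟨(hE' _).2 ⟨p, hp, rfl⟩, ZFSet.pair_mem_prod.2
          ⟨mem_placeSet.2 ⟨p, rfl⟩, mem_strSet.2 ⟨_, rfl⟩⟩⟩
      rw [Assignment.pair_mem_code, a.idx_eq _ _ hp, a.br_eq _ _ hp]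
      simp
    · obtain ⟨p, -, rfl⟩ := (hC' _).1 hy
      obtain ⟨x, hx, y, hy, rfl⟩ := ZFSet.mem_prod.1 hz
      obtain ⟨x', hx', y', hy', rfl⟩ := ZFSet.mem_prod.1 hy
      obtain rfl := ZFSet.mem_singleton.1 hx
      obtain rfl := ZFSet.mem_singleton.1 hx'
      obtain ⟨n, rfl⟩ := ZFSet.mem_range.1 hy'
      rw [Assignment.pair_mem_code]
      simp

/-- The multitree that consists of the trees of the multisystem `A` on the branches which the
places follow. -/
def Assignment.tree (a : Assignment θ) (A : Mat θ Sys) : Mat θ (Set Str) := fun ξ k =>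
  {x | ∀ n < (A ξ (a.idx ξ k)).height, x ∈ (A ξ (a.idx ξ k)).tree (branch (a.br ξ k) n)}

/-- A strong form of direct forcing, with a single element of each of the sets that form the
name. -/
def StronglyForces (T : Mat θ (Set Str)) (s : Str) (c : ℕ → Bool → Set (Mat θ (Set Str))) : Prop :=
  ∀ i b, s[i]? = some b → ∃ S ∈ c i b, Stronger T S

/-- The property of a multisystem `A` which produces the multitree required by the theorem: the
multitree that `A` defines forces an initial segment `s` of the real with the name `c`, and `s`
is outside of all trees at some level of the system with the index `q`. -/
def Decides (a : Assignment θ) (c : ℕ → Bool → Set (Mat θ (Set Str))) (q : Iio θ × ℕ)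
    (A : Mat θ Sys) : Prop :=
  ∃ s, StronglyForces (a.tree A) s c ∧ ∃ l < (A q.1 q.2).height,
    ∀ t : Str, t.length = l → s ∉ (A q.1 q.2).tree t

theorem pair_mem_nameCode {c : ℕ → Bool → Set (Mat θ (Set Str))} {i : ℕ} {b : Bool}
    {z : ZFSet.{0}} : ZFSet.pair (ZFSet.pair (natCode i) (boolCode b)) z ∈ nameCode c ↔
      z = setCode (matCode treeCode) (c i b) := by
  simp only [nameCode, funCode, ZFSet.mem_range, ZFSet.pair_inj, natCode_inj, boolCode_inj]
  constructor
  · rintro ⟨⟨⟨j, d⟩, -⟩, ⟨rfl, rfl⟩, rfl⟩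
    rfl
  · rintro rfl
    exact ⟨⟨(i, b), mem_univ _⟩, ⟨rfl, rfl⟩, rfl⟩

/-- The value of the multitree of `A` at a place, which is an intersection of trees, is described by
the code of the assignment without reference to heights. -/
theorem IsCTM.decides_mem (hM : IsCTM M) (hP : seqCode P ∈ M) (hPP : ∀ ξ, IsPTF (P ξ))
    (a : Assignment θ) {c : ℕ → Bool → Set (Mat θ (Set Str))} (hc : nameCode c ∈ M)
    (q : Iio θ × ℕ) : msSetCode {A | A ∈ MS P ∧ Decides a c q A} ∈ M := by
  have h1 := hM.omegaSet_mem
  have h2 := hM.boolSet_mem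
  have h3 := hM.strSet_mem
  have h4 := hM.placeSet_mem hP
  have h5 := hM.assignment_mem hP a
  have h6 := hM.lengthSet_mem
  have h7 := hM.placeCode_mem hP q
  have hcM : ∀ i b, setCode (matCode treeCode) (c i b) ∈ M := fun i b =>
    (hM.of_opair_mem (hM.mem_of_mem hc (pair_mem_nameCode (i := i) (b := b).2 rfl))).2
  have hSM : ∀ i b, ∀ S ∈ c i b, ∀ p : Iio θ × ℕ, treeCode (S p.1 p.2) ∈ M := fun i b S hS p => by
    have h : ZFSet.pair (placeCode p) (treeCode (S p.1 p.2)) ∈ matCode treeCode S := by simp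
    exact (hM.of_opair_mem (hM.mem_of_mem (hM.mem_of_mem (hcM i b) (mem_setCode.2 ⟨S, hS, rfl⟩))
      h)).2
  refine hM.msSetCode_sep_mem hP hPP (Q := fun z => ∃ s ∈ strSet,
    (∀ i ∈ omegaSet, ∀ b ∈ boolSet, ZFSet.pair i b ∈ s →
      ∃ Z ∈ M, ZFSet.pair (ZFSet.pair i b) Z ∈ nameCode c ∧ ∃ S ∈ Z, ∀ p ∈ placeSet θ,
        ∀ x ∈ strSet, (∀ r ∈ placeSet θ, ∀ t ∈ strSet, ∀ y ∈ M, ∀ T ∈ M,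
          ZFSet.pair p (ZFSet.pair r t) ∈ a.code → ZFSet.pair r y ∈ z → ZFSet.pair t T ∈ y →
            x ∈ T) → ∃ Y ∈ M, ZFSet.pair p Y ∈ S ∧ x ∈ Y) ∧
    ∃ l ∈ omegaSet, ∀ t ∈ strSet, ZFSet.pair t l ∈ lengthSet → ∃ y ∈ M, ∃ T ∈ M,
      ZFSet.pair (placeCode q) y ∈ z ∧ ZFSet.pair t T ∈ y ∧ s ∉ T)
    (Dfn.bex hM (DfnT.const h3) <| .and
      (Dfn.ball hM (DfnT.const h1) <| Dfn.ball hM (DfnT.const h2) <|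
        .imp (((DfnT.var 1).opair hM (DfnT.var 0)).mem (DfnT.var 2)) <| Dfn.ex <|
        .and ((((DfnT.var 2).opair hM (DfnT.var 1)).opair hM (DfnT.var 0)).mem (DfnT.const hc)) <|
        Dfn.bex hM (DfnT.var 0) <| Dfn.ball hM (DfnT.const h4) <| Dfn.ball hM (DfnT.const h3) <|
        .imp (Dfn.ball hM (DfnT.const h4) <| Dfn.ball hM (DfnT.const h3) <| Dfn.all <| Dfn.all <|
          .imp (((DfnT.var 5).opair hM ((DfnT.var 3).opair hM (DfnT.var 2))).mem
            (DfnT.const h5)) <|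
          .imp (((DfnT.var 3).opair hM (DfnT.var 1)).mem (DfnT.var 11)) <|
          .imp (((DfnT.var 2).opair hM (DfnT.var 0)).mem (DfnT.var 1))
            ((DfnT.var 4).mem (DfnT.var 0))) <|
        Dfn.ex <| .and (((DfnT.var 2).opair hM (DfnT.var 0)).mem (DfnT.var 3))
          ((DfnT.var 1).mem (DfnT.var 0)))
      (Dfn.bex hM (DfnT.const h1) <| Dfn.ball hM (DfnT.const h3) <|
        .imp (((DfnT.var 0).opair hM (DfnT.var 1)).mem (DfnT.const h6)) <| Dfn.ex <| Dfn.ex <|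
        .and (((DfnT.const h7).opair hM (DfnT.var 1)).mem (DfnT.var 5)) <|
        .and (((DfnT.var 2).opair hM (DfnT.var 0)).mem (DfnT.var 1))
          ((DfnT.var 4).mem (DfnT.var 0)).not))
    fun A hA => ?_
  have hsysM : ∀ p : Iio θ × ℕ, sysCode (A p.1 p.2) ∈ M := fun p =>
    hM.sysCode_mem hP hPP (hA.2 p.1 p.2)
  have htreeM : ∀ (p : Iio θ × ℕ) (t : Str), t.length < (A p.1 p.2).height →
      treeCode ((A p.1 p.2).tree t) ∈ M := fun p t ht =>
    hM.treeCode_mem hP ((hA.2 p.1 p.2).1 t ht)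
  -- Membership in the multitree that `A` defines, in terms of codes.
  have hx : ∀ (p : Iio θ × ℕ) (x : Str), (∀ r ∈ placeSet θ, ∀ t ∈ strSet, ∀ y ∈ M, ∀ T ∈ M,
      ZFSet.pair (placeCode p) (ZFSet.pair r t) ∈ a.code → ZFSet.pair r y ∈ matCode sysCode A →
        ZFSet.pair t T ∈ y → strCode x ∈ T) ↔ x ∈ a.tree A p.1 p.2 := by
    intro p x
    constructor
    · intro h n hn
      have h' := h (placeCode (p.1, a.idx p.1 p.2)) (mem_placeSet.2 ⟨_, rfl⟩)
        (strCode (branch (a.br p.1 p.2) n)) (mem_strSet.2 ⟨_, rfl⟩) _ (hsysM (p.1, a.idx p.1 p.2))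
        _ (htreeM (p.1, a.idx p.1 p.2) (branch (a.br p.1 p.2) n) (by simpa using hn))
        (Assignment.pair_mem_code.2 ⟨rfl, by simp⟩) (by simp) (by simpa using hn)
      exact strCode_mem_treeCode.1 h'
    · intro h r hr t ht y _ T _ h1 h2 h3
      obtain ⟨r, rfl⟩ := mem_placeSet.1 hr
      obtain ⟨t, rfl⟩ := mem_strSet.1 ht
      obtain ⟨rfl, h4⟩ := Assignment.pair_mem_code.1 h1
      obtain rfl := pair_mem_matCode.1 h2
      obtain ⟨h5, rfl⟩ := pair_mem_sysCode.1 h3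
      rw [strCode_mem_treeCode, h4]
      exact h _ h5
  simp only [Decides, mem_strSet, exists_exists_eq_and]
  refine exists_congr fun s => and_congr ?_ ?_
  · simp only [StronglyForces, mem_omegaSet, mem_boolSet, forall_exists_index,
      forall_apply_eq_imp_iff, pair_mem_strCode]
    refine forall₃_congr fun i b _ => ?_
    constructor
    · rintro ⟨Z, -, hZ, S, hSZ, h⟩
      obtain rfl := pair_mem_nameCode.1 hZ
      obtain ⟨S, hS, rfl⟩ := mem_setCode.1 hSZ
      refine ⟨S, hS, fun ξ k x hxA => ?_⟩
      obtain ⟨Y, -, hY, hxY⟩ := h (placeCode (ξ, k)) (mem_placeSet.2 ⟨_, rfl⟩) x ((by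
        simpa only [mem_strSet, forall_exists_index, forall_apply_eq_imp_iff] using
          (hx (ξ, k) x).2 hxA))
      obtain rfl := pair_mem_matCode.1 hY
      exact strCode_mem_treeCode.1 hxY
    · rintro ⟨S, hS, h⟩
      refine ⟨_, hcM i b, pair_mem_nameCode.2 rfl, _, mem_setCode.2 ⟨S, hS, rfl⟩, ?_⟩
      intro p hp x hxA
      obtain ⟨p, rfl⟩ := mem_placeSet.1 hp
      refine ⟨_, hSM i b S hS p, by simp, strCode_mem_treeCode.2 (h p.1 p.2 ((hx p x).1 ?_))⟩
      simpa only [mem_strSet, forall_exists_index, forall_apply_eq_imp_iff] using hxA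
  · simp only [mem_omegaSet, exists_exists_eq_and, forall_exists_index, forall_apply_eq_imp_iff,
      pair_mem_lengthSet]
    refine exists_congr fun l => ?_
    constructor
    · intro h
      have h' : ∀ t : Str, t.length = l → l < (A q.1 q.2).height ∧ s ∉ (A q.1 q.2).tree t := by
        intro t ht
        obtain ⟨y, -, T, -, h1, h2, h3⟩ := h t ht
        obtain rfl := pair_mem_matCode.1 h1
        obtain ⟨h4, rfl⟩ := pair_mem_sysCode.1 h2
        exact ⟨ht ▸ h4, fun hs => h3 (strCode_mem_treeCode.2 hs)⟩
      exact ⟨(h' (List.replicate l true) (by simp)).1, fun t ht => (h' t ht).2⟩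
    · rintro ⟨hl, h⟩ t ht
      exact ⟨_, hsysM q, _, htreeM q t (ht ▸ hl), by simp, by simpa using ht ▸ hl,
        fun hs => h t ht (strCode_mem_treeCode.1 hs)⟩

end

/-! ### Strong forcing of initial segments -/

section

variable {θ : Ordinal.{0}} {P : Iio θ → Set (Set Str)} {c : ℕ → Bool → Set (Mat θ (Set Str))}
  {R R' S : Mat θ (Set Str)}

theorem Stronger.refl (R : Mat θ (Set Str)) : Stronger R R := fun _ _ => subset_rfl

theorem Stronger.trans (h : Stronger R R') (h' : Stronger R' S) : Stronger R S :=
  fun ξ k => (h ξ k).trans (h' ξ k)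

theorem mem_paths {T : Set Str} {f : ℕ → Bool} : f ∈ paths T ↔ ∀ n, branch f n ∈ T := Iff.rfl

theorem paths_univ : paths univ = univ := by
  ext f
  simp [paths]

theorem mem_cube_iff {x : Mat θ (ℕ → Bool)} : x ∈ cube R ↔ ∀ ξ k, x ξ k ∈ paths (R ξ k) := by
  constructor
  · intro h ξ k
    by_cases hR : R ξ k = univ
    · rw [hR, paths_univ]
      trivial
    · exact h (ξ, k) hR
  · exact fun h p _ => h p.1 p.2

theorem paths_mono {S T : Set Str} (h : S ⊆ T) : paths S ⊆ paths T := fun _ hf n => h (hf n)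

theorem Stronger.cube_subset (h : Stronger R S) : cube R ⊆ cube S := fun _ hx =>
  mem_cube_iff.2 fun ξ k => paths_mono (h ξ k) (mem_cube_iff.1 hx ξ k)

/-- In a tree without maximal nodes every node is on a path. -/
theorem exists_path {T : Set Str} (hT : IsTree T) (h : ∀ s ∈ T, ∃ b : Bool, s ++ [b] ∈ T)
    {s : Str} (hs : s ∈ T) : ∃ f ∈ paths T, branch f s.length = s := by
  choose! b hb using h
  let g : ℕ → Str := fun n => (fun t => t ++ [b t])^[n] s
  have hg0 : g 0 = s := rfl
  have hg1 : ∀ n, g (n + 1) = g n ++ [b (g n)] := fun n => Function.iterate_succ_apply' _ _ _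
  have hgT : ∀ n, g n ∈ T := by
    intro n
    induction n with
    | zero => exact hs
    | succ n ih => exact hg1 n ▸ hb _ ih
  have hlen : ∀ n, (g n).length = s.length + n := by
    intro n
    induction n with
    | zero => simp [hg0]
    | succ n ih => rw [hg1, List.length_append, ih]; rfl
  have hmono : ∀ m n, m ≤ n → g m <+: g n := by
    intro m n hmn
    induction n, hmn using Nat.le_induction with
    | base => exact List.prefix_rfl
    | succ n _ ih => exact ih.trans (hg1 n ▸ List.prefix_append _ _)
  let f : ℕ → Bool := fun i => (g (i + 1))[i]?.getD false
  have hf : ∀ n, ∀ t, t <+: g n → branch f t.length = t := by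
    intro n t ht
    refine List.ext_getElem (by simp) fun i h1 h2 => ?_
    simp only [branch, List.getElem_map, List.getElem_range, f]
    have h3 : i < (g (i + 1)).length := by rw [hlen]; omega
    rw [List.getElem?_eq_getElem h3, Option.getD_some]
    have h4 : i < (g n).length := h2.trans_le ht.length_le
    have h5 : t[i] = (g n)[i] := List.IsPrefix.getElem ht h2
    rw [h5]
    rcases le_total (i + 1) n with h | h
    · exact List.IsPrefix.getElem (hmono _ _ h) h3
    · exact (List.IsPrefix.getElem (hmono _ _ h) h4).symm
  refine ⟨f, fun n => ?_, hf 0 s List.prefix_rfl⟩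
  have h1 : (g n).take n <+: g n := List.take_prefix _ _
  have h2 := hf n _ h1
  have h3 : ((g n).take n).length = n := by
    rw [List.length_take, hlen]
    omega
  rw [h3] at h2
  change branch f n ∈ T
  rw [h2]
  exact hT _ _ h1 (hgT n)

theorem MT.isPerfectTree (hP : ∀ ξ, IsPTF (P ξ)) (hR : R ∈ MT P) (ξ : Iio θ) (k : ℕ) :
    IsPerfectTree (R ξ k) := by
  by_cases h : R ξ k = univ
  · rw [h]
    exact ⟨⟨[], trivial⟩, fun _ _ _ _ => trivial, fun s _ =>
      ⟨s, trivial, List.prefix_rfl, fun _ => trivial⟩⟩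
  · exact (hP ξ).1 _ (hR.2 (ξ, k) h)

theorem IsPerfectTree.exists_append {T : Set Str} (hT : IsPerfectTree T) :
    ∀ s ∈ T, ∃ b : Bool, s ++ [b] ∈ T := by
  intro s hs
  obtain ⟨t, -, ⟨r, rfl⟩, h⟩ := hT.2.2 s hs
  cases r with
  | nil => exact ⟨true, by simpa using h true⟩
  | cons b r => exact ⟨b, hT.2.1 _ _ ⟨r ++ [true], by simp⟩ (h true)⟩

/-- Every node of a multitree is on a point of its cube. -/
theorem MT.exists_cube (hP : ∀ ξ, IsPTF (P ξ)) (hR : R ∈ MT P) {ξ : Iio θ} {k : ℕ} {s : Str}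
    (hs : s ∈ R ξ k) : ∃ x ∈ cube R, branch (x ξ k) s.length = s := by
  classical
  have hex : ∀ p : Iio θ × ℕ, ∃ f ∈ paths (R p.1 p.2),
      p = (ξ, k) → branch f s.length = s := by
    intro p
    have hT := MT.isPerfectTree hP hR p.1 p.2
    by_cases hp : p = (ξ, k)
    · subst hp
      obtain ⟨f, hf, h⟩ := exists_path hT.2.1 hT.exists_append hs
      exact ⟨f, hf, fun _ => h⟩
    · obtain ⟨f, hf, -⟩ := exists_path hT.2.1 hT.exists_append hT.nil_mem
      exact ⟨f, hf, fun h => absurd h hp⟩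
  choose f hf hf' using hex
  exact ⟨fun ξ k => f (ξ, k), mem_cube_iff.2 fun ξ k => hf (ξ, k), hf' _ rfl⟩

theorem MT.stronger_of_cube_subset (hP : ∀ ξ, IsPTF (P ξ)) (hR : R ∈ MT P)
    (h : cube R ⊆ cube S) : Stronger R S := by
  intro ξ k s hs
  obtain ⟨x, hx, hxs⟩ := MT.exists_cube hP hR hs
  exact hxs ▸ mem_paths.1 (mem_cube_iff.1 (h hx) ξ k) s.length

/-- A multitree can be strengthened so that finitely many places get trees of the forcing notions.
-/
theorem MT.exists_supp (hne : ∀ ξ, (P ξ).Nonempty) (hR : R ∈ MT P) {G : Set (Iio θ × ℕ)}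
    (hG : G.Finite) : ∃ R' ∈ MT P, Stronger R' R ∧ ∀ p ∈ G, R' p.1 p.2 ∈ P p.1 := by
  classical
  choose T hT using hne
  refine ⟨fun ξ k => if (ξ, k) ∈ G ∧ R ξ k = univ then T ξ else R ξ k, ⟨?_, ?_⟩, ?_, ?_⟩
  · refine (hG.union hR.1).subset fun p hp => ?_
    by_contra h
    simp only [mem_union, not_or, treeSupp, mem_ofPred_eq, not_not] at h
    simp [treeSupp, h.1, h.2] at hp
  · intro p hp
    simp only [treeSupp, mem_ofPred_eq] at hp
    simp only
    split_ifs at hp ⊢ with h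
    exacts [hT _, hR.2 p hp]
  · intro ξ k
    simp only
    split_ifs with h
    · rw [h.2]
      exact subset_univ _
    · exact subset_rfl
  · intro p hp
    simp only
    split_ifs with h
    · exact hT _
    · exact hR.2 p fun h' => h ⟨hp, h'⟩

/-- If finitely many cubes cover the cube of `R`, then a multitree stronger than `R` is below one
of the covering multitrees. -/
theorem MT.exists_of_cover (hP : ∀ ξ, IsPTF (P ξ)) (hne : ∀ ξ, (P ξ).Nonempty) (hR : R ∈ MT P)
    {F : Set (Mat θ (Set Str))} (hF : F.Finite) (hFP : F ⊆ MT P)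
    (hcov : cube R ⊆ ⋃ S ∈ F, cube S) :
    ∃ R' ∈ MT P, Stronger R' R ∧ ∃ S ∈ F, Stronger R' S := by
  classical
  -- The supports of the covering multitrees may be assumed to be parts of the support of `R`.
  have key : ∀ F : Set (Mat θ (Set Str)), F.Finite → ∀ R ∈ MT P,
      (∀ S ∈ F, ∀ p ∈ treeSupp S, R p.1 p.2 ∈ P p.1) → cube R ⊆ ⋃ S ∈ F, cube S →
      ∃ R' ∈ MT P, Stronger R' R ∧ ∃ S ∈ F, Stronger R' S := by
    intro F hF
    induction F, hF using Set.Finite.induction_on with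
    | empty =>
      intro R hR _ hcov
      have hne : (cube R).Nonempty := by
        choose f hf _ using fun p : Iio θ × ℕ =>
          exists_path (MT.isPerfectTree hP hR p.1 p.2).2.1
            (MT.isPerfectTree hP hR p.1 p.2).exists_append (MT.isPerfectTree hP hR p.1 p.2).nil_mem
        exact ⟨fun ξ k => f (ξ, k), mem_cube_iff.2 fun ξ k => hf (ξ, k)⟩
      obtain ⟨x, hx⟩ := hne
      simpa using hcov hx
    | @insert S F _ _ ih =>
      intro R hR hsupp hcov
      by_cases hRS : cube R ⊆ cube S
      · exact ⟨R, hR, .refl R, S, mem_insert _ _, MT.stronger_of_cube_subset hP hR hRS⟩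
      · obtain ⟨x, hxR, hxS⟩ := Set.not_subset.1 hRS
        simp only [cube, mem_ofPred_eq, not_forall] at hxS
        obtain ⟨⟨ξ, k⟩, hp, hxp⟩ := hxS
        simp only [mem_paths, not_forall] at hxp
        obtain ⟨n, hn⟩ := hxp
        have hb : branch (x ξ k) n ∈ R ξ k := mem_paths.1 (mem_cube_iff.1 hxR ξ k) n
        have hRp := hsupp S (mem_insert _ _) _ hp
        have hRb := (hP ξ).2 _ hRp _ hb
        let R₁ : Mat θ (Set Str) := fun ζ l =>
          if (ζ, l) = (ξ, k) then restr (R ξ k) (branch (x ξ k) n) else R ζ l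
        have hR₁k : R₁ ξ k = restr (R ξ k) (branch (x ξ k) n) := if_pos rfl
        have hR₁p : ∀ p : Iio θ × ℕ, p ≠ (ξ, k) → R₁ p.1 p.2 = R p.1 p.2 := fun p hp => if_neg hp
        have hval : Stronger R₁ R := by
          intro ζ l
          by_cases h : (ζ, l) = (ξ, k)
          · obtain ⟨rfl, rfl⟩ := Prod.mk.inj h
            rw [hR₁k]
            exact fun s hs => hs.1
          · rw [hR₁p (ζ, l) h]
        have hR₁ : R₁ ∈ MT P := by
          constructor
          · refine ((Set.finite_singleton (ξ, k)).union hR.1).subset fun p hp => ?_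
            by_cases h : p = (ξ, k)
            · exact .inl h
            · right
              rwa [treeSupp, mem_ofPred_eq, hR₁p p h] at hp
          · intro p hp
            by_cases h : p = (ξ, k)
            · subst h
              rw [hR₁k]
              exact hRb
            · rw [treeSupp, mem_ofPred_eq, hR₁p p h] at hp
              rw [hR₁p p h]
              exact hR.2 p hp
        obtain ⟨R', hR', hR'R, S', hS', hRS'⟩ := ih R₁ hR₁ (by
          intro S' hS' p hp
          by_cases h : p = (ξ, k)
          · subst h
            rw [hR₁k]
            exact hRb
          · rw [hR₁p p h]
            exact hsupp S' (mem_insert_of_mem _ hS') p hp) (by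
          intro y hy
          obtain ⟨S', hS', hyS'⟩ := mem_iUnion₂.1 (hcov (hval.cube_subset hy))
          rcases mem_insert_iff.1 hS' with rfl | hS'
          · exfalso
            have h1 := mem_paths.1 (mem_cube_iff.1 hy ξ k) n
            rw [hR₁k] at h1
            have h2 : branch (x ξ k) n = branch (y ξ k) n := by
              rcases h1.2 with h | h
              · exact h.eq_of_length (by simp)
              · exact (h.eq_of_length (by simp)).symm
            exact hn (h2 ▸ mem_paths.1 (mem_cube_iff.1 hyS' ξ k) n)
          · exact mem_iUnion₂.2 ⟨S', hS', hyS'⟩)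
        exact ⟨R', hR', hR'R.trans hval, S', mem_insert_of_mem _ hS', hRS'⟩
  obtain ⟨R₁, hR₁, hR₁R, h⟩ := MT.exists_supp hne hR
    (hF.biUnion fun S hS => (hFP hS).1)
  obtain ⟨R', hR', hR'R, hS⟩ := key F hF R₁ hR₁
    (fun S hS p hp => h p (mem_biUnion hS hp)) (hR₁R.cube_subset.trans hcov)
  exact ⟨R', hR', hR'R.trans hR₁R, hS⟩

theorem StronglyForces.mono {s : Str} (h : StronglyForces R s c) (hR : Stronger R' R) :
    StronglyForces R' s c := fun i b hi => by
  obtain ⟨S, hS, hRS⟩ := h i b hi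
  exact ⟨S, hS, hR.trans hRS⟩

theorem StronglyForces.forcesPrefix {s : Str} (h : StronglyForces R s c) : ForcesPrefix R s c := by
  intro n hn
  obtain ⟨S, hS, hRS⟩ := h n s[n] (List.getElem?_eq_getElem hn)
  exact ⟨{S}, Set.finite_singleton S, Set.singleton_subset_iff.2 hS, by
    simpa using hRS.cube_subset⟩

theorem ForcesPrefix.exists_stronglyForces (hP : ∀ ξ, IsPTF (P ξ)) (hne : ∀ ξ, (P ξ).Nonempty)
    (hc : IsRealName P c) {s : Str} (h : ForcesPrefix R s c) (hR : R ∈ MT P) :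
    ∃ R' ∈ MT P, Stronger R' R ∧ StronglyForces R' s c := by
  have key : ∀ n, ∃ R' ∈ MT P, Stronger R' R ∧
      ∀ i b, i < n → s[i]? = some b → ∃ S ∈ c i b, Stronger R' S := by
    intro n
    induction n with
    | zero => exact ⟨R, hR, .refl R, by simp⟩
    | succ n ih =>
      obtain ⟨R', hR', hR'R, h'⟩ := ih
      by_cases hn : n < s.length
      · obtain ⟨F, hF, hFc, hcov⟩ := h n hn
        obtain ⟨R'', hR'', hR''R', S, hS, hRS⟩ := MT.exists_of_cover hP hne hR' hF
          (hFc.trans (hc.subset _ _)) (hR'R.cube_subset.trans hcov)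
        refine ⟨R'', hR'', hR''R'.trans hR'R, fun i b hi hib => ?_⟩
        rcases Nat.lt_succ_iff_lt_or_eq.1 hi with hi | rfl
        · obtain ⟨S', hS', hRS'⟩ := h' i b hi hib
          exact ⟨S', hS', hR''R'.trans hRS'⟩
        · rw [List.getElem?_eq_getElem hn, Option.some.injEq] at hib
          exact ⟨S, hib ▸ hFc hS, hRS⟩
      · refine ⟨R', hR', hR'R, fun i b hi hib => h' i b ?_ hib⟩
        have := (List.getElem?_eq_some_iff.1 hib).1
        omega
  obtain ⟨R', hR', hR'R, h'⟩ := key s.length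
  exact ⟨R', hR', hR'R, fun i b hi => h' i b (List.getElem?_eq_some_iff.1 hi).1 hi⟩

theorem MT.exists_stronglyForces (hc : IsRealName P c) (hR : R ∈ MT P) (n : ℕ) :
    ∃ R' ∈ MT P, Stronger R' R ∧ ∃ s : Str, s.length = n ∧ StronglyForces R' s c := by
  induction n with
  | zero => exact ⟨R, hR, .refl R, [], rfl, by intro i b h; simp at h⟩
  | succ n ih =>
    obtain ⟨R', hR', hR'R, s, hs, hf⟩ := ih
    obtain ⟨S, hS, R'', hR'', hS', hR''R'⟩ := hc.predense n R' hR'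
    obtain ⟨b, hb⟩ : ∃ b, S ∈ c n b := hS.elim (fun h => ⟨_, h⟩) fun h => ⟨_, h⟩
    refine ⟨R'', hR'', hR''R'.trans hR'R, s ++ [b], by simp [hs], fun i d hi => ?_⟩
    by_cases hin : i < n
    · rw [List.getElem?_append_left (by omega)] at hi
      exact hf.mono hR''R' i d hi
    · have := (List.getElem?_eq_some_iff.1 hi).1
      rw [List.length_append, List.length_singleton] at this
      obtain rfl : i = n := by omega
      rw [← hs, List.getElem?_concat_length, Option.some.injEq] at hi
      exact ⟨S, hi ▸ hb, hS'⟩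

theorem StronglyForces.prefix_of_length_le (hc : IsRealName P c) (hR : R ∈ MT P) {s t : Str}
    (hs : StronglyForces R s c) (ht : StronglyForces R t c) (h : s.length ≤ t.length) :
    s <+: t := by
  rw [List.prefix_iff_getElem?]
  intro i hi
  have hi' := hi.trans_le h
  rw [List.getElem?_eq_getElem hi', Option.some.injEq]
  obtain ⟨S, hS, hRS⟩ := hs i s[i] (List.getElem?_eq_getElem hi)
  obtain ⟨S', hS', hRS'⟩ := ht i t[i] (List.getElem?_eq_getElem hi')
  by_contra hne
  cases h1 : s[i] <;> cases h2 : t[i] <;> rw [h1] at hS hne <;> rw [h2] at hS' hne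
  · exact hne rfl
  · exact hc.incompatible i S hS S' hS' ⟨R, hR, hRS, hRS'⟩
  · exact hc.incompatible i S' hS' S hS ⟨R, hR, hRS', hRS⟩
  · exact hne rfl

/-- If `R` directly forces that `t` is an initial segment of the generic real at the place `(η, k)`,
then all nodes of the tree of `R` at this place are comparable with `t`. -/
theorem ForcesPrefix.comparable_of_genName (hP : ∀ ξ, IsPTF (P ξ)) (hR : R ∈ MT P) {η : Iio θ}
    {k : ℕ} {t s : Str} (h : ForcesPrefix R t (genName η k)) (hs : s ∈ R η k) :
    s <+: t ∨ t <+: s := by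
  obtain ⟨x, hx, hxs⟩ := MT.exists_cube hP hR hs
  have hval : ∀ n (hn : n < t.length), x η k n = t[n] := by
    intro n hn
    obtain ⟨F, -, hF, hcov⟩ := h n hn
    obtain ⟨S, hS, hxS⟩ := mem_iUnion₂.1 (hcov hx)
    obtain rfl := hF hS
    have h1 := mem_paths.1 (mem_cube_iff.1 hxS η k) (n + 1)
    simp only [and_self, if_true] at h1
    have h2 := h1 (by simp)
    simpa [branch] using h2
  have ht : branch (x η k) t.length = t :=
    List.ext_getElem (by simp) fun i h1 h2 => by simp [branch, hval i h2]
  rw [← hxs, ← ht]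
  rcases le_total s.length t.length with h | h
  · exact .inl (branch_prefix _ h)
  · exact .inr (branch_prefix _ h)

/-- A condition that separates the real with the name `c` from all generic reals at finitely many
places `(η, k)`, and at the same time from subtrees of finitely many trees. -/
theorem MT.exists_avoid (hP : ∀ ξ, IsPTF (P ξ)) (hne : ∀ ξ, (P ξ).Nonempty)
    (hc : IsRealName P c) {η : Iio θ}
    (hD : ∀ k : ℕ, MTDense P {T | T ∈ MT P ∧ ForcesNe T c (genName η k)}) (hR : R ∈ MT P)
    (K : Finset ℕ) {ι : Type*} (I : Finset ι) {X : ι → Set Str} (hX : ∀ i ∈ I, X i ∈ P η) :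
    ∃ R' ∈ MT P, Stronger R' R ∧ ∃ s, StronglyForces R' s c ∧ (∀ k ∈ K, s ∉ R' η k) ∧
      ∃ Y : ι → Set Str, ∀ i ∈ I, Y i ∈ P η ∧ Y i ⊆ X i ∧ s ∉ Y i := by
  classical
  have hK : ∃ R' ∈ MT P, Stronger R' R ∧ ∀ k ∈ K, ∃ s, StronglyForces R' s c ∧ s ∉ R' η k := by
    induction K using Finset.induction_on with
    | empty => exact ⟨R, hR, .refl R, by simp⟩
    | insert k K _ ih =>
      obtain ⟨R₁, hR₁, hR₁R, h₁⟩ := ih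
      obtain ⟨R₂, ⟨hR₂, t, s, hts, hst, ht, hs⟩, hR₂R₁⟩ := hD k R₁ hR₁
      obtain ⟨R₃, hR₃, hR₃R₂, hs'⟩ := hs.exists_stronglyForces hP hne hc hR₂
      refine ⟨R₃, hR₃, (hR₃R₂.trans hR₂R₁).trans hR₁R, fun l hl => ?_⟩
      rcases Finset.mem_insert.1 hl with rfl | hl
      · refine ⟨s, hs', fun h => ?_⟩
        rcases ht.comparable_of_genName hP hR₂ (hR₃R₂ _ _ h) with h | h
        exacts [hst h, hts h]
      · obtain ⟨s', h1, h2⟩ := h₁ l hl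
        exact ⟨s', h1.mono (hR₃R₂.trans hR₂R₁), fun h => h2 ((hR₃R₂.trans hR₂R₁) _ _ h)⟩
  obtain ⟨R₁, hR₁, hR₁R, h₁⟩ := hK
  choose! w hw hw' using h₁
  have hsplit : ∀ i ∈ I, ∃ r : Str, ∀ b : Bool, r ++ [b] ∈ X i := by
    intro i hi
    have hT := (hP η).1 _ (hX i hi)
    obtain ⟨t, -, -, h⟩ := hT.2.2 _ hT.nil_mem
    exact ⟨t, h⟩
  choose! r hr using hsplit
  -- The string `s` is long enough to extend all `w k` and to differ from one of the two
  -- successors of every splitting node `r i`.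
  obtain ⟨R₂, hR₂, hR₂R₁, s, hs, hf⟩ := MT.exists_stronglyForces hc hR₁
    (K.sup (fun k => (w k).length) + I.sup (fun i => (r i).length) + 1)
  refine ⟨R₂, hR₂, hR₂R₁.trans hR₁R, s, hf, fun k hk hsk => ?_, ?_⟩
  · have hle := Finset.le_sup (f := fun k => (w k).length) hk
    have := ((hw k hk).mono hR₂R₁).prefix_of_length_le hc hR₂ hf (by omega)
    exact hw' k hk (hR₂R₁ _ _ ((MT.isPerfectTree hP hR₂ η k).2.1 _ _ this hsk))
  · have hY : ∀ i ∈ I, ∃ Y ∈ P η, Y ⊆ X i ∧ s ∉ Y := by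
      intro i hi
      have hle := Finset.le_sup (f := fun i => (r i).length) hi
      obtain ⟨b, hb⟩ : ∃ b, ¬ r i ++ [b] <+: s := by
        by_contra h
        push Not at h
        have := List.prefix_of_prefix_length_le (h true) (h false) (by simp)
        exact absurd (not_prefix_append this) (by simp)
      refine ⟨restr (X i) (r i ++ [b]), (hP η).2 _ (hX i hi) _ (hr i hi b), fun t ht => ht.1, ?_⟩
      rintro ⟨-, h | h⟩
      · exact hb h
      · have hl := h.length_le
        simp only [List.length_append, List.length_singleton] at hl hle
        rw [h.eq_of_length (by simp; omega)] at hb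
        exact hb List.prefix_rfl
    choose! Y hY hYX hsY using hY
    exact ⟨Y, fun i hi => ⟨hY i hi, hYX i hi, hsY i hi⟩⟩

end

/-! ### Extensions of splitting systems -/

section

variable {Q : Set (Set Str)} {φ ψ : Sys}

theorem IsStep.mono {T T' T'' : Set Str} {i : Bool} (h : IsStep T T' i) (hs : T'' ⊆ T') :
    IsStep T T'' i := by
  obtain ⟨h1, r, h2, h3, h4⟩ := h
  exact ⟨hs.trans h1, r, h2, h3, fun t ht => h4 t (hs ht)⟩

theorem IsPTF.exists_isStep (hQ : IsPTF Q) {T : Set Str} (hT : T ∈ Q) (i : Bool) :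
    ∃ T' ∈ Q, IsStep T T' i := by
  obtain ⟨r, hr⟩ := exists_isStem (hQ.1 T hT)
  obtain ⟨h1, h2⟩ := (isStem_iff (hQ.1 T hT)).1 hr
  exact ⟨restr T (r ++ [i]), hQ.2 T hT _ (h1 i), fun t ht => ht.1, r, h1, h2, fun t ht => ht.2⟩

theorem IsFSS.exists_height_succ (hQ : IsPTF Q) (hne : Q.Nonempty) (hφ : IsFSS Q φ) :
    ∃ ψ, IsFSS Q ψ ∧ φ.ExtendedBy ψ ∧ ψ.height = φ.height + 1 := by
  have hφ' := (isFSS_iff hQ).1 hφ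
  have hex : ∀ t : Str, t.length = φ.height → ∃ T ∈ Q, ∀ s i, t = s ++ [i] →
      IsStep (φ.tree s) T i := by
    intro t ht
    rcases List.eq_nil_or_concat t with rfl | ⟨s, i, rfl⟩
    · obtain ⟨T, hT⟩ := hne
      exact ⟨T, hT, fun s i h => by simp at h⟩
    · have hs : s.length < φ.height := by simp at ht; omega
      obtain ⟨T, hT, h⟩ := hQ.exists_isStep (hφ.1 s hs) i
      refine ⟨T, hT, fun s' i' h' => ?_⟩
      rw [List.concat_eq_append] at h'
      obtain ⟨rfl, h''⟩ := List.append_inj' h' rfl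
      rw [List.singleton_inj] at h''
      exact h'' ▸ h
  choose! f hf hf' using hex
  refine ⟨⟨φ.height + 1, fun t => if t.length = φ.height then f t else φ.tree t, fun t ht => ?_⟩,
    (isFSS_iff hQ).2 ⟨fun t ht => ?_, fun s i hs => ?_⟩, ⟨Nat.le_succ _, fun t ht => ?_⟩, rfl⟩
  · rw [if_neg (by omega)]
    exact φ.tree_eq_empty t (by omega)
  · simp only at ht ⊢
    split_ifs with h
    · exact hf t h
    · exact hφ.1 t (by omega)
  · simp only at hs ⊢
    have hs' : s.length ≠ φ.height := by simp at hs; omega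
    rw [if_neg hs']
    split_ifs with h
    · exact hf' _ h s i rfl
    · exact hφ'.2 s i (by omega)
  · simp only
    rw [if_neg (by omega)]

theorem Sys.ExtendedBy.refl (φ : Sys) : φ.ExtendedBy φ := ⟨le_rfl, fun _ _ => rfl⟩

theorem Sys.ExtendedBy.trans {χ : Sys} (h : φ.ExtendedBy ψ) (h' : ψ.ExtendedBy χ) :
    φ.ExtendedBy χ :=
  ⟨h.1.trans h'.1, fun s hs => (h.2 s hs).trans (h'.2 s (hs.trans_le h.1))⟩

theorem IsFSS.exists_height (hQ : IsPTF Q) (hne : Q.Nonempty) (hφ : IsFSS Q φ) {n : ℕ}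
    (hn : φ.height ≤ n) : ∃ ψ, IsFSS Q ψ ∧ φ.ExtendedBy ψ ∧ ψ.height = n := by
  induction n, hn using Nat.le_induction with
  | base => exact ⟨φ, hφ, .refl φ, rfl⟩
  | succ n _ ih =>
    obtain ⟨ψ, h1, h2, rfl⟩ := ih
    obtain ⟨χ, h3, h4, h5⟩ := h1.exists_height_succ hQ hne
    exact ⟨χ, h3, h2.trans h4, h5⟩

/-- The trees at the top level of a splitting system can be replaced by arbitrary smaller ones. -/
theorem IsFSS.exists_replace (hQ : IsPTF Q) (hφ : IsFSS Q φ) {n : ℕ} (hn : φ.height = n + 1)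
    {τ : Str → Set Str} (hτ : ∀ t : Str, t.length = n → τ t ∈ Q ∧ τ t ⊆ φ.tree t) :
    ∃ χ, IsFSS Q χ ∧ χ.height = n + 1 ∧ (∀ t : Str, t.length = n → χ.tree t = τ t) ∧
      ∀ ψ : Sys, ψ.height ≤ n → ψ.ExtendedBy φ → ψ.ExtendedBy χ := by
  have hφ' := (isFSS_iff hQ).1 hφ
  refine ⟨⟨n + 1, fun t => if t.length = n then τ t else φ.tree t, fun t ht => ?_⟩,
    (isFSS_iff hQ).2 ⟨fun t ht => ?_, fun s i hs => ?_⟩, rfl, fun t ht => if_pos ht,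
    fun ψ hψ h => ⟨hψ.trans (Nat.le_succ n), fun t ht => ?_⟩⟩
  · rw [if_neg (by omega)]
    exact φ.tree_eq_empty t (by omega)
  · simp only at ht ⊢
    split_ifs with h
    · exact (hτ t h).1
    · exact hφ.1 t (by omega)
  · simp only at hs ⊢
    have hs' : s.length ≠ n := by simp at hs; omega
    have h1 := hφ'.2 s i (by omega)
    rw [if_neg hs']
    split_ifs with h
    · exact h1.mono (hτ _ h).2
    · exact h1
  · simp only
    rw [if_neg (by omega)]
    exact h.2 t ht

theorem exists_isFSS_root {T : Set Str} (hT : T ∈ Q) :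
    ∃ φ, IsFSS Q φ ∧ φ.height = 1 ∧ φ.tree [] = T := by
  refine ⟨⟨1, fun s => if s = [] then T else ∅, fun s hs => ?_⟩, ⟨fun s hs => ?_, fun s i hs => ?_⟩,
    rfl, rfl⟩
  · rw [if_neg]
    rintro rfl
    simp at hs
  · obtain rfl : s = [] := by simpa using hs
    simpa using hT
  · simp at hs

end

/-! ### Density -/

section

variable {θ : Ordinal.{0}} {P : Iio θ → Set (Set Str)} {c : ℕ → Bool → Set (Mat θ (Set Str))}

theorem Sys.extendedBy_of_height_eq_zero {ψ φ : Sys} (h : ψ.height = 0) : ψ.ExtendedBy φ :=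
  ⟨h ▸ Nat.zero_le _, fun s hs => by omega⟩

theorem msDense_root {ξ : Iio θ} {T : Set Str} (hT : T ∈ P ξ) :
    MSDense P {A | A ∈ MS P ∧ ∃ m, 0 < (A ξ m).height ∧ (A ξ m).tree [] = T} := by
  classical
  intro Ψ hΨ
  obtain ⟨m, hm⟩ : ∃ m, (Ψ ξ m).height = 0 := by
    by_contra h
    push Not at h
    have hinj : Function.Injective fun m : ℕ => (ξ, m) := fun a b h => (Prod.mk.inj h).2
    exact Set.infinite_of_injective_forall_mem hinj h hΨ.1
  obtain ⟨φ, hφ, hh, hr⟩ := exists_isFSS_root hT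
  have hex : ∀ p : Iio θ × ℕ, ∃ χ, IsFSS (P p.1) χ ∧ (Ψ p.1 p.2).ExtendedBy χ ∧
      (p ≠ (ξ, m) → χ = Ψ p.1 p.2) ∧ (p = (ξ, m) → χ = φ) := by
    intro p
    by_cases hp : p = (ξ, m)
    · subst hp
      exact ⟨φ, hφ, Sys.extendedBy_of_height_eq_zero hm, by simp, by simp⟩
    · exact ⟨Ψ p.1 p.2, hΨ.2 _ _, .refl _, by simp, by simp [hp]⟩
  choose A hA hΨA hne heq using hex
  refine ⟨fun ξ k => A (ξ, k), ⟨⟨?_, fun ξ k => hA (ξ, k)⟩, m, ?_⟩, fun ξ k => hΨA (ξ, k)⟩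
  · refine ((Set.finite_singleton (ξ, m)).union hΨ.1).subset fun p hp => ?_
    by_cases h : p = (ξ, m)
    · exact .inl h
    · right
      simpa [hne p h] using hp
  · simp only [heq _ rfl, hh, hr, zero_lt_one, and_self]

/-- All systems which matter are first extended to a common height `L + 1` such that the places
follow different nodes at the level `L`. Then the trees at this level are replaced by smaller ones,
according to a multitree that avoids the trees of the system with the index `(η, m)`. -/
theorem msDense_decides (hP : ∀ ξ, IsPTF (P ξ)) (hne : ∀ ξ, (P ξ).Nonempty)
    (hc : IsRealName P c) {η : Iio θ}
    (hD : ∀ k : ℕ, MTDense P {T | T ∈ MT P ∧ ForcesNe T c (genName η k)}) (a : Assignment θ)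
    (m : ℕ) : MSDense P {A | A ∈ MS P ∧ Decides a c (η, m) A} := by
  classical
  intro Ψ hΨ
  let G : Set (Iio θ × ℕ) := {p | (Ψ p.1 p.2).height ≠ 0} ∪
    ({(η, m)} ∪ (fun p => (p.1, a.idx p.1 p.2)) '' a.exceptional)
  have hG : G.Finite := hΨ.1.union ((Set.finite_singleton _).union (a.finite.image _))
  let N : Set (Iio θ × ℕ) := {p | (p.1, a.idx p.1 p.2) ∈ G}
  have hexc : ∀ p ∈ a.exceptional, p ∈ N := fun p hp => .inr (.inr ⟨p, hp, rfl⟩)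
  have hN : N.Finite := by
    refine (a.finite.union hG).subset fun p hp => ?_
    by_cases h : p ∈ a.exceptional
    · exact .inl h
    · right
      have : (p.1, a.idx p.1 p.2) ∈ G := hp
      rwa [a.idx_eq _ _ h] at this
  obtain ⟨L, hL, hLN⟩ : ∃ L, (∀ p ∈ G, (Ψ p.1 p.2).height ≤ L) ∧
      ∀ p ∈ N, ∀ q ∈ N, p.1 = q.1 → a.idx p.1 p.2 = a.idx q.1 q.2 →
        branch (a.br p.1 p.2) L = branch (a.br q.1 q.2) L → p = q := by
    have h1 : ∀ᶠ L in Filter.atTop, ∀ p ∈ G, (Ψ p.1 p.2).height ≤ L :=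
      (Filter.eventually_all_finite hG).2 fun p _ => Filter.eventually_ge_atTop _
    have h2 : ∀ᶠ L in Filter.atTop, ∀ p ∈ N, ∀ q ∈ N, p.1 = q.1 →
        a.idx p.1 p.2 = a.idx q.1 q.2 →
        branch (a.br p.1 p.2) L = branch (a.br q.1 q.2) L → p = q := by
      refine (Filter.eventually_all_finite hN).2 fun p _ =>
        (Filter.eventually_all_finite hN).2 fun q _ => ?_
      by_cases hb : a.br p.1 p.2 = a.br q.1 q.2
      · refine Filter.Eventually.of_forall fun L h h' _ => ?_
        obtain ⟨ξ, k⟩ := p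
        obtain ⟨ζ, l⟩ := q
        obtain rfl : ξ = ζ := h
        rw [a.inj ξ k l h' hb]
      · obtain ⟨i, hi⟩ := Function.ne_iff.1 hb
        filter_upwards [Filter.eventually_gt_atTop i] with L hiL _ _ h
        exfalso
        have := congrArg (fun t : Str => t[i]?) h
        simp only [getElem?_branch hiL, Option.some.injEq] at this
        exact hi this
    exact (h1.and h2).exists
  choose φ hφ hΨφ hφL using fun p : Iio θ × ℕ => fun hp : p ∈ G =>
    (hΨ.2 p.1 p.2).exists_height (hP p.1) (hne p.1) ((hL p hp).trans (Nat.le_succ L))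
  -- The multitree that the extended systems define.
  let R₀ : Mat θ (Set Str) := fun ξ k =>
    if h : (ξ, a.idx ξ k) ∈ G then (φ _ h).tree (branch (a.br ξ k) L) else univ
  have hR₀ : ∀ p : Iio θ × ℕ, ∀ h : p ∈ N,
      R₀ p.1 p.2 = (φ _ h).tree (branch (a.br p.1 p.2) L) := fun p h => dif_pos h
  have hR₀P : ∀ p ∈ N, R₀ p.1 p.2 ∈ P p.1 := fun p h => by
    rw [hR₀ p h]
    exact (hφ _ h).1 _ (by rw [hφL, length_branch]; omega)
  have hR₀MT : R₀ ∈ MT P := by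
    have : ∀ p ∈ treeSupp R₀, p ∈ N := fun p hp => by
      by_contra h
      exact hp (dif_neg h)
    exact ⟨hN.subset this, fun p hp => hR₀P p (this p hp)⟩
  have hη : (η, m) ∈ G := .inr (.inl rfl)
  have hstr : {t : Str | t.length = L}.Finite := List.finite_length_eq Bool L
  have hNη : {k | (η, k) ∈ N}.Finite :=
    hN.preimage (f := fun k => (η, k)) fun x _ y _ h => (Prod.mk.inj h).2
  obtain ⟨R, hR, hRR₀, s, hs, hsK, σ, hσ⟩ := MT.exists_avoid hP hne hc hD hR₀MT
    hNη.toFinset hstr.toFinset (X := (φ _ hη).tree) fun t ht => by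
      refine (hφ _ hη).1 t ?_
      rw [Set.Finite.mem_toFinset, mem_ofPred_eq] at ht
      rw [hφL, ht]
      omega
  simp only [Set.Finite.mem_toFinset, mem_ofPred_eq] at hsK hσ
  have hRP : ∀ p ∈ N, R p.1 p.2 ∈ P p.1 := by
    intro p hp
    by_cases h : R p.1 p.2 = univ
    · have h' : R₀ p.1 p.2 = univ := univ_subset_iff.1 (h ▸ hRR₀ p.1 p.2)
      rw [h, ← h']
      exact hR₀P p hp
    · exact hR.2 p h
  have hex : ∀ p : Iio θ × ℕ, ∃ χ, IsFSS (P p.1) χ ∧ (Ψ p.1 p.2).ExtendedBy χ ∧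
      (p ∈ G → χ.height = L + 1 ∧
        (∀ k, a.idx p.1 k = p.2 → χ.tree (branch (a.br p.1 k) L) = R p.1 k) ∧
        (p = (η, m) → ∀ t : Str, t.length = L → s ∉ χ.tree t)) ∧
      (p ∉ G → (R p.1 p.2 = univ → χ.height = 0) ∧
        (R p.1 p.2 ≠ univ → χ.height = 1 ∧ χ.tree [] = R p.1 p.2)) := by
    intro p
    by_cases hp : p ∈ G
    · have hpN : ∀ k, a.idx p.1 k = p.2 → (p.1, k) ∈ N := fun k hk => by
        change (p.1, a.idx p.1 k) ∈ G
        rwa [hk]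
      have hτ : ∀ t : Str, t.length = L → ∃ τ ∈ P p.1, τ ⊆ (φ p hp).tree t ∧
          (∀ k, a.idx p.1 k = p.2 → branch (a.br p.1 k) L = t → τ = R p.1 k) ∧
          (p = (η, m) → s ∉ τ) := by
        intro t ht
        by_cases hk : ∃ k, a.idx p.1 k = p.2 ∧ branch (a.br p.1 k) L = t
        · obtain ⟨k, hk, hkt⟩ := hk
          refine ⟨R p.1 k, hRP _ (hpN k hk), ?_, ?_, ?_⟩
          · refine (hRR₀ p.1 k).trans ?_
            rw [hR₀ (p.1, k) (hpN k hk)]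
            simp only [hk, hkt]
            exact subset_rfl
          · intro l hl hlt
            have := hLN _ (hpN k hk) _ (hpN l hl) rfl (hk.trans hl.symm) (hkt.trans hlt.symm)
            rw [(Prod.mk.inj this).2]
          · rintro rfl
            exact hsK k (hpN k hk)
        · push Not at hk
          by_cases hpη : p = (η, m)
          · subst hpη
            obtain ⟨h1, h2, h3⟩ := hσ t ht
            exact ⟨σ t, h1, h2, fun k hk1 hk2 => absurd hk2 (hk k hk1), fun _ => h3⟩
          · exact ⟨_, (hφ p hp).1 t (by rw [hφL, ht]; omega), subset_rfl,
              fun k hk1 hk2 => absurd hk2 (hk k hk1), fun h => absurd h hpη⟩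
      choose! τ hτP hτφ hτR hτs using hτ
      obtain ⟨χ, h1, h2, h3, h4⟩ := (hφ p hp).exists_replace (hP p.1) (hφL p hp)
        (τ := τ) fun t ht => ⟨hτP t ht, hτφ t ht⟩
      refine ⟨χ, h1, h4 _ (hL p hp) (hΨφ p hp), fun _ => ⟨h2, fun k hk => ?_, fun hpη t ht => ?_⟩,
        fun h => absurd hp h⟩
      · rw [h3 _ (length_branch _ _), hτR _ (length_branch _ _) k hk rfl]
      · rw [h3 t ht]
        exact hτs t ht hpη
    · have hp0 : (Ψ p.1 p.2).height = 0 := by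
        by_contra h
        exact hp (.inl h)
      by_cases hRp : R p.1 p.2 = univ
      · exact ⟨Ψ p.1 p.2, hΨ.2 _ _, .refl _, fun h => absurd h hp,
          fun _ => ⟨fun _ => hp0, fun h => absurd hRp h⟩⟩
      · obtain ⟨χ, h1, h2, h3⟩ := exists_isFSS_root (hR.2 p hRp)
        exact ⟨χ, h1, Sys.extendedBy_of_height_eq_zero hp0, fun h => absurd h hp,
          fun _ => ⟨fun h => absurd h hRp, fun _ => ⟨h2, h3⟩⟩⟩
  choose A hA hΨA hAG hAG' using hex
  refine ⟨fun ξ k => A (ξ, k), ⟨⟨?_, fun ξ k => hA (ξ, k)⟩, s, hs.mono fun ξ k x hx => ?_, L, ?_,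
    ?_⟩, fun ξ k => hΨA (ξ, k)⟩
  · refine (hG.union hR.1).subset fun p hp => ?_
    by_contra h
    simp only [mem_union, not_or, treeSupp, mem_ofPred_eq, not_not] at h
    exact hp ((hAG' p h.1).1 h.2)
  · change ∀ n < (A (ξ, a.idx ξ k)).height, x ∈ (A (ξ, a.idx ξ k)).tree (branch (a.br ξ k) n) at hx
    by_cases hp : (ξ, a.idx ξ k) ∈ G
    · obtain ⟨h1, h2, -⟩ := hAG _ hp
      have := hx L (by omega)
      rwa [h2 k rfl] at this
    · have hk : (ξ, k) ∉ a.exceptional := fun h => hp (hexc _ h)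
      rw [a.idx_eq _ _ hk] at hx hp
      by_cases hRk : R ξ k = univ
      · rw [hRk]
        trivial
      · obtain ⟨h1, h2⟩ := (hAG' _ hp).2 hRk
        have := hx 0 (by omega)
        rwa [branch, List.range_zero, List.map_nil, h2] at this
  · exact (hAG _ hη).1 ▸ Nat.lt_succ_self L
  · exact (hAG _ hη).2.2 rfl

end

/-! ### The generic trees -/

section

variable {M : Set ZFSet.{0}} {θ : Ordinal.{0}} {P : Iio θ → Set (Set Str)} {Φ : ℕ → Mat θ Sys}
  {ξ : Iio θ} {m : ℕ}

theorem IsGenericSeq.mono (hΦ : IsGenericSeq M P Φ) {i j : ℕ} (h : i ≤ j) :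
    MSExtendedBy (Φ i) (Φ j) := by
  induction j, h using Nat.le_induction with
  | base => exact fun _ _ => .refl _
  | succ j _ ih => exact fun ξ m => (ih ξ m).trans (hΦ.increasing j ξ m)

theorem IsGenericSeq.limTree_eq (hΦ : IsGenericSeq M P Φ) {j : ℕ} {s : Str}
    (h : s.length < (Φ j ξ m).height) : limTree Φ ξ m s = (Φ j ξ m).tree s := by
  refine subset_antisymm (iUnion₂_subset fun i hi => ?_) fun x hx => mem_iUnion₂.2 ⟨j, h, hx⟩
  rcases le_total i j with hij | hij
  · rw [(hΦ.mono hij ξ m).2 s hi]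
  · rw [(hΦ.mono hij ξ m).2 s h]

theorem IsFSS.tree_anti {Q : Set (Set Str)} {φ : Sys} (hφ : IsFSS Q φ) {s t : Str} (hst : s <+: t)
    (ht : t.length < φ.height) : φ.tree t ⊆ φ.tree s := by
  obtain ⟨r, rfl⟩ := hst
  induction r using List.reverseRecOn with
  | nil => simp
  | append_singleton r i ih =>
    rw [← List.append_assoc] at ht ⊢
    exact (hφ.2 _ i ht).1.trans (ih (by simp at ht ⊢; omega))

theorem IsGenericSeq.limTree_anti (hΦ : IsGenericSeq M P Φ) {s t : Str} (hst : s <+: t) :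
    limTree Φ ξ m t ⊆ limTree Φ ξ m s := fun x hx => by
  obtain ⟨j, hj, hx⟩ := mem_iUnion₂.1 hx
  exact mem_iUnion₂.2 ⟨j, hst.length_le.trans_lt hj,
    ((hΦ.mem j).2 ξ m).tree_anti hst hj hx⟩

theorem mem_genTree {s x : Str} : x ∈ genTree Φ ξ m s ↔ ∀ n, s.length ≤ n →
    ∃ t : Str, (t.length = n ∧ s <+: t) ∧ x ∈ limTree Φ ξ m t := by
  simp [genTree]

theorem genTree_subset_limTree (s : Str) : genTree Φ ξ m s ⊆ limTree Φ ξ m s := fun x hx => by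
  obtain ⟨t, ⟨h1, h2⟩, h3⟩ := mem_genTree.1 hx _ le_rfl
  rwa [h2.eq_of_length h1.symm]

theorem IsGenericSeq.genTree_anti (hΦ : IsGenericSeq M P Φ) {s t : Str} (hst : s <+: t) :
    genTree Φ ξ m t ⊆ genTree Φ ξ m s := by
  intro x hx
  refine mem_genTree.2 fun n hn => ?_
  rcases le_total t.length n with h | h
  · obtain ⟨u, ⟨h1, h2⟩, h3⟩ := mem_genTree.1 hx n h
    exact ⟨u, ⟨h1, hst.trans h2⟩, h3⟩
  · refine ⟨t.take n, ⟨by simp [h], ?_⟩, hΦ.limTree_anti (List.take_prefix _ _)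
      (genTree_subset_limTree t hx)⟩
    exact List.prefix_of_prefix_length_le hst (List.take_prefix _ _) (by simp [h, hn])

end

/-- Every finite set of places can be assigned to prescribed nodes of a multisystem. -/
theorem exists_assignment {θ : Ordinal.{0}} {F : Set (Iio θ × ℕ)} (hF : F.Finite)
    (μ : Iio θ × ℕ → ℕ) (w : Iio θ × ℕ → Str) : ∃ a : Assignment θ, ∀ p ∈ F,
      a.idx p.1 p.2 = μ p ∧ branch (a.br p.1 p.2) (w p).length = w p := by
  classical
  obtain ⟨N, hN⟩ : ∃ N, ∀ p ∈ F, (w p).length ≤ N :=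
    ((Filter.eventually_all_finite hF).2 fun p _ =>
      Filter.eventually_ge_atTop (w p).length).exists
  -- On `F`, the last value `false` of the branch of the place `(ξ, k)` is at `N + k`; the branches
  -- of the other places are constantly `true`.
  let β : Iio θ × ℕ → ℕ → Bool := fun p i =>
    if p ∈ F then if h : i < (w p).length then (w p)[i] else decide (i ≠ N + p.2) else true
  have hβ : ∀ p ∈ F, ∀ i, N ≤ i → β p i = decide (i ≠ N + p.2) := fun p hp i hi => by
    have := hN p hp
    simp only [β]
    rw [if_pos hp, dif_neg (by omega)]
  have hβ' : ∀ p, p ∉ F → ∀ i, β p i = true := fun p hp i => if_neg hp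
  refine ⟨⟨fun ξ k => if (ξ, k) ∈ F then μ (ξ, k) else k, fun ξ k => β (ξ, k), ?_, F, hF, ?_, ?_,
    ?_⟩, ?_⟩
  · intro ξ k l h1 h2
    by_cases hk : (ξ, k) ∈ F <;> by_cases hl : (ξ, l) ∈ F
    · have := congrFun h2 (N + k)
      rw [hβ _ hk _ (by omega), hβ _ hl _ (by omega)] at this
      simpa using this
    · have := congrFun h2 (N + k)
      rw [hβ _ hk _ (by omega), hβ' _ hl] at this
      simp at this
    · have := congrFun h2 (N + l)
      rw [hβ _ hl _ (by omega), hβ' _ hk] at this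
      simp at this
    · simpa [hk, hl] using h1
  · intro ξ k h
    exact if_neg h
  · intro ξ k h
    exact funext fun i => hβ' _ h i
  · intro ξ k
    by_cases h : (ξ, k) ∈ F
    · refine ⟨N + k + 1, fun i hi => ?_⟩
      rw [hβ _ h _ (by omega)]
      simp only [decide_eq_true_eq]
      omega
    · exact ⟨0, fun i _ => hβ' _ h i⟩
  · intro p hp
    refine ⟨if_pos hp, List.ext_getElem (by simp) fun i h1 h2 => ?_⟩
    simp [branch, β, hp, h2]

end Jensen

end

open Jensen
theorem theoremK (M : Set ZFSet.{0}) (hM : IsCTM M) (θ : Ordinal.{0})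
    (P : Set.Iio θ → Set (Set Str)) (hP : ∀ ξ, IsPTF (P ξ)) (hne : ∀ ξ, (P ξ).Nonempty)
    (hPM : seqCode P ∈ M)
    (Φ : ℕ → Mat θ Sys) (hΦ : IsGenericSeq M P Φ)
    (η : Set.Iio θ)
    (c : ℕ → Bool → Set (Mat θ (Set Str))) (hc : IsRealName P c) (hcM : nameCode c ∈ M)
    (hD : ∀ k : ℕ, MTDense P {T | T ∈ MT P ∧ ForcesNe T c (genName η k)})
    (u : Mat θ (Set Str)) (hu : u ∈ MT (join P (genExt Φ)))
    (U : Set Str) (hU : U ∈ genExt Φ η) :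
    ∃ v ∈ MT (genExt Φ), Stronger v u ∧ ForcesNotMem v c U := by
  classical
  obtain ⟨m, s₀, rfl⟩ := hU
  -- Every tree of `u` includes a generic tree.
  have hnode : ∀ p ∈ treeSupp u, ∃ (μ : ℕ) (w : Str), genTree Φ p.1 μ w ⊆ u p.1 p.2 := by
    intro p hp
    rcases hu.2 p hp with h | ⟨μ, w, h⟩
    · obtain ⟨j, -, μ, h1, h2⟩ := hΦ.generic _ (fun _ h => h.1) (hM.rootSet_mem hPM hP h)
        (msDense_root h)
      refine ⟨μ, [], (genTree_subset_limTree _).trans ?_⟩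
      rw [hΦ.limTree_eq (j := j) (s := []) h1, h2]
    · exact ⟨μ, w, h.ge⟩
  choose! μ w hμw using hnode
  obtain ⟨a, ha⟩ := exists_assignment hu.1 μ w
  obtain ⟨j, hj, s, hs, l, hl, hsl⟩ := hΦ.generic _ (fun _ h => h.1)
    (hM.decides_mem hPM hP a hcM (η, m)) (msDense_decides hP hne hc hD a m)
  -- The generic trees below the nodes at the top level of `Φ j` on the branches of the assignment.
  let F : Set (Set.Iio θ × ℕ) := treeSupp u ∪ {p | (Φ j p.1 (a.idx p.1 p.2)).height ≠ 0}
  have hF : F.Finite := by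
    refine (hu.1.union (a.finite.union hj.1)).subset ?_
    rintro p (hp | hp)
    · exact .inl hp
    · right
      by_cases h : p ∈ a.exceptional
      · exact .inl h
      · right
        simpa only [Set.mem_ofPred_eq, a.idx_eq _ _ h] using hp
  let ℓ : Set.Iio θ × ℕ → ℕ := fun p =>
    max ((Φ j p.1 (a.idx p.1 p.2)).height - 1) (w p).length
  let v : Mat θ (Set Str) := fun ξ k =>
    if (ξ, k) ∈ F then genTree Φ ξ (a.idx ξ k) (branch (a.br ξ k) (ℓ (ξ, k))) else Set.univ
  have hv : ∀ p ∈ F, v p.1 p.2 = genTree Φ p.1 (a.idx p.1 p.2) (branch (a.br p.1 p.2) (ℓ p)) :=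
    fun p hp => if_pos hp
  have hvF : ∀ p ∈ treeSupp v, p ∈ F := fun p hp => by
    by_contra h
    exact hp (if_neg h)
  refine ⟨v, ⟨hF.subset hvF, fun p hp => ⟨_, _, hv p (hvF p hp)⟩⟩, fun ξ k => ?_, s, ?_,
    (hs.mono fun ξ k => ?_).forcesPrefix⟩
  · by_cases h : u ξ k = Set.univ
    · rw [h]
      exact Set.subset_univ _
    · rw [hv (ξ, k) (.inl h)]
      obtain ⟨h1, h2⟩ := ha (ξ, k) h
      simp only at h1 h2
      refine (hΦ.genTree_anti (s := w (ξ, k)) ?_).trans (h1 ▸ hμw (ξ, k) h)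
      conv_lhs => rw [← h2]
      exact branch_prefix _ (le_max_right _ _)
  · intro hsU
    obtain ⟨t, ⟨ht, -⟩, hst⟩ := mem_genTree.1 hsU _ (le_max_left s₀.length l)
    have hlen : (t.take l).length = l := by simp [ht]
    refine hsl (t.take l) hlen ?_
    rw [← hΦ.limTree_eq (by rw [hlen]; exact hl)]
    exact hΦ.limTree_anti (List.take_prefix _ _) hst
  · intro x hx n hn
    have hk : (ξ, k) ∈ F := .inr (by simp only [Set.mem_ofPred_eq]; omega)
    rw [hv (ξ, k) hk] at hx
    rw [← hΦ.limTree_eq (by rw [length_branch]; exact hn)]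
    refine hΦ.limTree_anti (branch_prefix _ ?_) (genTree_subset_limTree _ hx)
    have := le_max_left ((Φ j ξ (a.idx ξ k)).height - 1) (w (ξ, k)).length
    simp only [ℓ]
    omega
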